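/- **Notation.** Let $\mathrm{Ai}(z)=\frac{1}{2\pi i}\int e^{w^3/3-zw}\,dw$ be the Airy function (contour: the two rays from $e^{-i\pi/3}\infty$ through $0$ to $e^{i\pi/3}\infty$). For $x\in\mathbb R$ let $S_x=\exp\{x\partial^2+\tfrac13\partial^3\}$ be the operator with integral kernel $$S_x(u,v)=e^{\frac23x^3+x(v-u)}\,\mathrm{Ai}(v-u+x^2),$$ let $S_x^*$ be its adjoint (kernel $S_x(v,u)$), and let $S=S_0$. Let $Rf(x)=f(-x)$, $M_\beta f(x)=e^{\beta x}f(x)$, $e^{\lambda\partial}f(x)=f(x+\lambda)$, let $\chi_0,\bar\chi_0$ be multiplication by $\mathbf 1_{x>0},\mathbf 1_{x\le0}$, and regard $L^2(a,\infty)\subset L^2(\mathbb R)$ by extending functions by zero. Let $B$ be a Brownian motion with diffusion coefficient $2$. For $h:[0,\infty)\to\mathbb R$ let $\tau=\inf\{y\ge0: B(y)\le h(y)\}$, and let $S^{\mathrm{hypo}(h)}$ be the operator with kernel $$S^{\mathrm{hypo}(h)}(u,v)=\mathbb E\big[S_{-\tau}(B(\tau),v)\,\mathbf 1_{\tau<\infty}\,\big|\,B(0)=u\big].$$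 For $h_\beta(y)=2\beta|y|$ and $h^{\pm}_\beta(y)=h_\beta(\pm y)$, $y\ge0$, the soft-shock operator $K_\beta$ is the hitting operator of $h_\beta$ with split point $0$: $$K_\beta=I-\big(S-S^{\mathrm{hypo}(h^-_\beta)}\big)^*\,\chi_0\,\big(S-S^{\mathrm{hypo}(h^+_\beta)}\big),$$ considered on $L^2(b,\infty)$ for each $b\in\mathbb R$; here $S-S^{\mathrm{hypo}(h^\pm_\beta)}$ is an operator $L^2(b,\infty)\to L^2(\mathbb R)$. Finally let $$A=S^*RS,\qquad E_\beta=S_{-\beta}^*\,\bar\chi_0\,(I-R)\,S_\beta .$$ **Lemma (factorization).** Let $\beta\ge0$ and $a\in\mathbb R$. All expectations and integrals in these definitions converge absolutely, for functions in $L^2(a+\beta^2,\infty)$ in the case of $S-S^{\mathrm{hypo}(h_\beta^\pm)}$, and for functions $M_{-\beta}f$ with $f\in L^2(a,\infty)$ in the case of $A$ and $E_\beta$. On $L^2(a,\infty)$, $A$ is the GOE operator, with kernel $A(u,v)=2^{-1/3}\mathrm{Ai}\big(2^{-1/3}(u+v)\big)$. The operators $S-S^{\mathrm{hypo}(h_\beta^\pm)}:L^2(a+\beta^2,\infty)\to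 L^2(\mathbb R)$ and $M_\beta(A+E_\beta)M_{-\beta}:L^2(a,\infty)\to L^2(\mathbb R)$ are bounded, and, as operators on $L^2(a,\infty)$, $$I-e^{\beta^2\partial}K_\beta e^{-\beta^2\partial}=\big(I-M_\beta(A+E_\beta)M_{-\beta}\big)^*\,\big(I-M_\beta(A+E_\beta)M_{-\beta}\big).$$ On the right, $I-M_\beta(A+E_\beta)M_{-\beta}$ is an operator $L^2(a,\infty)\to L^2(\mathbb R)$ and $(\cdot)^*$ is its Hilbert-space adjoint; on the left, $e^{-\beta^2\partial}:L^2(a,\infty)\to L^2(a+\beta^2,\infty)$ and $e^{\beta^2\partial}:L^2(a+\beta^2,\infty)\to L^2(a,\infty)$. -/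

import Mathlib

open MeasureTheory ProbabilityTheory Set
open scoped NNReal ENNReal

noncomputable section

namespace SoftShock

/-! ### The Airy function and the kernels of `S_x = exp (x ∂² + ∂³/3)` and of the GOE operator -/

/-- The Airy function `Ai z = (1/2πi) ∮ exp (w³/3 - z w) dw`, along the two rays going from
`e^{-iπ/3} ∞` to `0` and from `0` to `e^{iπ/3} ∞`, parametrized by `w = r e^{∓iπ/3}`, `r > 0`.
The contour integral is a real number. -/
def airyAi (z : ℝ) : ℝ :=
  let ω : ℂ := Complex.exp (Complex.I * (Real.pi / 3))
  let ω' : ℂ := Complex.exp (-(Complex.I * (Real.pi / 3)))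
  ((1 / (2 * Real.pi * Complex.I)) *
    ((∫ r : ℝ in Ioi 0, Complex.exp ((r * ω) ^ 3 / 3 - z * (r * ω)) * ω) -
      ∫ r : ℝ in Ioi 0, Complex.exp ((r * ω') ^ 3 / 3 - z * (r * ω')) * ω')).re

/-- The integral kernel `S_x(u,v) = exp (2x³/3 + x (v - u)) Ai (v - u + x²)`. -/
def sKernel (x u v : ℝ) : ℝ :=
  Real.exp (2 / 3 * x ^ 3 + x * (v - u)) * airyAi (v - u + x ^ 2)

/-- The GOE kernel `2^{-1/3} Ai (2^{-1/3} (u + v))`. -/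
def goeKernel (u v : ℝ) : ℝ :=
  (2 : ℝ) ^ (-(1 / 3) : ℝ) * airyAi ((2 : ℝ) ^ (-(1 / 3) : ℝ) * (u + v))

/-! ### Operators on functions `ℝ → ℂ` -/

/-- The operator with integral kernel `k`. -/
def kernelOp (k : ℝ → ℝ → ℝ) (f : ℝ → ℂ) : ℝ → ℂ := fun u => ∫ v, (k u v : ℂ) * f v

/-- The integrals that define `kernelOp k f` all converge absolutely. -/
def KernelConverges (k : ℝ → ℝ → ℝ) (f : ℝ → ℂ) : Prop :=
  ∀ u, Integrable (fun v => (k u v : ℂ) * f v)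

/-- The transposed kernel; as all our kernels are real, it is the kernel of the adjoint. -/
def transposeKernel (k : ℝ → ℝ → ℝ) : ℝ → ℝ → ℝ := fun u v => k v u

/-- `S_x = exp (x ∂² + ∂³/3)`. -/
def opS (x : ℝ) : (ℝ → ℂ) → (ℝ → ℂ) := kernelOp (sKernel x)

/-- The adjoint `S_x^*`. -/
def opSAdj (x : ℝ) : (ℝ → ℂ) → (ℝ → ℂ) := kernelOp (transposeKernel (sKernel x))

/-- The reflection `R f (u) = f (-u)`. -/
def opR (f : ℝ → ℂ) : ℝ → ℂ := fun u => f (-u)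

/-- Multiplication by `e^{β u}`. -/
def opM (β : ℝ) (f : ℝ → ℂ) : ℝ → ℂ := fun u => (Real.exp (β * u) : ℂ) * f u

/-- `χ̄_a`, the restriction to `(-∞, a]`. -/
def chiBar (a : ℝ) (f : ℝ → ℂ) : ℝ → ℂ := (Iic a).indicator f

/-- `A = S^* R S`, with `S = S_0`. -/
def opA (f : ℝ → ℂ) : ℝ → ℂ := opSAdj 0 (opR (opS 0 f))

/-- `E_β = S_{-β}^* χ̄_0 (I - R) S_β`. -/
def opE (β : ℝ) (f : ℝ → ℂ) : ℝ → ℂ :=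
  opSAdj (-β) (chiBar 0 (opS β f - opR (opS β f)))

/-- `M_β (A + E_β) M_{-β}`. -/
def opX (β : ℝ) (f : ℝ → ℂ) : ℝ → ℂ :=
  opM β (opA (opM (-β) f) + opE β (opM (-β) f))

/-! ### The hitting kernel

`W` is a standard Brownian motion, so that `B(y) = u + √2 W(y)` is a Brownian motion with diffusion
coefficient `2` that starts from `u`. -/

section Hitting

variable {Ω : Type*}

/-- The times `y ≥ 0` at which `B(y) ≤ h(y)`, where `B(y) = u + √2 W(y)`. -/
def hitTimes (W : ℝ≥0 → Ω → ℝ) (h : ℝ≥0 → ℝ) (u : ℝ) (ω : Ω) : Set ℝ≥0 :=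
  {y | u + √2 * W y ω ≤ h y}

open Classical in
/-- The random variable `S_{x-τ}(B(τ), v) 1{τ < ∞}`, where `τ = inf {y ≥ 0 : B(y) ≤ h(y)}`. -/
def hypoIntegrand (W : ℝ≥0 → Ω → ℝ) (h : ℝ≥0 → ℝ) (x u v : ℝ) (ω : Ω) : ℝ :=
  if (hitTimes W h u ω).Nonempty then
    let τ : ℝ≥0 := sInf (hitTimes W h u ω)
    sKernel (x - τ) (u + √2 * W τ ω) v
  else 0

/-- The kernel `S_x^{hypo(h)}(u,v) = E[S_{x-τ}(B(τ), v) 1{τ < ∞} | B(0) = u]`. -/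
def hypoKernel [MeasurableSpace Ω] (P : Measure Ω) (W : ℝ≥0 → Ω → ℝ) (h : ℝ≥0 → ℝ)
    (x u v : ℝ) : ℝ :=
  ∫ ω, hypoIntegrand W h x u v ω ∂P

/-- `S - S^{hypo(h)}`, as an operator on functions. -/
def opHit [MeasurableSpace Ω] (P : Measure Ω) (W : ℝ≥0 → Ω → ℝ) (h : ℝ≥0 → ℝ)
    (f : ℝ → ℂ) : ℝ → ℂ :=
  opS 0 f - kernelOp (hypoKernel P W h 0) f

end Hitting

/-! ### The spaces `L²(ℝ)` and `L²(a, ∞)` and their operators -/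

/-- `L²(ℝ)`. -/
abbrev L2R : Type := Lp ℂ 2 (volume : Measure ℝ)

/-- `L²(a, ∞)`. -/
abbrev L2Ioi (a : ℝ) : Type := Lp ℂ 2 (volume.restrict (Ioi a) : Measure ℝ)

/-- Extension by zero of (a representative of) `f ∈ L²(a, ∞)` to a function on `ℝ`. -/
def zeroExt {a : ℝ} (f : L2Ioi a) : ℝ → ℂ := (Ioi a).indicator f

lemma memLp_zeroExt {a : ℝ} (f : L2Ioi a) : MemLp (zeroExt f) 2 (volume : Measure ℝ) :=
  (memLp_indicator_iff_restrict measurableSet_Ioi).2 (Lp.memLp f)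

/-- The isometric inclusion `L²(a, ∞) → L²(ℝ)`, extension by zero. -/
def incl (a : ℝ) : L2Ioi a →ₗᵢ[ℂ] L2R where
  toFun f := (memLp_zeroExt f).toLp (zeroExt f)
  map_add' f g := by
    rw [← MemLp.toLp_add, MemLp.toLp_eq_toLp_iff]
    have h := (ae_restrict_iff' measurableSet_Ioi).1 (Lp.coeFn_add f g)
    filter_upwards [h] with u hu
    by_cases hm : u ∈ Ioi a
    · simp only [zeroExt, Pi.add_apply, indicator_of_mem hm]
      exact hu hm
    · simp [zeroExt, hm]
  map_smul' c f := by
    rw [RingHom.id_apply, ← MemLp.toLp_const_smul, MemLp.toLp_eq_toLp_iff]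
    have h := (ae_restrict_iff' measurableSet_Ioi).1 (Lp.coeFn_smul c f)
    filter_upwards [h] with u hu
    by_cases hm : u ∈ Ioi a
    · simp [zeroExt, hm, hu hm]
    · simp [zeroExt, hm]
  norm_map' f := by
    change ‖(memLp_zeroExt f).toLp (zeroExt f)‖ = ‖f‖
    rw [Lp.norm_toLp, Lp.norm_def, zeroExt,
      eLpNorm_indicator_eq_eLpNorm_restrict measurableSet_Ioi]

/-- The projection `χ_a` of `L²(ℝ)` onto `L²(a, ∞)`: restrict to `(a, ∞)`, then extend by zero. -/
def proj (a : ℝ) : L2R →L[ℂ] L2R :=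
  (incl a).toContinuousLinearMap ∘L LpToLpRestrictCLM ℝ ℂ ℂ volume 2 (Ioi a)

lemma measurePreserving_shift {l a b : ℝ} (h : b = a + l) :
    MeasurePreserving (fun u : ℝ => u + l) (volume.restrict (Ioi a)) (volume.restrict (Ioi b)) := by
  have := (measurePreserving_add_right (volume : Measure ℝ) l).restrict_preimage
    (measurableSet_Ioi (a := b))
  simpa [h] using this

/-- The translation `e^{l ∂} : f ↦ f(· + l)`, from `L²(b, ∞)` to `L²(a, ∞)` where `b = a + l`. -/
def shift (l : ℝ) {a b : ℝ} (h : b = a + l) : L2Ioi b →L[ℂ] L2Ioi a :=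
  (Lp.compMeasurePreservingₗᵢ ℂ (fun u : ℝ => u + l)
    (measurePreserving_shift h)).toContinuousLinearMap

/-- The bounded operator `T : L²(a, ∞) → L²(ℝ)` is the action of the operator on functions `F`. -/
def Realizes {a : ℝ} (T : L2Ioi a →L[ℂ] L2R) (F : (ℝ → ℂ) → (ℝ → ℂ)) : Prop :=
  ∀ f : L2Ioi a, T f =ᵐ[volume] F (zeroExt f)

open Classical in
/-- The bounded operator `L²(a, ∞) → L²(ℝ)` given by the operator on functions `F`. There is at most
one; the value is `0` if there is none. -/
def toL2 (F : (ℝ → ℂ) → (ℝ → ℂ)) (a : ℝ) : L2Ioi a →L[ℂ] L2R :=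
  if h : ∃ T : L2Ioi a →L[ℂ] L2R, Realizes T F then h.choose else 0

/-- The function `h_β(y) = 2β|y|`. -/
def hShock (β y : ℝ) : ℝ := 2 * β * |y|

/-- The half `h^-(y) = h(-y)`, `y ≥ 0`, of `h` to the left of the split point `0`. -/
def leftHalf (h : ℝ → ℝ) : ℝ≥0 → ℝ := fun y => h (-(y : ℝ))

/-- The half `h^+(y) = h(y)`, `y ≥ 0`, of `h` to the right of the split point `0`. -/
def rightHalf (h : ℝ → ℝ) : ℝ≥0 → ℝ := fun y => h (y : ℝ)

/-- The hitting operator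
`K^{hypo(h)} = I - (S - S^{hypo(h^-)})^* χ_{h(0)} (S - S^{hypo(h^+)})` (split point `0`)
on `L²(b, ∞)`. -/
def hittingOperator {Ω : Type*} [MeasurableSpace Ω] (P : Measure Ω) (W : ℝ≥0 → Ω → ℝ)
    (h : ℝ → ℝ) (b : ℝ) : L2Ioi b →L[ℂ] L2Ioi b :=
  1 - (toL2 (opHit P W (leftHalf h)) b).adjoint ∘L proj (h 0) ∘L
    toL2 (opHit P W (rightHalf h)) b

/-- The soft shock operator `K_β` on `L²(b, ∞)`: the hitting operator of `h_β(y) = 2β|y|`. -/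
def opK {Ω : Type*} [MeasurableSpace Ω] (P : Measure Ω) (W : ℝ≥0 → Ω → ℝ) (β b : ℝ) :
    L2Ioi b →L[ℂ] L2Ioi b :=
  hittingOperator P W (hShock β) b

end SoftShock

end

open SoftShock

/-!
Write `U_c = exp (∂³/3 - c ∂)`, the operator with kernel `Ai (v - u + c)`. The claim is that both
sides of the factorization are `D^* D`, where `D = χ_0 (I - M_{2β} R) U_c` and `c = β²`.

*The hitting side.* For the line `h(y) = 2 β y`, a Brownian motion that starts from `u ≤ 0` has
already hit, and `S^{hypo(h)}(u,v) = S(u,v)`. For `u > 0` the kernel is `e^{2βu} Ai (u + v)`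
(`hypoKernel_line_of_pos`). Indeed, on the contour `w = 2 β + r`, `r = (6/5 + i) s`, the kernel
`S_{-t}(2 β t, v)` is an integral in which `t` occurs only through `e^{-λ t}`, where
`λ = r² + 2 β r` (`sKernel_neg_line`); Fubini's theorem reduces the claim to the Laplace transform
`E [e^{-λ τ} 1{τ < ∞}] = e^{-r u}` of the hitting time (`integral_cexp_sInf_hitTimes`). The latter is
optional stopping for the martingale `exp (-r B(t) - r² t)`, carried out on finite grids of times,
whose mesh then tends to `0`, with a uniform bound on second moments. The slope `6/5 > 1` makes
`Re λ > 0`, so that the expectation converges, and `6/5 < √3` keeps the Airy integral convergent.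
Hence `S - S^{hypo(h)} = χ_0 (I - M_{2β} R) U_0` (`opHit_line`), and composing with the translation by
`β²` turns `U_0` into `U_c` (`realizes_comp_shift`).

*The side of `A` and `E_β`.* By the Fourier transform on `L²`, `U_c` is the unitary operator
`airyTransform c`, and on the functions at hand `U_c` and `U_c^* = U_c⁻¹` act through absolutely
convergent integrals against the Airy kernel (`airyTransform_toLp_ae_eq`,
`airyTransform_symm_toLp_ae_eq`). A convolution identity for the Airy function
(`integral_airyAi_mul_airyAi`) shows that `A` has the GOE kernel and that
`M_β A M_{-β} = U_c^* M_{2β} R U_c`. Together with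
`M_β E_β M_{-β} = U_c^* χ̄_0 (I - M_{2β} R) U_c` this gives
`I - M_β (A + E_β) M_{-β} = U_c^* χ_0 (I - M_{2β} R) U_c = U_c⁻¹ D` (`realizes_opX`), and the unitary
factor `U_c⁻¹` drops out of `(U_c⁻¹ D)^* (U_c⁻¹ D)`.
-/

noncomputable section

namespace SoftShock

open Complex Filter Topology FourierTransform

/-! ### Deformation of the Airy contour -/

/-- The integrand `exp (w³/3 - z w)` of the Airy function. -/
def airyPhase (z : ℝ) (w : ℂ) : ℂ := cexp (w ^ 3 / 3 - z * w)

/-- The integral of `exp (w³/3 - z w)` along the half-line `w = c + (m + i) s`, `s > 0`. -/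
def rayIntegral (z c m : ℝ) : ℂ :=
  ∫ s : ℝ in Ioi 0, airyPhase z (c + (m + I) * s) * (m + I)

lemma norm_airyPhase (z x s : ℝ) :
    ‖airyPhase z (x + s * I)‖ = Real.exp (x ^ 3 / 3 - x * s ^ 2 - z * x) := by
  rw [airyPhase, norm_exp]
  congr 1
  have : ((x : ℂ) + s * I) ^ 3 / 3 - z * (x + s * I)
      = ((x ^ 3 / 3 - x * s ^ 2 - z * x : ℝ) : ℂ) + ((x ^ 2 * s - s ^ 3 / 3 - z * s : ℝ) : ℂ) * I := by
    push_cast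
    have h3 : I ^ 3 = - I := by rw [pow_succ, I_sq]; ring
    ring_nf
    rw [I_sq, h3]
    ring
  rw [this, add_re, ofReal_re, re_ofReal_mul, I_re, mul_zero, add_zero]

lemma airyPhase_ofReal (z x : ℝ) :
    airyPhase z x = ((Real.exp (x ^ 3 / 3 - z * x) : ℝ) : ℂ) := by
  rw [airyPhase]; push_cast; rfl

lemma continuous_airyPhase (z : ℝ) : Continuous (airyPhase z) := by
  unfold airyPhase; fun_prop

lemma hasDerivAt_airyPhase (z : ℝ) (w : ℂ) :
    HasDerivAt (airyPhase z) ((w ^ 2 - z) * airyPhase z w) w := by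
  unfold airyPhase
  have h : HasDerivAt (fun w : ℂ => w ^ 3 / 3 - z * w) (w ^ 2 - z) w := by
    have h1 := ((hasDerivAt_pow 3 w).div_const 3).sub ((hasDerivAt_id w).const_mul (z : ℂ))
    convert! h1 using 1
    simp
  convert! h.cexp using 1
  ring

lemma integrable_exp_linear_sub_sq (K A : ℝ) {ε : ℝ} (hε : 0 < ε) :
    Integrable (fun s : ℝ => K * Real.exp (A * s - ε * s ^ 2)) := by
  have h := ((integrable_exp_neg_mul_sq hε).comp_sub_right (A / (2 * ε))).const_mul
    (K * Real.exp (A ^ 2 / (4 * ε)))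
  refine h.congr (Eventually.of_forall fun s => ?_)
  beta_reduce
  rw [mul_assoc, ← Real.exp_add]
  congr 2
  field_simp
  ring

lemma tendsto_exp_linear_sub_sq (K A : ℝ) {ε : ℝ} (hε : 0 < ε) :
    Tendsto (fun s : ℝ => K * Real.exp (A * s - ε * s ^ 2)) atTop (𝓝 0) := by
  rw [← mul_zero K]
  refine Tendsto.const_mul K (Real.tendsto_exp_atBot.comp ?_)
  have : (fun s : ℝ => A * s - ε * s ^ 2) = fun s => s * (A - ε * s) := by ext; ring
  rw [this]
  refine tendsto_id.atTop_mul_atBot₀ ?_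
  refine tendsto_atBot_add_const_left _ A ?_ |>.congr fun s => (sub_eq_add_neg _ _).symm
  exact tendsto_neg_atTop_atBot.comp (tendsto_id.const_mul_atTop hε)

/-- If the cubic `Re w³/3` stays below `C - ε s²` along the homotopy between the half-lines
`c₀ + (m₀ + i) s` and `c₁ + (m₁ + i) s`, the two integrals differ by an integral over a real
segment, so that their imaginary parts agree. -/
lemma rayIntegral_im_eq (z c₀ m₀ c₁ m₁ C ε : ℝ) (hε : 0 < ε)
    (hb : ∀ p ∈ Icc (0 : ℝ) 1, ∀ s : ℝ, 0 ≤ s → ∀ x : ℝ,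
      x = c₀ + m₀ * s + p * ((c₁ - c₀) + (m₁ - m₀) * s) →
      x ^ 3 / 3 - x * s ^ 2 ≤ C - ε * s ^ 2) :
    IntegrableOn (fun s : ℝ => airyPhase z (c₁ + (m₁ + I) * s) * (m₁ + I)) (Ioi 0) ∧
    (rayIntegral z c₁ m₁).im = (rayIntegral z c₀ m₀).im := by
  set x : ℝ → ℝ → ℝ := fun p s => c₀ + m₀ * s + p * ((c₁ - c₀) + (m₁ - m₀) * s) with hx
  set w : ℝ → ℝ → ℂ := fun p s => (x p s : ℂ) + s * I with hw
  set d : ℝ → ℝ := fun s => (c₁ - c₀) + (m₁ - m₀) * s with hd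
  set q : ℝ → ℂ := fun p => ((m₀ + p * (m₁ - m₀) : ℝ) : ℂ) + I with hq
  set g : ℝ → ℝ → ℂ := fun p s => airyPhase z (w p s) * q p with hg
  set G : ℝ → ℝ → ℂ := fun p s =>
    airyPhase z (w p s) * (((w p s) ^ 2 - z) * d s * q p + (m₁ - m₀ : ℝ)) with hG
  -- derivatives
  have hgp : ∀ p s, HasDerivAt (fun p => g p s) (G p s) p := by
    intro p s
    have h1 : HasDerivAt (fun p : ℝ => w p s) (d s : ℂ) p := by
      have : HasDerivAt (fun p : ℝ => x p s) (d s) p := by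
        simpa [hx, hd] using ((hasDerivAt_id p).mul_const (d s)).const_add (c₀ + m₀ * s)
      simpa [hw] using (this.ofReal_comp.add_const ((s : ℂ) * I))
    have h2 : HasDerivAt q ((m₁ - m₀ : ℝ) : ℂ) p := by
      have : HasDerivAt (fun p : ℝ => m₀ + p * (m₁ - m₀)) (m₁ - m₀) p := by
        simpa using ((hasDerivAt_id p).mul_const (m₁ - m₀)).const_add m₀
      simpa [hq] using (this.ofReal_comp.add_const I)
    have h3 := ((hasDerivAt_airyPhase z (w p s)).comp p h1).mul h2
    convert! h3 using 1
    simp only [hG, Function.comp]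
    ring
  have hgs : ∀ p s, HasDerivAt (fun s => airyPhase z (w p s) * d s) (G p s) s := by
    intro p s
    have h1 : HasDerivAt (fun s : ℝ => w p s) (q p) s := by
      have : HasDerivAt (fun s : ℝ => x p s) (m₀ + p * (m₁ - m₀)) s := by
        have := (((hasDerivAt_id s).const_mul m₀).const_add c₀).fun_add
          ((((hasDerivAt_id s).const_mul (m₁ - m₀)).const_add (c₁ - c₀)).const_mul p)
        simpa [hx] using this
      simpa [hw, hq] using (this.ofReal_comp.fun_add ((hasDerivAt_id s).ofReal_comp.mul_const I))
    have h2 : HasDerivAt (fun s => ((d s : ℝ) : ℂ)) ((m₁ - m₀ : ℝ) : ℂ) s := by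
      have : HasDerivAt d (m₁ - m₀) s := by
        simpa [hd] using ((hasDerivAt_id s).const_mul (m₁ - m₀)).const_add (c₁ - c₀)
      exact this.ofReal_comp
    have h3 := ((hasDerivAt_airyPhase z (w p s)).comp s h1).mul h2
    convert! h3 using 1
    simp only [hG, Function.comp]
    ring
  -- bounds
  obtain ⟨D, hD1, hDx, hDd, hDq⟩ : ∃ D : ℝ, 1 ≤ D ∧
      (∀ p ∈ Icc (0 : ℝ) 1, ∀ s : ℝ, 0 ≤ s → |x p s| ≤ D * (1 + s)) ∧
      (∀ s : ℝ, 0 ≤ s → |d s| ≤ D * (1 + s)) ∧ (∀ p ∈ Icc (0 : ℝ) 1, ‖q p‖ ≤ D) := by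
    refine ⟨1 + |c₀| + |m₀| + |c₁ - c₀| + |m₁ - m₀|, ?_, ?_, ?_, ?_⟩
    · have := abs_nonneg c₀; have := abs_nonneg m₀; have := abs_nonneg (c₁ - c₀)
      have := abs_nonneg (m₁ - m₀); linarith
    · intro p hp s hs
      have e1 : |x p s| ≤ |c₀| + |m₀| * s + 1 * (|c₁ - c₀| + |m₁ - m₀| * s) := by
        simp only [hx]
        refine (abs_add_le _ _).trans (add_le_add ((abs_add_le _ _).trans (add_le_add le_rfl ?_)) ?_)
        · rw [abs_mul, abs_of_nonneg hs]
        · rw [abs_mul]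
          refine mul_le_mul ?_ ?_ (abs_nonneg _) zero_le_one
          · rw [abs_of_nonneg hp.1]; exact hp.2
          · refine (abs_add_le _ _).trans (add_le_add le_rfl ?_)
            rw [abs_mul, abs_of_nonneg hs]
      have := abs_nonneg c₀; have := abs_nonneg m₀; have := abs_nonneg (c₁ - c₀)
      have := abs_nonneg (m₁ - m₀)
      nlinarith [mul_nonneg (abs_nonneg c₀) hs, mul_nonneg (abs_nonneg (c₁ - c₀)) hs]
    · intro s hs
      have e1 : |d s| ≤ |c₁ - c₀| + |m₁ - m₀| * s := by
        refine (abs_add_le _ _).trans (add_le_add le_rfl ?_)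
        rw [abs_mul, abs_of_nonneg hs]
      have := abs_nonneg c₀; have := abs_nonneg m₀; have := abs_nonneg (c₁ - c₀)
      have := abs_nonneg (m₁ - m₀)
      nlinarith [mul_nonneg (abs_nonneg c₀) hs, mul_nonneg (abs_nonneg (c₁ - c₀)) hs,
        mul_nonneg (abs_nonneg m₀) hs]
    · intro p hp
      have e1 : ‖q p‖ ≤ (|m₀| + 1 * |m₁ - m₀|) + 1 := by
        simp only [hq]
        refine (norm_add_le _ _).trans (add_le_add ?_ (by simp))
        rw [norm_real, Real.norm_eq_abs]
        refine (abs_add_le _ _).trans (add_le_add le_rfl ?_)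
        rw [abs_mul]
        refine mul_le_mul ?_ le_rfl (abs_nonneg _) zero_le_one
        rw [abs_of_nonneg hp.1]; exact hp.2
      have := abs_nonneg c₀; have := abs_nonneg (c₁ - c₀)
      linarith
  have hF : ∀ p ∈ Icc (0 : ℝ) 1, ∀ s : ℝ, 0 ≤ s → ‖airyPhase z (w p s)‖ ≤
      Real.exp (C + |z| * D) * Real.exp ((|z| * D) * s - ε * s ^ 2) := by
    intro p hp s hs
    rw [hw, norm_airyPhase, ← Real.exp_add]
    apply Real.exp_le_exp.2
    have h1 := hb p hp s hs (x p s) rfl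
    have h2 : -(z * x p s) ≤ |z| * (D * (1 + s)) :=
      (neg_le_abs _).trans ((abs_mul _ _).trans_le
        (mul_le_mul_of_nonneg_left (hDx p hp s hs) (abs_nonneg z)))
    linarith
  have hone : ∀ s : ℝ, 0 ≤ s → (1 + s) ^ 3 ≤ 6 * Real.exp 1 * Real.exp s := by
    intro s hs
    have := Real.pow_div_factorial_le_exp (1 + s) (by linarith) 3
    rw [Real.exp_add] at this
    norm_num [Nat.factorial] at this
    linarith
  obtain ⟨K, A, hK0, hKg, hKd, hKG⟩ : ∃ K A : ℝ, 0 ≤ K ∧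
      (∀ p ∈ Icc (0 : ℝ) 1, ∀ s : ℝ, 0 ≤ s → ‖g p s‖ ≤ K * Real.exp (A * s - ε * s ^ 2)) ∧
      (∀ p ∈ Icc (0 : ℝ) 1, ∀ s : ℝ, 0 ≤ s →
        ‖airyPhase z (w p s) * d s‖ ≤ K * Real.exp (A * s - ε * s ^ 2)) ∧
      (∀ p ∈ Icc (0 : ℝ) 1, ∀ s : ℝ, 0 ≤ s → ‖G p s‖ ≤ K * Real.exp (A * s - ε * s ^ 2)) := by
    have key : ∀ N : ℝ, 0 ≤ N → ∀ s : ℝ, 0 ≤ s →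
        Real.exp (C + |z| * D) * Real.exp ((|z| * D) * s - ε * s ^ 2) * (N * (1 + s) ^ 3) ≤
        (Real.exp (C + |z| * D) * N * (6 * Real.exp 1)) *
          Real.exp ((|z| * D + 1) * s - ε * s ^ 2) := by
      intro N hN s hs
      have e : Real.exp ((|z| * D + 1) * s - ε * s ^ 2)
          = Real.exp ((|z| * D) * s - ε * s ^ 2) * Real.exp s := by
        rw [← Real.exp_add]; ring_nf
      rw [e]
      have := mul_le_mul_of_nonneg_left (hone s hs)
        (show 0 ≤ Real.exp (C + |z| * D) * N * Real.exp ((|z| * D) * s - ε * s ^ 2) by positivity)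
      linarith
    have hD0 : 0 ≤ D := by linarith
    set N := ((D + 1) ^ 2 + |z|) * D * D + D + |m₁ - m₀| with hN
    have hN0 : 0 ≤ N := by positivity
    have hDN : D ≤ N := by
      have : 0 ≤ ((D + 1) ^ 2 + |z|) * D * D := by positivity
      have := abs_nonneg (m₁ - m₀)
      linarith
    refine ⟨Real.exp (C + |z| * D) * N * (6 * Real.exp 1), |z| * D + 1, by positivity, ?_, ?_, ?_⟩
    · intro p hp s hs
      refine le_trans ?_ (key N hN0 s hs)
      rw [hg, norm_mul]
      refine mul_le_mul (hF p hp s hs) ?_ (norm_nonneg _) (by positivity)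
      have h1 : (1 : ℝ) ≤ (1 + s) ^ 3 := one_le_pow₀ (by linarith)
      exact (hDq p hp).trans (hDN.trans (le_mul_of_one_le_right hN0 h1))
    · intro p hp s hs
      refine le_trans ?_ (key N hN0 s hs)
      rw [norm_mul, norm_real, Real.norm_eq_abs]
      refine mul_le_mul (hF p hp s hs) ?_ (abs_nonneg _) (by positivity)
      have h1 : (1 + s) ≤ (1 + s) ^ 3 := by nlinarith [mul_nonneg hs hs, mul_nonneg hs (mul_nonneg hs hs)]
      exact (hDd s hs).trans (mul_le_mul hDN h1 (by linarith) hN0)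
    · intro p hp s hs
      refine le_trans ?_ (key N hN0 s hs)
      rw [hG, norm_mul]
      refine mul_le_mul (hF p hp s hs) ?_ (norm_nonneg _) (by positivity)
      have hw1 : ‖w p s‖ ≤ (D + 1) * (1 + s) := by
        refine (norm_add_le _ _).trans ?_
        rw [norm_mul, norm_real, norm_real, norm_I, Real.norm_eq_abs, Real.norm_eq_abs,
          abs_of_nonneg hs]
        have := hDx p hp s hs
        linarith
      have hw2 : ‖(w p s) ^ 2 - z‖ ≤ ((D + 1) ^ 2 + |z|) * (1 + s) ^ 2 := by
        refine (norm_sub_le _ _).trans ?_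
        rw [norm_pow, norm_real, Real.norm_eq_abs]
        have e1 := pow_le_pow_left₀ (norm_nonneg _) hw1 2
        have e2 : |z| ≤ |z| * (1 + s) ^ 2 :=
          le_mul_of_one_le_right (abs_nonneg z) (one_le_pow₀ (by linarith))
        rw [mul_pow] at e1
        linarith
      have h3 : ‖((w p s) ^ 2 - z) * d s * q p‖ ≤
          ((D + 1) ^ 2 + |z|) * (1 + s) ^ 2 * (D * (1 + s)) * D := by
        rw [norm_mul, norm_mul, norm_real, Real.norm_eq_abs]
        refine mul_le_mul (mul_le_mul hw2 (hDd s hs) (abs_nonneg _) (by positivity)) (hDq p hp)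
          (norm_nonneg _) (by positivity)
      refine (norm_add_le _ _).trans ?_
      rw [norm_real, Real.norm_eq_abs]
      have e2 : D + |m₁ - m₀| ≤ (D + |m₁ - m₀|) * (1 + s) ^ 3 :=
          le_mul_of_one_le_right (by positivity) (one_le_pow₀ (by linarith))
      rw [hN]
      nlinarith
  have hcx : Continuous (fun y : ℝ × ℝ => w y.1 y.2) := by
    simp only [hw, hx]; fun_prop
  have hcG : Continuous (fun y : ℝ × ℝ => G y.1 y.2) := by
    have := (continuous_airyPhase z).comp hcx
    simp only [hG, hd, hq]
    simp only [Function.comp_def] at this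
    fun_prop
  have hcg : ∀ p, Continuous (g p) := by
    intro p
    have := (continuous_airyPhase z).comp (hcx.comp (Continuous.prodMk_right p))
    simp only [hg]
    simp only [Function.comp_def] at this
    fun_prop
  have hint := integrable_exp_linear_sub_sq K A hε
  have hgi : ∀ p ∈ Icc (0 : ℝ) 1, IntegrableOn (g p) (Ioi 0) := by
    intro p hp
    refine Integrable.mono' hint.integrableOn (hcg p).aestronglyMeasurable ?_
    exact (ae_restrict_iff' measurableSet_Ioi).2 (Eventually.of_forall fun s hs =>
      hKg p hp s (le_of_lt hs))
  have hGi : ∀ p ∈ Icc (0 : ℝ) 1, IntegrableOn (G p) (Ioi 0) := by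
    intro p hp
    refine Integrable.mono' hint.integrableOn
      (hcG.comp (Continuous.prodMk_right p)).aestronglyMeasurable ?_
    exact (ae_restrict_iff' measurableSet_Ioi).2 (Eventually.of_forall fun s hs =>
      hKG p hp s (le_of_lt hs))
  have hGprod : Integrable (Function.uncurry G)
      ((volume.restrict (Ioc (0 : ℝ) 1)).prod (volume.restrict (Ioi (0 : ℝ)))) := by
    have hb1 : Integrable (fun y : ℝ × ℝ => (1 : ℝ) * (K * Real.exp (A * y.2 - ε * y.2 ^ 2)))
        ((volume.restrict (Ioc (0 : ℝ) 1)).prod (volume.restrict (Ioi (0 : ℝ)))) :=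
      Integrable.mul_prod (f := fun _ : ℝ => (1 : ℝ)) (integrable_const _) hint.integrableOn
    refine hb1.mono' hcG.aestronglyMeasurable ?_
    rw [Measure.prod_restrict]
    refine (ae_restrict_iff' (measurableSet_Ioc.prod measurableSet_Ioi)).2
      (Eventually.of_forall fun y hy => ?_)
    rw [one_mul]
    exact hKG y.1 ⟨le_of_lt hy.1.1, hy.1.2⟩ y.2 (le_of_lt hy.2)
  have h0 : (0 : ℝ) ∈ Icc (0 : ℝ) 1 := by simp
  have h1 : (1 : ℝ) ∈ Icc (0 : ℝ) 1 := by simp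
  have e0 : rayIntegral z c₀ m₀ = ∫ s in Ioi 0, g 0 s := by
    rw [rayIntegral]
    congr 1; ext s
    simp only [hg, hw, hx, hq]
    push_cast; ring_nf
  have e1' : ∀ s : ℝ, airyPhase z (c₁ + (m₁ + I) * s) * (m₁ + I) = g 1 s := by
    intro s
    simp only [hg, hw, hx, hq]
    push_cast; ring_nf
  have e1 : rayIntegral z c₁ m₁ = ∫ s in Ioi 0, g 1 s := by
    rw [rayIntegral]
    congr 1; ext s
    exact e1' s
  refine ⟨by simp_rw [e1']; exact hgi 1 h1, ?_⟩
  have hdiff : rayIntegral z c₁ m₁ - rayIntegral z c₀ m₀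
      = -∫ p in Ioc (0 : ℝ) 1, ((Real.exp ((x p 0) ^ 3 / 3 - z * x p 0) * (c₁ - c₀) : ℝ) : ℂ) := by
    rw [e0, e1, ← integral_sub (hgi 1 h1) (hgi 0 h0)]
    have : ∀ s, g 1 s - g 0 s = ∫ p in Ioc (0 : ℝ) 1, G p s := by
      intro s
      rw [← intervalIntegral.integral_of_le zero_le_one]
      symm
      refine intervalIntegral.integral_eq_sub_of_hasDerivAt (fun p _ => hgp p s) ?_
      exact (hcG.comp (Continuous.prodMk_left s)).intervalIntegrable _ _
    simp_rw [this]
    rw [← integral_integral_swap hGprod, ← integral_neg]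
    refine setIntegral_congr_fun measurableSet_Ioc fun p hp => ?_
    have hp' : p ∈ Icc (0 : ℝ) 1 := ⟨le_of_lt hp.1, hp.2⟩
    have := integral_Ioi_of_hasDerivAt_of_tendsto' (a := (0 : ℝ)) (m := (0 : ℂ))
      (fun s _ => hgs p s) (hGi p hp') ?_
    · rw [this, zero_sub]
      congr 1
      have : w p 0 = ((x p 0 : ℝ) : ℂ) := by simp [hw]
      rw [this, airyPhase_ofReal]
      simp [hd]
    · refine squeeze_zero_norm' ?_ (tendsto_exp_linear_sub_sq K A hε)
      filter_upwards [eventually_ge_atTop (0 : ℝ)] with s hs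
      exact hKd p hp' s hs
  have := congrArg Complex.im hdiff
  rw [integral_complex_ofReal] at this
  simp only [sub_im, neg_im, ofReal_im, neg_zero] at this
  linarith

/-! ### The Airy function on vertical and slanted contours -/

lemma airyAi_eq_rayIntegral (z : ℝ) :
    airyAi z = 1 / Real.pi * (rayIntegral z 0 (1 / √3)).im := by
  set ω : ℂ := cexp (I * (Real.pi / 3)) with hω
  set ω' : ℂ := cexp (-(I * (Real.pi / 3))) with hω'
  set J : ℂ := ∫ r : ℝ in Ioi 0, cexp ((r * ω) ^ 3 / 3 - z * (r * ω)) * ω with hJ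
  have hconj : ω' = (starRingEnd ℂ) ω := by
    rw [hω, hω', ← exp_conj]
    congr 1
    simp only [map_mul, conj_I, map_div₀, conj_ofReal]
    rw [show (starRingEnd ℂ) 3 = 3 from conj_ofNat 3]
    ring
  have hJ' : (∫ r : ℝ in Ioi 0, cexp ((r * ω') ^ 3 / 3 - z * (r * ω')) * ω')
      = (starRingEnd ℂ) J := by
    rw [hJ, ← integral_conj]
    congr 1; ext r
    rw [hconj, map_mul]
    congr 1
    rw [← exp_conj ((r * ω) ^ 3 / 3 - z * (r * ω))]
    congr 1
    simp only [map_sub, map_mul, map_div₀, map_pow, conj_ofReal]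
    rw [show (starRingEnd ℂ) 3 = 3 from conj_ofNat 3]
  have h3 : (0 : ℝ) < √3 := by positivity
  have hsq : √3 * √3 = 3 := Real.mul_self_sqrt (by norm_num)
  have hωv : ω = ((1 / 2 : ℝ) : ℂ) + ((√3 / 2 : ℝ) : ℂ) * I := by
    rw [hω, mul_comm, show (Real.pi : ℂ) / 3 = ((Real.pi / 3 : ℝ) : ℂ) by push_cast; rfl,
      exp_mul_I, ← ofReal_cos, ← ofReal_sin, Real.cos_pi_div_three, Real.sin_pi_div_three]
  have hdir : (((1 / √3 : ℝ) : ℂ) + I) = ((2 / √3 : ℝ) : ℂ) * ω := by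
    rw [hωv, mul_add, ← mul_assoc, ← ofReal_mul, ← ofReal_mul]
    have e1 : 2 / √3 * (1 / 2) = 1 / √3 := by field_simp
    have e2 : 2 / √3 * (√3 / 2) = 1 := by field_simp
    rw [e1, e2]; simp
  have hray : rayIntegral z 0 (1 / √3) = J := by
    have := integral_comp_mul_left_Ioi (fun r : ℝ => cexp ((r * ω) ^ 3 / 3 - z * (r * ω)) * ω) 0
      (show (0 : ℝ) < 2 / √3 by positivity)
    rw [mul_zero] at this
    have h2 : J = (2 / √3) • ((2 / √3)⁻¹ • J) := by
      rw [smul_smul, mul_inv_cancel₀ (by positivity), one_smul]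
    rw [h2, hJ, ← this, rayIntegral, ← integral_smul]
    refine setIntegral_congr_fun measurableSet_Ioi fun s _ => ?_
    rw [hdir, airyPhase, real_smul]
    push_cast
    ring_nf
  rw [hray, airyAi]
  change ((1 / (2 * Real.pi * I)) * (J - ∫ r : ℝ in Ioi 0,
    cexp ((r * ω') ^ 3 / 3 - z * (r * ω')) * ω')).re = _
  rw [hJ', sub_conj]
  rw [show 1 / (2 * Real.pi * I) * ((2 * J.im : ℝ) * I) = ((1 / Real.pi * J.im : ℝ) : ℂ) from ?_,
    ofReal_re]
  push_cast
  have hpi : (Real.pi : ℂ) ≠ 0 := ofReal_ne_zero.2 Real.pi_ne_zero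
  field_simp

lemma sqrt_three_inv_bounds : 1 / 2 ≤ 1 / √3 ∧ 1 / √3 ≤ 6 / 5 ∧ (1 / √3) ^ 2 = 1 / 3 := by
  have h3 : (0 : ℝ) < √3 := by positivity
  have hsq : √3 * √3 = 3 := Real.mul_self_sqrt (by norm_num)
  refine ⟨?_, ?_, ?_⟩
  · rw [div_le_div_iff₀ (by norm_num) h3]; nlinarith
  · rw [div_le_div_iff₀ h3 (by norm_num)]; nlinarith
  · rw [div_pow, pow_two √3, hsq]; norm_num

/-- The Airy function as an integral over the vertical half-line `Re w = k`, `Im w > 0`. -/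
lemma airyAi_eq_vertical_half (z : ℝ) {k : ℝ} (hk : 0 < k) :
    IntegrableOn (fun s : ℝ => airyPhase z (k + ((0 : ℝ) + I) * s) * ((0 : ℝ) + I)) (Ioi 0) ∧
    airyAi z = 1 / Real.pi * (rayIntegral z k 0).im := by
  obtain ⟨hn1, hn2, hn3⟩ := sqrt_three_inv_bounds
  rw [airyAi_eq_rayIntegral]
  set n := 1 / √3 with hn
  have := rayIntegral_im_eq z 0 n k 0 (3 * k ^ 3) (8 / 9 * k) (by positivity) ?_
  · exact ⟨this.1, by rw [this.2]⟩
  · rintro p ⟨hp0, hp1⟩ s hs x hx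
    have hx' : x = p * k + (1 - p) * (n * s) := by rw [hx]; ring
    clear hx
    have hns : 0 ≤ n * s := by positivity
    have hx0 : 0 ≤ x := by
      rw [hx']
      have := mul_nonneg (sub_nonneg.2 hp1) hns
      positivity
    rcases le_total k (n * s) with h | h
    · have h1 : k ≤ x := by
        rw [hx']; nlinarith [mul_le_mul_of_nonneg_left h (sub_nonneg.2 hp1)]
      have h2 : x ≤ n * s := by
        rw [hx']; nlinarith [mul_le_mul_of_nonneg_left h hp0]
      have h3 : x ^ 2 ≤ s ^ 2 / 3 := by
        have := pow_le_pow_left₀ hx0 h2 2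
        rw [mul_pow, hn3] at this
        linarith
      have h4 : x ^ 3 / 3 ≤ x * (s ^ 2 / 9) := by
        have := mul_le_mul_of_nonneg_left h3 hx0
        nlinarith
      have h5 : k * s ^ 2 ≤ x * s ^ 2 := mul_le_mul_of_nonneg_right h1 (sq_nonneg s)
      have : 0 ≤ k ^ 3 := by positivity
      nlinarith
    · have h1 : x ≤ k := by
        rw [hx']; nlinarith [mul_le_mul_of_nonneg_left h (sub_nonneg.2 hp1)]
      have h2 : x ^ 3 ≤ k ^ 3 := pow_le_pow_left₀ hx0 h1 3
      have h3 : s ^ 2 ≤ 3 * k ^ 2 := by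
        have := pow_le_pow_left₀ hns h 2
        rw [mul_pow, hn3] at this
        linarith
      have h4 : k * s ^ 2 ≤ k * (3 * k ^ 2) := mul_le_mul_of_nonneg_left h3 hk.le
      have h5 : 0 ≤ x * s ^ 2 := by positivity
      have : 0 ≤ k ^ 3 := by positivity
      nlinarith

/-- On the half-line `x = d + m s`, `1/2 ≤ m ≤ 6/5`, the cubic `Re w³/3` is at most `-s³/4` up to quadratic
terms, which the cubic one absorbs. -/
lemma slanted_cubic_le {m d D s x : ℝ} (hs : 0 ≤ s) (hm1 : 1 / 2 ≤ m) (hm2 : m ≤ 6 / 5)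
    (hdD : |d| ≤ D) (hx : x = d + m * s) :
    x ^ 3 / 3 - x * s ^ 2 ≤
      16 * (D + 2 * D ^ 2 + 1) ^ 3 + 2 * D ^ 2 + D ^ 3 - 1 * s ^ 2 := by
  have hD0 : 0 ≤ D := (abs_nonneg d).trans hdD
  have e : x ^ 3 / 3 - x * s ^ 2
      = (m ^ 3 / 3 - m) * s ^ 3 + (m ^ 2 - 1) * d * s ^ 2 + m * d ^ 2 * s + d ^ 3 / 3 := by
    rw [hx]; ring
  have hmm : m ^ 2 ≤ 36 / 25 := by nlinarith
  have b1 : m ^ 3 / 3 - m ≤ - (1 / 4) := by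
    have : m * (1 / 2) ≤ m * (1 - m ^ 2 / 3) :=
      mul_le_mul_of_nonneg_left (by linarith) (by linarith)
    nlinarith
  have b2 : (m ^ 2 - 1) * d ≤ D := by
    refine (le_abs_self _).trans ?_
    rw [abs_mul]
    have : |m ^ 2 - 1| ≤ 1 := by rw [abs_le]; constructor <;> nlinarith
    calc |m ^ 2 - 1| * |d| ≤ 1 * D := mul_le_mul this hdD (abs_nonneg _) zero_le_one
      _ = D := one_mul D
  have hd2 : d ^ 2 ≤ D ^ 2 := by
    rw [← sq_abs d]; exact pow_le_pow_left₀ (abs_nonneg d) hdD 2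
  have b3 : m * d ^ 2 * s ≤ 2 * D ^ 2 * (1 + s ^ 2) := by
    have h1 : m * d ^ 2 ≤ 2 * D ^ 2 := mul_le_mul (by linarith) hd2 (sq_nonneg d) (by norm_num)
    exact mul_le_mul h1 (by nlinarith) hs (by positivity)
  have b4 : d ^ 3 / 3 ≤ D ^ 3 := by
    have h1 : d ^ 3 ≤ D ^ 3 := by
      refine (le_abs_self _).trans ?_
      rw [abs_pow]; exact pow_le_pow_left₀ (abs_nonneg d) hdD 3
    have : 0 ≤ D ^ 3 := by positivity
    linarith
  have b5 : ∀ B : ℝ, 0 ≤ B → B * s ^ 2 - 1 / 4 * s ^ 3 ≤ 16 * B ^ 3 := by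
    intro B hB0
    rcases le_total s (4 * B) with h | h
    · have h1 := mul_le_mul_of_nonneg_left (pow_le_pow_left₀ hs h 2) hB0
      have h2 : 0 ≤ s ^ 3 := by positivity
      linarith
    · have h1 := mul_le_mul_of_nonneg_right h (sq_nonneg s)
      have h2 : 0 ≤ B ^ 3 := by positivity
      linarith
  have b6 := mul_le_mul_of_nonneg_right b1 (show 0 ≤ s ^ 3 by positivity)
  have b7 := mul_le_mul_of_nonneg_right b2 (sq_nonneg s)
  have b8 := b5 (D + 2 * D ^ 2 + 1) (by positivity)
  rw [e]
  linarith

/-- The Airy function as an integral over the half-line `w = c + (6/5 + i) s`, `s > 0`. The slope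
lies strictly between `1` and `√3`: the cubic `Re w³` and the negative quadratic `-Re w²` both
decay along such a half-line. -/
lemma airyAi_eq_slanted (z c : ℝ) :
    IntegrableOn (fun s : ℝ => airyPhase z (c + ((6 / 5 : ℝ) + I) * s) * ((6 / 5 : ℝ) + I))
      (Ioi 0) ∧
    airyAi z = 1 / Real.pi * (rayIntegral z c (6 / 5)).im := by
  obtain ⟨hn1, hn2, -⟩ := sqrt_three_inv_bounds
  rw [airyAi_eq_rayIntegral]
  have := rayIntegral_im_eq z 0 (1 / √3) c (6 / 5)
    (16 * (|c| + 2 * |c| ^ 2 + 1) ^ 3 + 2 * |c| ^ 2 + |c| ^ 3) 1 one_pos ?_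
  · exact ⟨this.1, by rw [this.2]⟩
  · rintro p ⟨hp0, hp1⟩ s hs x hx
    refine slanted_cubic_le (m := 1 / √3 + p * (6 / 5 - 1 / √3)) (d := p * c) hs ?_ ?_ ?_ ?_
    · have := mul_nonneg hp0 (sub_nonneg.2 hn2); linarith
    · have := mul_nonneg (sub_nonneg.2 hp1) (sub_nonneg.2 hn2); linarith
    · rw [abs_mul, abs_of_nonneg hp0]
      exact mul_le_of_le_one_left (abs_nonneg c) hp1
    · rw [hx]; ring

/-! ### Decay and Laplace transform of the Airy function -/

lemma integrable_exp_neg_mul_abs {ε : ℝ} (hε : 0 < ε) :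
    Integrable (fun y : ℝ => Real.exp (-(ε * |y|))) := by
  rw [← integrableOn_univ, ← Iic_union_Ioi (a := (0 : ℝ)), integrableOn_union]
  constructor
  · refine (integrableOn_exp_mul_Iic hε 0).congr_fun (fun y hy => ?_) measurableSet_Iic
    have : |y| = -y := abs_of_nonpos hy
    simp only [this]; ring_nf
  · refine (integrableOn_exp_mul_Ioi (neg_lt_zero.2 hε) 0).congr_fun (fun y hy => ?_)
      measurableSet_Ioi
    have : |y| = y := abs_of_pos hy
    simp only [this]; ring_nf

/-- `exp (w³/3)` on the line `w = k + 2πiξ`. -/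
def airySymbol (k ξ : ℝ) : ℂ := cexp (((k : ℂ) + (2 * Real.pi * ξ : ℝ) * I) ^ 3 / 3)

lemma continuous_airySymbol (k : ℝ) : Continuous (airySymbol k) := by
  unfold airySymbol; fun_prop

lemma norm_airySymbol (k ξ : ℝ) :
    ‖airySymbol k ξ‖ = Real.exp (k ^ 3 / 3 - k * (2 * Real.pi * ξ) ^ 2) := by
  have := norm_airyPhase 0 k (2 * Real.pi * ξ)
  rw [airyPhase] at this
  simpa [airySymbol] using this

lemma integrable_airySymbol {k : ℝ} (hk : 0 < k) : Integrable (airySymbol k) := by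
  have h := integrable_exp_linear_sub_sq (Real.exp (k ^ 3 / 3)) 0
    (show 0 < k * (2 * Real.pi) ^ 2 by positivity)
  refine h.mono' (continuous_airySymbol k).aestronglyMeasurable (Eventually.of_forall fun ξ => ?_)
  rw [norm_airySymbol, ← Real.exp_add]
  apply le_of_eq
  congr 1
  ring

/-- The Airy function as an integral over the vertical line `Re w = k`. -/
lemma airyAi_eq_vertical (z : ℝ) {k : ℝ} (hk : 0 < k) :
    (2 * Real.pi * airyAi z : ℂ) = ∫ s : ℝ, airyPhase z (k + s * I) := by
  have he := (airyAi_eq_vertical_half z hk).2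
  set φ : ℝ → ℂ := fun s => airyPhase z (k + s * I) with hφ
  have hφ1 : rayIntegral z k 0 = (∫ s in Ioi 0, φ s) * I := by
    rw [rayIntegral, ← integral_mul_const]
    congr 1; ext s
    simp [hφ, mul_comm]
  have hconj : ∀ s, φ (-s) = (starRingEnd ℂ) (φ s) := by
    intro s
    simp only [hφ, airyPhase]
    rw [← exp_conj]
    congr 1
    simp only [map_sub, map_mul, map_div₀, map_pow, map_add, conj_ofReal, conj_I]
    rw [show (starRingEnd ℂ) 3 = 3 from conj_ofNat 3]
    push_cast; ring
  have hi : Integrable φ := by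
    have h := integrable_exp_linear_sub_sq (Real.exp (k ^ 3 / 3 - z * k)) 0 hk
    have hc : Continuous φ := (continuous_airyPhase z).comp (by fun_prop)
    refine h.mono' hc.aestronglyMeasurable (Eventually.of_forall fun s => ?_)
    rw [hφ, norm_airyPhase, ← Real.exp_add]
    apply le_of_eq
    congr 1
    ring
  rw [← intervalIntegral.integral_Iic_add_Ioi hi.integrableOn hi.integrableOn (b := 0)]
  have h1 : ∫ s in Iic 0, φ s = (starRingEnd ℂ) (∫ s in Ioi 0, φ s) := by
    rw [← integral_conj, ← neg_zero, ← integral_comp_neg_Ioi]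
    simp_rw [hconj, neg_zero]
  rw [h1, he, hφ1, add_comm, add_conj]
  have hpi : (Real.pi : ℂ) ≠ 0 := ofReal_ne_zero.2 Real.pi_ne_zero
  push_cast
  simp
  field_simp

lemma exp_mul_airyAi_eq_fourier {k : ℝ} (hk : 0 < k) (z : ℝ) :
    ((Real.exp (k * z) * airyAi z : ℝ) : ℂ) = 𝓕 (airySymbol k) z := by
  have h := airyAi_eq_vertical z hk
  have h2 : ∫ s : ℝ, airyPhase z (k + s * I)
      = ((2 * Real.pi : ℝ) : ℂ) * (cexp (-(k * z)) * 𝓕 (airySymbol k) z) := by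
    have h3 := Measure.integral_comp_mul_left (fun s : ℝ => airyPhase z (k + s * I)) (2 * Real.pi)
    rw [abs_of_pos (by positivity)] at h3
    have h4 : ∫ s : ℝ, airyPhase z (k + s * I) = ((2 * Real.pi : ℝ) : ℂ) *
        ∫ ξ : ℝ, airyPhase z (k + (2 * Real.pi * ξ : ℝ) * I) := by
      rw [h3, ← real_smul, smul_smul, mul_inv_cancel₀ (by positivity), one_smul]
    rw [h4, Real.fourier_real_eq_integral_exp_smul]
    congr 1
    rw [← integral_const_mul]
    congr 1; ext ξ
    rw [smul_eq_mul, airyPhase, airySymbol, ← exp_add, ← exp_add]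
    congr 1
    push_cast
    ring
  rw [h2] at h
  have hpi : (Real.pi : ℂ) ≠ 0 := ofReal_ne_zero.2 Real.pi_ne_zero
  have h5 : (airyAi z : ℂ) = cexp (-(k * z)) * 𝓕 (airySymbol k) z := by
    have : (2 * Real.pi : ℂ) ≠ 0 := by simp [hpi]
    apply mul_left_cancel₀ this
    rw [h]; push_cast; rfl
  push_cast
  rw [h5, ← mul_assoc, ← exp_add]
  simp

/-- `Ai` decays faster than any exponential at `+∞` and grows slower than any exponential at
`-∞`. -/
lemma exists_abs_airyAi_le {k : ℝ} (hk : 0 < k) :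
    ∃ C, 0 < C ∧ ∀ z, |airyAi z| ≤ C * Real.exp (-(k * z)) := by
  refine ⟨(∫ ξ, ‖airySymbol k ξ‖) + 1, ?_, fun z => ?_⟩
  · have : 0 ≤ ∫ ξ, ‖airySymbol k ξ‖ := integral_nonneg fun _ => norm_nonneg _
    linarith
  · have h := congrArg norm (exp_mul_airyAi_eq_fourier hk z)
    rw [norm_real, norm_mul, Real.norm_eq_abs, Real.norm_eq_abs, Real.abs_exp] at h
    have h2 : ‖𝓕 (airySymbol k) z‖ ≤ ∫ ξ, ‖airySymbol k ξ‖ := by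
      rw [Real.fourier_real_eq_integral_exp_smul]
      refine (norm_integral_le_integral_norm _).trans (le_of_eq ?_)
      congr 1; ext ξ
      rw [norm_smul, norm_exp_ofReal_mul_I, one_mul]
    rw [← h] at h2
    rw [Real.exp_neg, ← div_eq_mul_inv, le_div_iff₀ (Real.exp_pos _)]
    linarith

lemma continuous_airyAi : Continuous airyAi := by
  have h : Continuous (𝓕 (airySymbol 1)) :=
    VectorFourier.fourierIntegral_continuous Real.continuous_fourierChar
      (innerSL ℝ).continuous₂ (integrable_airySymbol one_pos)
  have h2 : airyAi = fun z => Real.exp (-z) * (𝓕 (airySymbol 1) z).re := by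
    ext z
    rw [← exp_mul_airyAi_eq_fourier one_pos, ofReal_re, one_mul, ← mul_assoc, ← Real.exp_add]
    simp
  rw [h2]
  fun_prop

lemma integrable_exp_mul_airyAi {k : ℝ} (hk : 0 < k) :
    Integrable (fun z => Real.exp (k * z) * airyAi z) := by
  obtain ⟨C₁, hC₁, h₁⟩ := exists_abs_airyAi_le (half_pos hk)
  obtain ⟨C₂, hC₂, h₂⟩ := exists_abs_airyAi_le (show 0 < 2 * k by positivity)
  refine ((integrable_exp_neg_mul_abs (half_pos hk)).const_mul (C₁ + C₂)).mono'
    ((Real.continuous_exp.comp (continuous_const_mul k)).mul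
      continuous_airyAi).aestronglyMeasurable (Eventually.of_forall fun z => ?_)
  rw [norm_mul, Real.norm_eq_abs, Real.norm_eq_abs, Real.abs_exp]
  rcases le_total z 0 with hz | hz
  · calc Real.exp (k * z) * |airyAi z|
        ≤ Real.exp (k * z) * (C₁ * Real.exp (-(k / 2 * z))) := by gcongr; exact h₁ z
      _ = C₁ * Real.exp (-(k / 2 * |z|)) := by
          rw [abs_of_nonpos hz, mul_left_comm, ← Real.exp_add]; ring_nf
      _ ≤ _ := by gcongr; linarith
  · calc Real.exp (k * z) * |airyAi z|
        ≤ Real.exp (k * z) * (C₂ * Real.exp (-(2 * k * z))) := by gcongr; exact h₂ z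
      _ = C₂ * Real.exp (-(k * z)) := by
          rw [mul_left_comm, ← Real.exp_add]; ring_nf
      _ ≤ (C₁ + C₂) * Real.exp (-(k / 2 * |z|)) := by
          rw [abs_of_nonneg hz]
          gcongr
          · linarith
          · linarith

/-- The two-sided Laplace transform of the Airy function is `exp (w³/3)`, `Re w > 0`. -/
lemma integral_cexp_mul_airyAi {w : ℂ} (hw : 0 < w.re) :
    ∫ y : ℝ, cexp (w * y) * airyAi y = cexp (w ^ 3 / 3) := by
  set k := w.re
  set ξ := w.im / (2 * Real.pi) with hξ
  have hF : 𝓕 (airySymbol k) = fun z => ((Real.exp (k * z) * airyAi z : ℝ) : ℂ) := by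
    ext z; exact (exp_mul_airyAi_eq_fourier hw z).symm
  have hpi : Real.pi ≠ 0 := Real.pi_ne_zero
  have hwξ : w = k + (2 * Real.pi * ξ : ℝ) * I := by
    have : 2 * Real.pi * ξ = w.im := by rw [hξ]; field_simp
    rw [this, re_add_im]
  have h := congrFun ((continuous_airySymbol k).fourierInv_fourier_eq (integrable_airySymbol hw)
    (by rw [hF]; exact (integrable_exp_mul_airyAi hw).ofReal)) ξ
  rw [hF, Real.fourierInv_eq_fourier_neg, Real.fourier_real_eq_integral_exp_smul, airySymbol,
    ← hwξ] at h
  rw [← h]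
  congr 1; ext y
  push_cast
  rw [smul_eq_mul, ← mul_assoc, ← exp_add]
  congr 2
  conv_lhs => rw [hwξ]
  push_cast
  ring

/-! ### The GOE kernel as a convolution of Airy functions -/

/-- The GOE kernel as an integral over the vertical line `Re w = k`: the substitution
`w ↦ 2^{1/3} w` turns the cubic `w³/3` into `2 w³/3`. -/
lemma goeKernel_eq (u v : ℝ) {k : ℝ} (hk : 0 < k) :
    (2 * Real.pi * goeKernel u v : ℂ)
      = ∫ s : ℝ, cexp (2 * ((k : ℂ) + s * I) ^ 3 / 3 - (u + v : ℝ) * (k + s * I)) := by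
  set r : ℝ := (2 : ℝ) ^ (-(1 / 3) : ℝ) with hr
  have hr0 : 0 < r := by positivity
  have hr3 : r⁻¹ ^ 3 = 2 := by
    rw [hr, Real.rpow_neg (by norm_num), inv_inv, ← Real.rpow_natCast, ← Real.rpow_mul (by norm_num)]
    norm_num
  have h := airyAi_eq_vertical (r * (u + v)) (show 0 < r⁻¹ * k by positivity)
  have h3 := Measure.integral_comp_mul_left
    (fun s : ℝ => airyPhase (r * (u + v)) ((r⁻¹ * k : ℝ) + s * I)) r⁻¹
  rw [← h, inv_inv, abs_of_pos hr0] at h3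
  have h4 : (2 * Real.pi * goeKernel u v : ℂ) = r • (2 * Real.pi * airyAi (r * (u + v)) : ℂ) := by
    rw [goeKernel, ← hr, real_smul]; push_cast; ring
  rw [h4, ← h3]
  congr 1; ext s
  rw [airyPhase]
  congr 1
  have hr3' : (r : ℂ)⁻¹ ^ 3 = 2 := by exact_mod_cast hr3
  have hrr : (r : ℂ) * (r : ℂ)⁻¹ = 1 := mul_inv_cancel₀ (ofReal_ne_zero.2 hr0.ne')
  push_cast
  have e1 : ((r : ℂ)⁻¹ * k + (r : ℂ)⁻¹ * s * I) ^ 3 = (r : ℂ)⁻¹ ^ 3 * (k + s * I) ^ 3 := by ring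
  have e2 : (r : ℂ) * (u + v) * ((r : ℂ)⁻¹ * k + (r : ℂ)⁻¹ * s * I)
      = (r : ℂ) * (r : ℂ)⁻¹ * ((u + v) * (k + s * I)) := by ring
  rw [e1, e2, hr3', hrr]
  ring

/-- The convolution identity behind `S_{-β}^* R S_β = S^* R S`. -/
lemma integral_airyAi_mul_airyAi {β : ℝ} (hβ : 0 ≤ β) (u v : ℝ) :
    ∫ z : ℝ, airyAi (u - z + β ^ 2) * Real.exp (2 * β * z) * airyAi (v + z + β ^ 2)
      = Real.exp (β * (u - v)) * goeKernel u v := by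
  set c := β ^ 2 with hc
  set k := 2 * β + 1 with hk
  have hk0 : 0 < k := by positivity
  have hpi : (2 * Real.pi : ℂ) ≠ 0 := by simp [Real.pi_ne_zero]
  have hshift : Integrable (fun z : ℝ => Real.exp (u - z + c) * airyAi (u - z + c)) := by
    have := ((integrable_exp_mul_airyAi one_pos).comp_sub_left (u + c))
    refine this.congr (Eventually.of_forall fun z => ?_)
    beta_reduce
    rw [one_mul]; ring_nf
  set Φ : ℝ → ℝ → ℂ := fun z s => (airyAi (u - z + c) : ℂ) * cexp (2 * β * z) *
    airyPhase (v + z + c) (k + s * I) with hΦ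
  have hprod : Integrable (Function.uncurry Φ) ((volume : Measure ℝ).prod (volume : Measure ℝ)) := by
    have hb : Integrable (fun y : ℝ × ℝ => ‖Real.exp (u - y.1 + c) * airyAi (u - y.1 + c)‖ *
        (Real.exp (k ^ 3 / 3 - k * (v + c) - (u + c)) * Real.exp (0 * y.2 - k * y.2 ^ 2)))
        ((volume : Measure ℝ).prod (volume : Measure ℝ)) :=
      hshift.norm.mul_prod (integrable_exp_linear_sub_sq _ 0 hk0)
    refine hb.mono' ?_ (Eventually.of_forall fun y => ?_)
    · have h1 : Continuous fun y : ℝ × ℝ => airyAi (u - y.1 + c) :=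
        continuous_airyAi.comp (by fun_prop)
      have h2 : Continuous fun y : ℝ × ℝ => airyPhase (v + y.1 + c) (k + y.2 * I) := by
        unfold airyPhase; fun_prop
      have : Continuous (Function.uncurry Φ) := by
        simp only [Function.uncurry_def, hΦ]
        fun_prop
      exact this.aestronglyMeasurable
    · rw [Function.uncurry, hΦ]
      beta_reduce
      rw [norm_mul, norm_mul, norm_airyPhase, norm_real, norm_mul, Real.norm_eq_abs,
        Real.norm_eq_abs, Real.abs_exp, norm_exp]
      have e : ((2 * (β : ℂ) * (y.1 : ℂ))).re = 2 * β * y.1 := by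
        rw [show (2 * (β : ℂ) * (y.1 : ℂ)) = ((2 * β * y.1 : ℝ) : ℂ) by push_cast; rfl, ofReal_re]
      rw [e]
      apply le_of_eq
      have : Real.exp (2 * β * y.1) * Real.exp (k ^ 3 / 3 - k * y.2 ^ 2 - (v + y.1 + c) * k)
        = Real.exp (u - y.1 + c) * (Real.exp (k ^ 3 / 3 - k * (v + c) - (u + c)) *
          Real.exp (0 * y.2 - k * y.2 ^ 2)) := by
        rw [← Real.exp_add, ← Real.exp_add, ← Real.exp_add]
        congr 1
        rw [hk]; ring
      rw [mul_assoc, this]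
      ring
  have hinner : ∀ s : ℝ, ∫ z : ℝ, Φ z s = cexp (β * (u - v)) *
      cexp (2 * (((β + 1 : ℝ) : ℂ) + s * I) ^ 3 / 3 - (u + v : ℝ) * ((β + 1 : ℝ) + s * I)) := by
    intro s
    set q : ℂ := ((β + 1 : ℝ) : ℂ) + s * I with hq
    have hw : ((k : ℂ) + s * I) = β + q := by rw [hq, hk]; push_cast; ring
    have hre : 0 < (q - β).re := by simp [hq]
    have hL := integral_cexp_mul_airyAi hre
    have hsub := integral_sub_left_eq_self (fun y : ℝ => cexp ((q - β) * y) * airyAi y) volume (u + c)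
    rw [hL] at hsub
    have : ∀ z : ℝ, Φ z s = cexp ((β + q) ^ 3 / 3 - (β + q) * (v + c) + (β - q) * (u + c)) *
        (cexp ((q - β) * ((u + c - z : ℝ) : ℂ)) * airyAi (u + c - z)) := by
      intro z
      simp only [hΦ]
      rw [hw, airyPhase, mul_assoc, ← exp_add, ← mul_assoc, ← exp_add, mul_comm,
        show u - z + c = u + c - z by ring]
      congr 2
      push_cast
      ring
    simp_rw [this]
    rw [integral_const_mul, hsub, ← exp_add, ← exp_add]
    congr 1
    rw [hc]
    push_cast
    ring
  have hmain : (∫ z : ℝ, ((airyAi (u - z + c) * Real.exp (2 * β * z) * airyAi (v + z + c) : ℝ) : ℂ))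
      = ((Real.exp (β * (u - v)) * goeKernel u v : ℝ) : ℂ) := by
    apply mul_left_cancel₀ hpi
    have e1 : ∀ z : ℝ, (2 * Real.pi : ℂ) *
        ((airyAi (u - z + c) * Real.exp (2 * β * z) * airyAi (v + z + c) : ℝ) : ℂ)
        = ∫ s : ℝ, Φ z s := by
      intro z
      simp only [hΦ]
      rw [integral_const_mul, ← airyAi_eq_vertical _ hk0]
      push_cast
      ring
    rw [← integral_const_mul]
    simp_rw [e1]
    rw [integral_integral_swap hprod]
    simp_rw [hinner]
    rw [integral_const_mul, ← goeKernel_eq u v (show 0 < β + 1 by positivity)]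
    push_cast
    ring
  rw [integral_complex_ofReal] at hmain
  exact_mod_cast hmain

/-! ### The Fourier transform on `L²(ℝ)` -/

section FourierL2

open scoped ContDiff

/-- Dominated convergence in `L²(ℝ)`. -/
lemma tendsto_toLp_of_dominated {f : ℕ → ℝ → ℂ} {g : ℝ → ℂ} {bound : ℝ → ℝ}
    (hf : ∀ n, MemLp (f n) 2 (volume : Measure ℝ)) (hg : MemLp g 2 (volume : Measure ℝ))
    (hb : MemLp bound 2 (volume : Measure ℝ)) (hle : ∀ n, ∀ᵐ x, ‖f n x‖ ≤ bound x)
    (hlim : ∀ᵐ x, Tendsto (fun n => f n x) atTop (𝓝 (g x))) :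
    Tendsto (fun n => (hf n).toLp (f n)) atTop (𝓝 (hg.toLp g)) := by
  rw [Lp.tendsto_Lp_iff_tendsto_eLpNorm'']
  have hsq : Tendsto (fun n => ∫⁻ x, ‖(f n - g) x‖ₑ ^ (2 : ℝ)) atTop (𝓝 0) := by
    have h0 : (0 : ℝ≥0∞) = ∫⁻ _ : ℝ, 0 := by simp
    rw [h0]
    refine tendsto_lintegral_of_dominated_convergence' (fun x => ‖2 * bound x‖ₑ ^ (2 : ℝ)) ?_ ?_ ?_ ?_
    · intro n
      exact ((hf n).1.sub hg.1).enorm.pow_const _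
    · intro n
      have hall : ∀ᵐ x, ∀ n, ‖f n x‖ ≤ bound x := ae_all_iff.2 hle
      filter_upwards [hall, hlim] with x hx hxl
      have hgx : ‖g x‖ ≤ bound x := le_of_tendsto' hxl.norm hx
      gcongr
      rw [enorm_le_iff_norm_le, Pi.sub_apply]
      refine (norm_sub_le _ _).trans ?_
      have := hx n
      rw [Real.norm_eq_abs, abs_of_nonneg (by linarith [norm_nonneg (g x)])]
      linarith
    · have := (hb.const_mul 2).2
      rw [eLpNorm_lt_top_iff_lintegral_rpow_enorm_lt_top (by norm_num) (by norm_num)] at this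
      simpa using this.ne
    · filter_upwards [hlim] with x hx
      have h1 : Tendsto (fun n => ‖(f n - g) x‖ₑ) atTop (𝓝 0) := by
        have h2 : Tendsto (fun n => f n x - g x) atTop (𝓝 0) := by
          simpa using hx.sub_const (g x)
        simpa using h2.enorm
      have := (ENNReal.continuous_rpow_const (y := 2)).tendsto (0 : ℝ≥0∞)
      have h3 := this.comp h1
      simpa [Function.comp_def] using h3
  have h := (ENNReal.continuous_rpow_const (y := 1 / 2)).tendsto (0 : ℝ≥0∞)
  have h2 := h.comp hsq
  rw [ENNReal.zero_rpow_of_pos (by norm_num)] at h2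
  refine h2.congr fun n => ?_
  rw [Function.comp, eLpNorm_eq_lintegral_rpow_enorm_toReal (by norm_num) (by norm_num)]
  simp

lemma continuous_fourier_of_integrable {f : ℝ → ℂ} (hf : Integrable f) : Continuous (𝓕 f) :=
  VectorFourier.fourierIntegral_continuous Real.continuous_fourierChar
    (innerSL ℝ).continuous₂ hf

lemma integral_fourier_mul_eq {f g : ℝ → ℂ} (hf : Integrable f) (hg : Integrable g) :
    ∫ ξ, 𝓕 f ξ * g ξ = ∫ x, f x * 𝓕 g x := by
  have := VectorFourier.integral_fourierIntegral_smul_eq_flip (L := innerₗ ℝ) (μ := volume)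
    (ν := volume) Real.continuous_fourierChar continuous_inner hf hg
  rw [flip_innerₗ] at this
  exact this

/-- On `L¹ ∩ L²`, the Fourier transform of `L²` is given by the Fourier integral. -/
lemma fourier_toLp_ae_eq {f : ℝ → ℂ} (h1 : Integrable f) (h2 : MemLp f 2 (volume : Measure ℝ)) :
    (𝓕 (h2.toLp f) : L2R) =ᵐ[volume] 𝓕 f := by
  refine ae_eq_of_integral_contDiff_smul_eq ((Lp.memLp _).locallyIntegrable (by norm_num))
    (continuous_fourier_of_integrable h1).locallyIntegrable fun g g_smooth g_cpt => ?_
  have hg₁ : HasCompactSupport (ofRealCLM ∘ g) := g_cpt.comp_left rfl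
  have hg₂ : ContDiff ℝ ∞ (ofRealCLM ∘ g) := by fun_prop
  set G := hg₁.toSchwartzMap hg₂ with hG
  have hGg : ∀ x, G x = (g x : ℂ) := fun x => rfl
  calc ∫ x, g x • (𝓕 (h2.toLp f) : L2R) x
      = ((𝓕 (h2.toLp f) : L2R) : TemperedDistribution ℝ ℂ) G := by
        rw [Lp.toTemperedDistribution_apply]
        simp [hGg]
    _ = 𝓕 ((h2.toLp f : L2R) : TemperedDistribution ℝ ℂ) G := by
        rw [Lp.fourier_toTemperedDistribution_eq]
    _ = ∫ x, (𝓕 G) x • (h2.toLp f) x := by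
        rw [TemperedDistribution.fourier_apply, Lp.toTemperedDistribution_apply]
    _ = ∫ x, f x * 𝓕 (G : ℝ → ℂ) x := by
        refine integral_congr_ae ?_
        filter_upwards [h2.coeFn_toLp] with x hx
        rw [hx, SchwartzMap.fourier_coe, smul_eq_mul, mul_comm]
    _ = ∫ x, 𝓕 f x * G x := (integral_fourier_mul_eq h1 G.integrable).symm
    _ = _ := by
        congr 1; ext x
        rw [hGg, real_smul, mul_comm]

/-- On `L¹ ∩ L²`, the inverse Fourier transform of `L²` is given by the Fourier integral. -/
lemma fourierInv_toLp_ae_eq {f : ℝ → ℂ} (h1 : Integrable f)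
    (h2 : MemLp f 2 (volume : Measure ℝ)) :
    (𝓕⁻ (h2.toLp f) : L2R) =ᵐ[volume] 𝓕⁻ f := by
  have hc : Continuous (𝓕⁻ f) := by
    have : 𝓕⁻ f = fun x => 𝓕 f (-x) := by ext x; rw [Real.fourierInv_eq_fourier_neg]
    rw [this]
    exact (continuous_fourier_of_integrable h1).comp continuous_neg
  refine ae_eq_of_integral_contDiff_smul_eq ((Lp.memLp _).locallyIntegrable (by norm_num))
    hc.locallyIntegrable fun g g_smooth g_cpt => ?_
  have hg₁ : HasCompactSupport (ofRealCLM ∘ g) := g_cpt.comp_left rfl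
  have hg₂ : ContDiff ℝ ∞ (ofRealCLM ∘ g) := by fun_prop
  set G := hg₁.toSchwartzMap hg₂ with hG
  have hGg : ∀ x, G x = (g x : ℂ) := fun x => rfl
  have hflip : ∫ x, f x * 𝓕⁻ (G : ℝ → ℂ) x = ∫ x, 𝓕⁻ f x * G x := by
    have := integral_fourier_mul_eq h1 (G.integrable.comp_neg (μ := volume))
    have e1 : 𝓕 (fun x => G (-x)) = 𝓕⁻ (G : ℝ → ℂ) := by
      rw [Real.fourierInv_eq_fourier_comp_neg]
    rw [e1] at this
    rw [← this, ← integral_neg_eq_self]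
    congr 1; ext x
    rw [neg_neg, Real.fourierInv_eq_fourier_neg]
  calc ∫ x, g x • (𝓕⁻ (h2.toLp f) : L2R) x
      = ((𝓕⁻ (h2.toLp f) : L2R) : TemperedDistribution ℝ ℂ) G := by
        rw [Lp.toTemperedDistribution_apply]
        simp [hGg]
    _ = 𝓕⁻ ((h2.toLp f : L2R) : TemperedDistribution ℝ ℂ) G := by
        rw [Lp.fourierInv_toTemperedDistribution_eq]
    _ = ∫ x, (𝓕⁻ G) x • (h2.toLp f) x := by
        rw [TemperedDistribution.fourierInv_apply, Lp.toTemperedDistribution_apply]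
    _ = ∫ x, f x * 𝓕⁻ (G : ℝ → ℂ) x := by
        refine integral_congr_ae ?_
        filter_upwards [h2.coeFn_toLp] with x hx
        rw [hx, SchwartzMap.fourierInv_coe, smul_eq_mul, mul_comm]
    _ = ∫ x, 𝓕⁻ f x * G x := hflip
    _ = _ := by
        congr 1; ext x
        rw [hGg, real_smul, mul_comm]

lemma memLp_mul_of_bound {m f : ℝ → ℂ} {C : ℝ} (hm : Continuous m) (hC : ∀ x, ‖m x‖ ≤ C)
    (hf : MemLp f 2 (volume : Measure ℝ)) :
    MemLp (fun x => m x * f x) 2 (volume : Measure ℝ) := by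
  refine hf.of_le_mul (c := C) (hm.aestronglyMeasurable.mul hf.1) (Eventually.of_forall fun x => ?_)
  rw [norm_mul]
  exact mul_le_mul_of_nonneg_right (hC x) (norm_nonneg _)

/-- Multiplication by a continuous function of modulus one, as a unitary operator of `L²(ℝ)`. -/
def mulUnimodular (m : ℝ → ℂ) (hm : Continuous m) (h1 : ∀ x, ‖m x‖ = 1) : L2R ≃ₗᵢ[ℂ] L2R :=
  have hle : ∀ x, ‖m x‖ ≤ 1 := fun x => (h1 x).le
  have hm' : Continuous fun x => (m x)⁻¹ :=
    hm.inv₀ fun x hx => by simpa [hx] using h1 x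
  have hle' : ∀ x, ‖(m x)⁻¹‖ ≤ 1 := fun x => by rw [norm_inv, h1 x, inv_one]
  { toFun := fun f => (memLp_mul_of_bound hm hle (Lp.memLp f)).toLp _
    invFun := fun f => (memLp_mul_of_bound hm' hle' (Lp.memLp f)).toLp _
    map_add' := fun f g => by
      rw [← MemLp.toLp_add, MemLp.toLp_eq_toLp_iff]
      filter_upwards [Lp.coeFn_add f g] with x hx
      rw [hx, Pi.add_apply, Pi.add_apply, mul_add]
    map_smul' := fun c f => by
      rw [RingHom.id_apply, ← MemLp.toLp_const_smul, MemLp.toLp_eq_toLp_iff]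
      filter_upwards [Lp.coeFn_smul c f] with x hx
      rw [hx, Pi.smul_apply, Pi.smul_apply, smul_eq_mul, smul_eq_mul]
      ring
    left_inv := fun f => by
      apply Lp.ext
      refine (MemLp.coeFn_toLp _).trans ?_
      filter_upwards [(memLp_mul_of_bound hm hle (Lp.memLp f)).coeFn_toLp] with x hx
      have : m x ≠ 0 := fun h => by simpa [h] using h1 x
      rw [hx, ← mul_assoc, inv_mul_cancel₀ this, one_mul]
    right_inv := fun f => by
      apply Lp.ext
      refine (MemLp.coeFn_toLp _).trans ?_
      filter_upwards [(memLp_mul_of_bound hm' hle' (Lp.memLp f)).coeFn_toLp] with x hx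
      have : m x ≠ 0 := fun h => by simpa [h] using h1 x
      rw [hx, ← mul_assoc, mul_inv_cancel₀ this, one_mul]
    norm_map' := fun f => by
      change ‖(memLp_mul_of_bound hm hle (Lp.memLp f)).toLp _‖ = _
      rw [Lp.norm_toLp, Lp.norm_def]
      congr 1
      refine eLpNorm_congr_norm_ae (Eventually.of_forall fun x => ?_)
      rw [norm_mul, h1, one_mul] }

lemma mulUnimodular_apply {m : ℝ → ℂ} (hm : Continuous m) (h1 : ∀ x, ‖m x‖ = 1) (f : L2R) :
    mulUnimodular m hm h1 f
      = (memLp_mul_of_bound hm (fun x => (h1 x).le) (Lp.memLp f)).toLp _ := rfl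

end FourierL2

/-! ### The unitary operator `exp (∂³/3 - c ∂)` -/

lemma memLp_indicator_exp (a : ℝ) {k : ℝ} (hk : 0 < k) :
    MemLp ((Ioi a).indicator fun v : ℝ => ((Real.exp (-(k * v)) : ℝ) : ℂ)) 2
      (volume : Measure ℝ) := by
  rw [memLp_indicator_iff_restrict measurableSet_Ioi, memLp_two_iff_integrable_sq_norm
    (by fun_prop)]
  refine (integrableOn_exp_mul_Ioi (a := -(2 * k)) (by linarith) a).congr
    (Eventually.of_forall fun v => ?_)
  beta_reduce
  rw [norm_real, Real.norm_eq_abs, Real.abs_exp, ← Real.exp_nat_mul]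
  congr 1
  push_cast
  ring

/-- A function in `L²(a, ∞)` is integrable against every decaying exponential. -/
lemma integrable_exp_mul_of_eq_zero {φ : ℝ → ℂ} (hφ : MemLp φ 2 (volume : Measure ℝ)) {a : ℝ}
    (ha : ∀ v ≤ a, φ v = 0) {k : ℝ} (hk : 0 < k) :
    Integrable fun v : ℝ => ((Real.exp (-(k * v)) : ℝ) : ℂ) * φ v := by
  refine ((memLp_indicator_exp a hk).integrable_mul hφ).congr (Eventually.of_forall fun v => ?_)
  simp only [Pi.mul_apply]
  by_cases hv : v ∈ Ioi a
  · rw [indicator_of_mem hv]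
  · rw [ha v (not_lt.1 hv), mul_zero, mul_zero]

lemma integrable_airyAi_mul {φ : ℝ → ℂ} (hφ : MemLp φ 2 (volume : Measure ℝ)) {a : ℝ}
    (ha : ∀ v ≤ a, φ v = 0) (r : ℝ) :
    Integrable fun v : ℝ => (airyAi (v + r) : ℂ) * φ v := by
  obtain ⟨C, hC, h⟩ := exists_abs_airyAi_le one_pos
  refine ((integrable_exp_mul_of_eq_zero hφ ha one_pos).norm.const_mul
    (C * Real.exp (-r))).mono' ?_ (Eventually.of_forall fun v => ?_)
  · exact (continuous_ofReal.comp (continuous_airyAi.comp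
      (continuous_add_const r))).aestronglyMeasurable.mul hφ.1
  · rw [norm_mul, norm_mul, norm_real, norm_real, Real.norm_eq_abs, Real.norm_eq_abs, Real.abs_exp,
      ← mul_assoc]
    gcongr
    refine (h _).trans (le_of_eq ?_)
    rw [mul_assoc, ← Real.exp_add]
    ring_nf

lemma norm_airyPhase_imaginary (c ξ : ℝ) :
    ‖airyPhase c ((0 : ℝ) + (2 * Real.pi * ξ : ℝ) * I)‖ = 1 := by
  rw [norm_airyPhase]; simp

/-- The unitary operator of `L²(ℝ)` with Fourier multiplier `exp (w³/3 - c w)`, `w = 2πiξ`, that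
is `exp (∂³/3 - c ∂)`. Its kernel is `Ai (v - u + c)`. -/
def airyTransform (c : ℝ) : L2R ≃ₗᵢ[ℂ] L2R :=
  (Lp.fourierTransformₗᵢ ℝ ℂ).trans
    ((mulUnimodular (fun ξ => airyPhase c ((0 : ℝ) + (2 * Real.pi * ξ : ℝ) * I))
      ((continuous_airyPhase c).comp (by fun_prop)) (norm_airyPhase_imaginary c)).trans
      (Lp.fourierTransformₗᵢ ℝ ℂ).symm)

lemma airyPhase_eq_airySymbol (c k ξ : ℝ) :
    airyPhase c (k + (2 * Real.pi * ξ : ℝ) * I)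
      = cexp (-(c * k)) * (cexp (-(2 * Real.pi * c * ξ : ℝ) * I) * airySymbol k ξ) := by
  rw [airyPhase, airySymbol, ← exp_add, ← exp_add]
  congr 1
  push_cast
  ring

/-- For `Re w = k > 0` the multiplier `exp (w³/3 - c w)` is absolutely integrable, and Fubini's
theorem identifies the operator that it defines as the one with kernel `Ai (v - u + c)`,
conjugated by `e^{-k u}`. -/
lemma fourierInv_airyPhase_mul_fourier (c : ℝ) {k : ℝ} (hk : 0 < k) {φ : ℝ → ℂ}
    (hφ : Integrable fun v : ℝ => ((Real.exp (-(k * v)) : ℝ) : ℂ) * φ v) (u : ℝ) :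
    𝓕⁻ (fun ξ => airyPhase c (k + (2 * Real.pi * ξ : ℝ) * I) *
        𝓕 (fun v : ℝ => ((Real.exp (-(k * v)) : ℝ) : ℂ) * φ v) ξ) u
      = ((Real.exp (-(k * u)) : ℝ) : ℂ) * ∫ v, (airyAi (v - u + c) : ℂ) * φ v := by
  set h : ℝ → ℂ := fun ξ => cexp ((2 * Real.pi * u * ξ : ℝ) * I) *
    airyPhase c (k + (2 * Real.pi * ξ : ℝ) * I) with hh
  have hF : ∀ v, 𝓕 h v = ((Real.exp (k * (v - u)) * airyAi (v - u + c) : ℝ) : ℂ) := by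
    intro v
    have h1 : 𝓕 h v = cexp (-(c * k)) * 𝓕 (airySymbol k) (v - u + c) := by
      rw [Real.fourier_real_eq_integral_exp_smul, Real.fourier_real_eq_integral_exp_smul,
        ← integral_const_mul]
      congr 1; ext ξ
      simp only [hh, smul_eq_mul]
      rw [airyPhase_eq_airySymbol, ← mul_assoc, ← mul_assoc, ← mul_assoc, ← mul_assoc, ← exp_add,
        ← exp_add, ← exp_add, ← exp_add]
      congr 2
      push_cast
      ring
    rw [h1, ← exp_mul_airyAi_eq_fourier hk]
    push_cast
    rw [← mul_assoc, ← exp_add]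
    congr 2
    ring
  have hhi : Integrable h := by
    have hb : Integrable fun ξ => Real.exp (-(c * k)) * ‖airySymbol k ξ‖ :=
      (integrable_airySymbol hk).norm.const_mul _
    refine hb.mono' ?_ (Eventually.of_forall fun ξ => le_of_eq ?_)
    · have : Continuous h := by
        have := continuous_airyPhase c
        simp only [hh]
        fun_prop
      exact this.aestronglyMeasurable
    · simp only [hh]
      rw [airyPhase_eq_airySymbol, norm_mul, norm_mul, norm_mul, norm_exp_ofReal_mul_I,
        ← ofReal_neg, norm_exp_ofReal_mul_I, one_mul, one_mul, norm_exp]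
      congr 2
      rw [← ofReal_mul, ← ofReal_neg, ofReal_re]
  have := integral_fourier_mul_eq hφ hhi
  rw [Real.fourierInv_eq_fourier_neg, Real.fourier_real_eq_integral_exp_smul]
  rw [← integral_const_mul]
  refine Eq.trans ?_ (this.trans ?_)
  · congr 1; ext ξ
    simp only [hh, smul_eq_mul]
    have e : cexp (((-2 * Real.pi * ξ * -u : ℝ) : ℂ) * I)
        = cexp (((2 * Real.pi * u * ξ : ℝ) : ℂ) * I) := by
      congr 2; ring_nf
    rw [e]
    ring
  · congr 1; ext v
    rw [hF]
    push_cast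
    have : cexp (-(k * u)) = cexp (-(k * v)) * cexp (k * (v - u)) := by
      rw [← exp_add]; congr 1; ring
    rw [this]
    ring

lemma norm_airyPhase_le_of_le_one {c k : ℝ} (hc : 0 ≤ c) (hk : 0 ≤ k) (hk1 : k ≤ 1) (s : ℝ) :
    ‖airyPhase c (k + s * I)‖ ≤ Real.exp 1 := by
  rw [norm_airyPhase]
  apply Real.exp_le_exp.2
  have h1 : k ^ 3 ≤ 1 := pow_le_one₀ hk hk1
  have h2 : 0 ≤ k * s ^ 2 := by positivity
  have h3 : 0 ≤ c * k := by positivity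
  linarith

/-- On `L²(a, ∞)` the unitary operator `exp (∂³/3 - c ∂)` acts through the absolutely convergent
integral against `Ai (v - u + c)`. This is the limit `k → 0` of
`fourierInv_airyPhase_mul_fourier`. -/
lemma airyTransform_toLp_ae_eq {c : ℝ} (hc : 0 ≤ c) {φ : ℝ → ℂ}
    (hφ : MemLp φ 2 (volume : Measure ℝ)) {a : ℝ} (ha : ∀ v ≤ a, φ v = 0) :
    airyTransform c (hφ.toLp φ) =ᵐ[volume]
      fun u => ∫ v, (airyAi (v - u + c) : ℂ) * φ v := by
  set κ : ℕ → ℝ := fun n => 1 / ((n : ℝ) + 1) with hκ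
  have hκ0 : ∀ n, 0 < κ n := fun n => by simp only [hκ]; positivity
  have hκ1 : ∀ n, κ n ≤ 1 := fun n => by
    simp only [hκ]
    rw [div_le_one (by positivity)]
    have : (0 : ℝ) ≤ n := by positivity
    linarith
  have hκlim : Tendsto κ atTop (𝓝 0) := tendsto_one_div_add_atTop_nhds_zero_nat
  set g : ℕ → ℝ → ℂ := fun n v => ((Real.exp (-(κ n * v)) : ℝ) : ℂ) * φ v with hg
  have hg1 : ∀ n, Integrable (g n) := fun n => integrable_exp_mul_of_eq_zero hφ ha (hκ0 n)
  have hgle : ∀ n v, ‖g n v‖ ≤ Real.exp |a| * ‖φ v‖ := by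
    intro n v
    rw [hg, norm_mul, norm_real, Real.norm_eq_abs, Real.abs_exp]
    by_cases hv : v ≤ a
    · simp [ha v hv]
    · gcongr
      have h1 : κ n * a ≤ κ n * v := mul_le_mul_of_nonneg_left (le_of_not_ge hv) (hκ0 n).le
      have h2 : -(κ n * a) ≤ |a| := by
        calc -(κ n * a) ≤ |κ n * a| := neg_le_abs _
          _ = κ n * |a| := by rw [abs_mul, abs_of_pos (hκ0 n)]
          _ ≤ 1 * |a| := mul_le_mul_of_nonneg_right (hκ1 n) (abs_nonneg a)
          _ = |a| := one_mul _
      linarith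
  have hg2 : ∀ n, MemLp (g n) 2 (volume : Measure ℝ) := fun n =>
    hφ.of_le_mul (c := Real.exp |a|) (hg1 n).1 (Eventually.of_forall (hgle n))
  have hgl : Tendsto (fun n => (hg2 n).toLp (g n)) atTop (𝓝 (hφ.toLp φ)) := by
    refine tendsto_toLp_of_dominated hg2 hφ (hφ.norm.const_mul (Real.exp |a|))
      (fun n => Eventually.of_forall (hgle n)) (Eventually.of_forall fun v => ?_)
    have h1 : Tendsto (fun n => -(κ n * v)) atTop (𝓝 0) := by
      simpa using (hκlim.mul_const v).neg
    have h2 := (continuous_ofReal.tendsto _).comp ((Real.continuous_exp.tendsto _).comp h1)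
    simpa [hg] using h2.mul_const (φ v)
  set m : ℕ → ℝ → ℂ := fun n ξ => airyPhase c (κ n + (2 * Real.pi * ξ : ℝ) * I) with hm
  have hmc : ∀ n, Continuous (m n) := fun n => (continuous_airyPhase c).comp (by fun_prop)
  have hmle : ∀ n ξ, ‖m n ξ‖ ≤ Real.exp 1 := fun n ξ =>
    norm_airyPhase_le_of_le_one hc (hκ0 n).le (hκ1 n) _
  set F : L2R := hφ.toLp φ with hF
  set G : ℕ → L2R := fun n => (hg2 n).toLp (g n) with hG
  have hFg : ∀ n, (𝓕 (G n) : L2R) =ᵐ[volume] 𝓕 (g n) := fun n =>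
    fourier_toLp_ae_eq (hg1 n) (hg2 n)
  set H : ℕ → ℝ → ℂ := fun n ξ => m n ξ * 𝓕 (g n) ξ with hH
  have hH2' : ∀ n, MemLp (fun ξ => m n ξ * (𝓕 (G n) : L2R) ξ) 2 (volume : Measure ℝ) :=
    fun n => memLp_mul_of_bound (hmc n) (hmle n) (Lp.memLp _)
  have hHae : ∀ n, (fun ξ => m n ξ * (𝓕 (G n) : L2R) ξ) =ᵐ[volume] H n := by
    intro n
    filter_upwards [hFg n] with ξ hξ
    rw [hξ]
  have hH2 : ∀ n, MemLp (H n) 2 (volume : Measure ℝ) := fun n => (hH2' n).ae_eq (hHae n)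
  have hH1 : ∀ n, Integrable (H n) := by
    intro n
    have hmi : Integrable (m n) := by
      refine ((integrable_airySymbol (hκ0 n)).norm.const_mul (Real.exp (-(c * κ n)))).mono'
        (hmc n).aestronglyMeasurable (Eventually.of_forall fun ξ => le_of_eq ?_)
      simp only [hm]
      rw [airyPhase_eq_airySymbol, norm_mul, norm_mul, ← ofReal_neg, norm_exp_ofReal_mul_I,
        one_mul, norm_exp]
      congr 2
      rw [← ofReal_mul, ← ofReal_neg, ofReal_re]
    refine hmi.mul_bdd (c := ∫ v, ‖g n v‖)
      (continuous_fourier_of_integrable (hg1 n)).aestronglyMeasurable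
      (Eventually.of_forall fun ξ => ?_)
    rw [Real.fourier_real_eq_integral_exp_smul]
    refine (norm_integral_le_integral_norm _).trans (le_of_eq ?_)
    congr 1; ext v
    rw [norm_smul, norm_exp_ofReal_mul_I, one_mul]
  -- convergence in `L²` of the regularized multipliers
  have hlim : Tendsto (fun n => (hH2 n).toLp (H n)) atTop
      (𝓝 (mulUnimodular (fun ξ => airyPhase c ((0 : ℝ) + (2 * Real.pi * ξ : ℝ) * I))
      ((continuous_airyPhase c).comp (by fun_prop)) (norm_airyPhase_imaginary c) (𝓕 F))) := by
    rw [mulUnimodular_apply]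
    have hm2 : ∀ n, MemLp (fun ξ => m n ξ * (𝓕 F : L2R) ξ) 2 (volume : Measure ℝ) :=
      fun n => memLp_mul_of_bound (hmc n) (hmle n) (Lp.memLp _)
    have hA : Tendsto (fun n => (hm2 n).toLp _) atTop (𝓝 ((memLp_mul_of_bound
        ((continuous_airyPhase c).comp (by fun_prop)) (fun ξ => (norm_airyPhase_imaginary c ξ).le)
          (Lp.memLp (𝓕 F : L2R))).toLp _)) := by
      refine tendsto_toLp_of_dominated hm2 _ ((Lp.memLp (𝓕 F : L2R)).norm.const_mul (Real.exp 1))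
        (fun n => Eventually.of_forall fun ξ => ?_) (Eventually.of_forall fun ξ => ?_)
      · rw [norm_mul]
        exact mul_le_mul_of_nonneg_right (hmle n ξ) (norm_nonneg _)
      · refine Tendsto.mul_const _ ?_
        refine ((continuous_airyPhase c).tendsto _).comp ?_
        exact ((continuous_ofReal.tendsto 0).comp hκlim).add_const _
    have hB : Tendsto (fun n => (hH2 n).toLp (H n) - (hm2 n).toLp _) atTop (𝓝 0) := by
      have h0 : Tendsto (fun n => Real.exp 1 * ‖𝓕 (G n) - 𝓕 F‖) atTop (𝓝 0) := by
        have h1 : Tendsto (fun n => 𝓕 (G n)) atTop (𝓝 (𝓕 F)) :=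
          ((Lp.fourierTransformₗᵢ ℝ ℂ).continuous.tendsto F).comp hgl
        have h2 := (tendsto_iff_norm_sub_tendsto_zero.1 h1).const_mul (Real.exp 1)
        simpa using h2
      refine squeeze_zero_norm (fun n => ?_) h0
      refine Lp.norm_le_mul_norm_of_ae_le_mul ?_
      filter_upwards [Lp.coeFn_sub ((hH2 n).toLp (H n)) ((hm2 n).toLp _), (hH2 n).coeFn_toLp,
        (hm2 n).coeFn_toLp, Lp.coeFn_sub (𝓕 (G n) : L2R) (𝓕 F), hFg n] with ξ e1 e2 e3 e4 e5
      rw [e1, Pi.sub_apply, e2, e3, e4, Pi.sub_apply, e5, ← mul_sub, norm_mul]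
      exact mul_le_mul_of_nonneg_right (hmle n ξ) (norm_nonneg _)
    simpa using hB.add hA
  have hlim2 : Tendsto (fun n => 𝓕⁻ ((hH2 n).toLp (H n))) atTop (𝓝 (airyTransform c F)) :=
    ((Lp.fourierTransformₗᵢ ℝ ℂ).symm.continuous.tendsto _).comp hlim
  obtain ⟨ns, hns, hae⟩ := (tendstoInMeasure_of_tendsto_Lp hlim2).exists_seq_tendsto_ae
  have hall : ∀ᵐ u, ∀ n, (𝓕⁻ ((hH2 n).toLp (H n)) : L2R) u = 𝓕⁻ (H n) u :=
    ae_all_iff.2 fun n => fourierInv_toLp_ae_eq (hH1 n) (hH2 n)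
  filter_upwards [hae, hall] with u hu hu2
  refine tendsto_nhds_unique hu ?_
  have h1 : Tendsto (fun n => ((Real.exp (-(κ n * u)) : ℝ) : ℂ) *
      ∫ v, (airyAi (v - u + c) : ℂ) * φ v) atTop (𝓝 (∫ v, (airyAi (v - u + c) : ℂ) * φ v)) := by
    have h1 : Tendsto (fun n => -(κ n * u)) atTop (𝓝 0) := by
      simpa using (hκlim.mul_const u).neg
    have h2 := (continuous_ofReal.tendsto _).comp ((Real.continuous_exp.tendsto _).comp h1)
    simpa using h2.mul_const (∫ v, (airyAi (v - u + c) : ℂ) * φ v)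
  refine (h1.comp hns.tendsto_atTop).congr fun n => ?_
  rw [Function.comp, hu2, ← fourierInv_airyPhase_mul_fourier c (hκ0 _) (hg1 _)]

/-! ### The inverse of `exp (∂³/3 - c ∂)` -/

lemma continuous_airyAi_comp {X : Type*} [TopologicalSpace X] {f : X → ℝ} (hf : Continuous f) :
    Continuous fun x => (airyAi (f x) : ℂ) :=
  continuous_ofReal.comp (continuous_airyAi.comp hf)

/-- Fubini's theorem applies to `∫∫ f(v) Ai (v - u + c) g(u)` as soon as `e^{-k v} f` and `e^{k u} g`
are integrable for the same `k > 0`: the bound `Ai (v - u) ≤ C e^{-k v} e^{k u}` separates. -/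
lemma integrable_prod_mul_airyAi_mul (c : ℝ) {k : ℝ} (hk : 0 < k) {f g : ℝ → ℂ}
    (hf : Integrable fun v : ℝ => ((Real.exp (-(k * v)) : ℝ) : ℂ) * f v)
    (hg : Integrable fun u : ℝ => ((Real.exp (k * u) : ℝ) : ℂ) * g u)
    (hfm : AEStronglyMeasurable f) (hgm : AEStronglyMeasurable g) :
    Integrable (fun p : ℝ × ℝ => f p.1 * ((airyAi (p.1 - p.2 + c) : ℂ) * g p.2))
      ((volume : Measure ℝ).prod (volume : Measure ℝ)) := by
  obtain ⟨C, hC, h⟩ := exists_abs_airyAi_le hk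
  refine ((hf.norm.mul_prod hg.norm).const_mul (C * Real.exp (-(k * c)))).mono' ?_
    (Eventually.of_forall fun p => ?_)
  · exact hfm.comp_fst.mul ((continuous_airyAi_comp (by fun_prop)).aestronglyMeasurable.mul
      hgm.comp_snd)
  · simp only [norm_mul, norm_real, Real.norm_eq_abs, Real.abs_exp]
    have e : Real.exp (-(k * (p.1 - p.2 + c)))
        = Real.exp (-(k * c)) * (Real.exp (-(k * p.1)) * Real.exp (k * p.2)) := by
      rw [← Real.exp_add, ← Real.exp_add]; congr 1; ring
    have h1 := h (p.1 - p.2 + c)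
    rw [e] at h1
    calc ‖f p.1‖ * (|airyAi (p.1 - p.2 + c)| * ‖g p.2‖)
        ≤ ‖f p.1‖ * ((C * (Real.exp (-(k * c)) * (Real.exp (-(k * p.1)) * Real.exp (k * p.2))))
          * ‖g p.2‖) := by gcongr
      _ = _ := by ring

lemma integrable_airyAi_sub_mul (c v : ℝ) {k : ℝ} (hk : 0 < k) {g : ℝ → ℂ}
    (hg : Integrable fun u : ℝ => ((Real.exp (k * u) : ℝ) : ℂ) * g u)
    (hgm : AEStronglyMeasurable g) :
    Integrable fun u => (airyAi (v - u + c) : ℂ) * g u := by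
  obtain ⟨C, hC, h⟩ := exists_abs_airyAi_le hk
  refine (hg.norm.const_mul (C * Real.exp (-(k * (v + c))))).mono'
    ((continuous_airyAi_comp (by fun_prop)).aestronglyMeasurable.mul hgm)
    (Eventually.of_forall fun u => ?_)
  rw [norm_mul, norm_mul, norm_real, norm_real, Real.norm_eq_abs, Real.norm_eq_abs, Real.abs_exp,
    ← mul_assoc]
  gcongr
  refine (h _).trans (le_of_eq ?_)
  rw [mul_assoc, ← Real.exp_add]
  ring_nf

lemma locallyIntegrable_integral_airyAi (c : ℝ) {k : ℝ} (hk : 0 < k) {g : ℝ → ℂ}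
    (hg : Integrable fun u : ℝ => ((Real.exp (k * u) : ℝ) : ℂ) * g u)
    (hgm : AEStronglyMeasurable g) :
    LocallyIntegrable fun v => ∫ u, (airyAi (v - u + c) : ℂ) * g u := by
  obtain ⟨C, hC, h⟩ := exists_abs_airyAi_le hk
  have hm : AEStronglyMeasurable (fun p : ℝ × ℝ => (airyAi (p.1 - p.2 + c) : ℂ) * g p.2)
      ((volume : Measure ℝ).prod (volume : Measure ℝ)) :=
    (continuous_airyAi_comp (by fun_prop)).aestronglyMeasurable.mul hgm.comp_snd
  have hb : Continuous fun v : ℝ => (C * Real.exp (-(k * c)) *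
      ∫ u, ‖((Real.exp (k * u) : ℝ) : ℂ) * g u‖) * Real.exp (-(k * v)) := by fun_prop
  refine hb.locallyIntegrable.mono hm.integral_prod_right' (Eventually.of_forall fun v => ?_)
  refine (norm_integral_le_integral_norm _).trans (le_trans ?_ (le_abs_self _))
  have h2 := integrable_airyAi_sub_mul c v hk hg hgm
  refine (integral_mono h2.norm (hg.norm.const_mul (C * Real.exp (-(k * (v + c))))) fun u => ?_).trans
    (le_of_eq ?_)
  · beta_reduce
    rw [norm_mul, norm_mul, norm_real, norm_real, Real.norm_eq_abs, Real.norm_eq_abs, Real.abs_exp,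
      ← mul_assoc]
    gcongr
    refine (h _).trans (le_of_eq ?_)
    rw [mul_assoc, ← Real.exp_add]
    ring_nf
  · rw [integral_const_mul, show -(k * (v + c)) = -(k * c) + -(k * v) by ring, Real.exp_add]
    ring

/-- The inverse of `airyTransform c`, which is also its adjoint, acts through the transposed kernel
on the functions `g` for which this kernel gives absolutely convergent integrals. -/
lemma airyTransform_symm_toLp_ae_eq {c : ℝ} (hc : 0 ≤ c) {k : ℝ} (hk : 0 < k) {g : ℝ → ℂ}
    (hg2 : MemLp g 2 (volume : Measure ℝ))
    (hg : Integrable fun u : ℝ => ((Real.exp (k * u) : ℝ) : ℂ) * g u) :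
    (airyTransform c).symm (hg2.toLp g) =ᵐ[volume]
      fun v => ∫ u, (airyAi (v - u + c) : ℂ) * g u := by
  refine ae_eq_of_integral_contDiff_smul_eq ((Lp.memLp _).locallyIntegrable (by norm_num))
    (locallyIntegrable_integral_airyAi c hk hg hg2.1) fun φ φ_smooth φ_cpt => ?_
  have hφ₁ : HasCompactSupport (fun v => (φ v : ℂ)) := φ_cpt.comp_left (g := ofReal) rfl
  have hφ₂ : Continuous (fun v => (φ v : ℂ)) := continuous_ofReal.comp φ_smooth.continuous
  have hφ : MemLp (fun v => (φ v : ℂ)) 2 (volume : Measure ℝ) :=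
    hφ₂.memLp_of_hasCompactSupport hφ₁
  obtain ⟨b, hb⟩ := φ_cpt.isCompact.bddBelow
  have ha : ∀ v ≤ b - 1, (φ v : ℂ) = 0 := by
    intro v hv
    have : v ∉ tsupport φ := fun hv' => by have := hb hv'; linarith
    rw [image_eq_zero_of_notMem_tsupport this, ofReal_zero]
  have hfub := integrable_prod_mul_airyAi_mul c hk (integrable_exp_mul_of_eq_zero hφ ha hk) hg
    hφ.1 hg2.1
  calc ∫ v, φ v • (airyTransform c).symm (hg2.toLp g) v
      = inner ℂ (hφ.toLp _) ((airyTransform c).symm (hg2.toLp g)) := by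
        rw [L2.inner_def]
        refine integral_congr_ae ?_
        filter_upwards [hφ.coeFn_toLp] with v hv
        rw [hv, RCLike.inner_apply, conj_ofReal, real_smul, mul_comm]
    _ = inner ℂ (airyTransform c (hφ.toLp _)) (hg2.toLp g) := by
        rw [← (airyTransform c).inner_map_map, LinearIsometryEquiv.apply_symm_apply]
    _ = ∫ u, ∫ v, (φ v : ℂ) * ((airyAi (v - u + c) : ℂ) * g u) := by
        rw [L2.inner_def]
        refine integral_congr_ae ?_
        filter_upwards [hg2.coeFn_toLp, airyTransform_toLp_ae_eq hc hφ ha] with u hu hu2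
        rw [hu, hu2, RCLike.inner_apply, ← integral_conj, ← integral_const_mul]
        congr 1; ext v
        rw [map_mul, conj_ofReal, conj_ofReal]
        ring
    _ = ∫ v, ∫ u, (φ v : ℂ) * ((airyAi (v - u + c) : ℂ) * g u) :=
        (integral_integral_swap hfub).symm
    _ = _ := by
        congr 1; ext v
        rw [integral_const_mul, real_smul]

/-! ### The operator `χ_0 (I - M_{2β} R) exp (∂³/3 - c ∂)` -/

/-- The action of `exp (∂³/3 - c ∂)` as an integral operator: the integral of `φ` against
`Ai (v - u + c)`. -/
def airyInt (c : ℝ) (φ : ℝ → ℂ) (u : ℝ) : ℂ := ∫ v, (airyAi (v - u + c) : ℂ) * φ v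

/-- `(I - M_{2β} R)` applied to `airyInt c φ`. -/
def reflDiff (c β : ℝ) (φ : ℝ → ℂ) (u : ℝ) : ℂ :=
  airyInt c φ u - (Real.exp (2 * β * u) : ℂ) * airyInt c φ (-u)

lemma zeroExt_eq_zero {a : ℝ} (f : L2Ioi a) : ∀ v ≤ a, zeroExt f v = 0 := fun v hv =>
  indicator_of_notMem (by simpa using hv) _

lemma incl_eq_toLp {a : ℝ} (f : L2Ioi a) : incl a f = (memLp_zeroExt f).toLp (zeroExt f) := rfl

lemma integrable_airyInt {φ : ℝ → ℂ} (hφ : MemLp φ 2 (volume : Measure ℝ)) {a : ℝ}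
    (ha : ∀ v ≤ a, φ v = 0) (c u : ℝ) :
    Integrable fun v : ℝ => (airyAi (v - u + c) : ℂ) * φ v := by
  refine (integrable_airyAi_mul hφ ha (c - u)).congr (Eventually.of_forall fun v => ?_)
  beta_reduce
  rw [show v + (c - u) = v - u + c by ring]

lemma aestronglyMeasurable_airyInt (c : ℝ) {φ : ℝ → ℂ} (hφ : AEStronglyMeasurable φ) :
    AEStronglyMeasurable (airyInt c φ) := by
  have hm : AEStronglyMeasurable (fun p : ℝ × ℝ => (airyAi (p.2 - p.1 + c) : ℂ) * φ p.2)
      ((volume : Measure ℝ).prod (volume : Measure ℝ)) :=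
    (continuous_airyAi_comp (by fun_prop)).aestronglyMeasurable.mul hφ.comp_snd
  exact hm.integral_prod_right'

/-- The image of `L²(a, ∞)` under `exp (∂³/3 - c ∂)` decays faster than any exponential at `-∞`. -/
lemma exists_norm_airyInt_le (c a : ℝ) {k : ℝ} (hk : 0 < k) :
    ∃ K, 0 ≤ K ∧ ∀ φ : ℝ → ℂ, MemLp φ 2 (volume : Measure ℝ) → (∀ v ≤ a, φ v = 0) →
      ∀ u, ‖airyInt c φ u‖ ≤ K * (eLpNorm φ 2 volume).toReal * Real.exp (k * u) := by
  obtain ⟨C, hC, h⟩ := exists_abs_airyAi_le hk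
  set e : ℝ → ℂ := (Ioi a).indicator fun v : ℝ => ((Real.exp (-(k * v)) : ℝ) : ℂ) with he
  have hem : MemLp e 2 (volume : Measure ℝ) := memLp_indicator_exp a hk
  refine ⟨C * Real.exp (-(k * c)) * (eLpNorm e 2 volume).toReal, by positivity,
    fun φ hφ ha u => ?_⟩
  have hint := integrable_exp_mul_of_eq_zero hφ ha hk
  have hcs : ∫ v, ‖((Real.exp (-(k * v)) : ℝ) : ℂ) * φ v‖
      ≤ (eLpNorm e 2 volume).toReal * (eLpNorm φ 2 volume).toReal := by
    have h1 : (fun v => ((Real.exp (-(k * v)) : ℝ) : ℂ) * φ v) = e • φ := by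
      ext v
      simp only [Pi.smul_apply', smul_eq_mul, he]
      by_cases hv : v ∈ Ioi a
      · rw [indicator_of_mem hv]
      · rw [ha v (not_lt.1 hv), mul_zero, mul_zero]
    have h2 : eLpNorm (e • φ) 1 volume ≤ eLpNorm e 2 volume * eLpNorm φ 2 volume :=
      eLpNorm_smul_le_mul_eLpNorm hφ.1 hem.1
    rw [integral_norm_eq_lintegral_enorm hint.1, ← ENNReal.toReal_mul]
    refine ENNReal.toReal_mono (ENNReal.mul_ne_top hem.2.ne hφ.2.ne) ?_
    rw [← eLpNorm_one_eq_lintegral_enorm, h1]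
    exact h2
  calc ‖airyInt c φ u‖ ≤ ∫ v, ‖(airyAi (v - u + c) : ℂ) * φ v‖ := norm_integral_le_integral_norm _
    _ ≤ ∫ v, (C * Real.exp (-(k * c)) * Real.exp (k * u)) *
          ‖((Real.exp (-(k * v)) : ℝ) : ℂ) * φ v‖ := by
        refine integral_mono (integrable_airyInt hφ ha c u).norm (hint.norm.const_mul _) fun v => ?_
        beta_reduce
        rw [norm_mul, norm_mul, norm_real, norm_real, Real.norm_eq_abs, Real.norm_eq_abs,
          Real.abs_exp, ← mul_assoc]
        gcongr
        refine (h _).trans (le_of_eq ?_)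
        rw [mul_assoc, mul_assoc, ← Real.exp_add, ← Real.exp_add]
        ring_nf
    _ = (C * Real.exp (-(k * c)) * Real.exp (k * u)) *
          ∫ v, ‖((Real.exp (-(k * v)) : ℝ) : ℂ) * φ v‖ := integral_const_mul _ _
    _ ≤ (C * Real.exp (-(k * c)) * Real.exp (k * u)) *
          ((eLpNorm e 2 volume).toReal * (eLpNorm φ 2 volume).toReal) := by gcongr
    _ = _ := by ring

lemma memLp_airyInt {c : ℝ} (hc : 0 ≤ c) {φ : ℝ → ℂ} (hφ : MemLp φ 2 (volume : Measure ℝ)) {a : ℝ}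
    (ha : ∀ v ≤ a, φ v = 0) : MemLp (airyInt c φ) 2 (volume : Measure ℝ) :=
  (Lp.memLp (airyTransform c (hφ.toLp φ))).ae_eq (airyTransform_toLp_ae_eq hc hφ ha)

/-- Translations commute with `exp (∂³/3)` and change the parameter `c`. -/
lemma airyInt_comp_shift (c d : ℝ) (φ : ℝ → ℂ) (u : ℝ) :
    airyInt c (fun v => φ (v + -d)) u = airyInt (c + d) φ u := by
  rw [airyInt, airyInt, ← integral_add_right_eq_self _ d]
  congr 1; ext v
  rw [show v + d + -d = v by ring, show v + d - u + c = v - u + (c + d) by ring]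

lemma airyInt_congr_ae {c : ℝ} {φ ψ : ℝ → ℂ} (h : φ =ᵐ[volume] ψ) : airyInt c φ = airyInt c ψ := by
  ext u
  refine integral_congr_ae ?_
  filter_upwards [h] with v hv
  rw [hv]

lemma reflDiff_congr_ae {c β : ℝ} {φ ψ : ℝ → ℂ} (h : φ =ᵐ[volume] ψ) :
    reflDiff c β φ = reflDiff c β ψ := by
  ext u; rw [reflDiff, reflDiff, airyInt_congr_ae h]

/-- For `u > 0` the reflected term of `reflDiff` decays exponentially. -/
lemma exists_norm_reflected_le (c a β : ℝ) (hβ : 0 ≤ β) (k : ℝ) (hk : 0 < k) :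
    ∃ K, 0 ≤ K ∧ ∀ φ : ℝ → ℂ, MemLp φ 2 (volume : Measure ℝ) → (∀ v ≤ a, φ v = 0) →
      ∀ u, ‖(Real.exp (2 * β * u) : ℂ) * airyInt c φ (-u)‖
        ≤ K * (eLpNorm φ 2 volume).toReal * Real.exp (-(k * u)) := by
  obtain ⟨K, hK, h⟩ := exists_norm_airyInt_le c a (show 0 < 2 * β + k by positivity)
  refine ⟨K, hK, fun φ hφ ha u => ?_⟩
  rw [norm_mul, norm_real, Real.norm_eq_abs, Real.abs_exp]
  calc Real.exp (2 * β * u) * ‖airyInt c φ (-u)‖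
      ≤ Real.exp (2 * β * u) *
        (K * (eLpNorm φ 2 volume).toReal * Real.exp ((2 * β + k) * -u)) := by
        gcongr; exact h φ hφ ha (-u)
    _ = K * (eLpNorm φ 2 volume).toReal *
        (Real.exp (2 * β * u) * Real.exp ((2 * β + k) * -u)) := by ring
    _ = _ := by rw [← Real.exp_add]; ring_nf

lemma aestronglyMeasurable_reflected (c β : ℝ) {φ : ℝ → ℂ} (hφ : AEStronglyMeasurable φ) :
    AEStronglyMeasurable fun u : ℝ => (Real.exp (2 * β * u) : ℂ) * airyInt c φ (-u) := by
  refine (Continuous.aestronglyMeasurable (by fun_prop)).mul ?_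
  exact (aestronglyMeasurable_airyInt c hφ).comp_measurePreserving
    (Measure.measurePreserving_neg volume)

/-- `M_{2β} R` maps the image of `L²(a, ∞)` under `exp (∂³/3 - c ∂)` to `L²(ℝ)`: for `u ≤ 0` the
weight is bounded, and for `u > 0` the superexponential decay at `-∞` of the image compensates it. -/
lemma memLp_reflected {c : ℝ} (hc : 0 ≤ c) {β : ℝ} (hβ : 0 ≤ β) {φ : ℝ → ℂ}
    (hφ : MemLp φ 2 (volume : Measure ℝ)) {a : ℝ} (ha : ∀ v ≤ a, φ v = 0) :
    MemLp (fun u : ℝ => (Real.exp (2 * β * u) : ℂ) * airyInt c φ (-u)) 2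
      (volume : Measure ℝ) := by
  obtain ⟨K, hK, h⟩ := exists_norm_reflected_le c a β hβ 1 one_pos
  have h1 : MemLp (fun u : ℝ => airyInt c φ (-u)) 2 (volume : Measure ℝ) :=
    (memLp_airyInt hc hφ ha).comp_measurePreserving (Measure.measurePreserving_neg volume)
  have h2 : MemLp (fun u : ℝ => ‖airyInt c φ (-u)‖ + (K * (eLpNorm φ 2 volume).toReal) *
      ‖(Ioi (0 : ℝ)).indicator (fun v : ℝ => ((Real.exp (-(1 * v)) : ℝ) : ℂ)) u‖) 2
      (volume : Measure ℝ) :=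
    h1.norm.add ((memLp_indicator_exp 0 one_pos).norm.const_mul _)
  refine h2.mono (aestronglyMeasurable_reflected c β hφ.1) (Eventually.of_forall fun u => ?_)
  refine le_trans ?_ (le_abs_self _)
  rcases le_or_gt u 0 with hu | hu
  · rw [norm_mul, norm_real, Real.norm_eq_abs, Real.abs_exp]
    have e1 : Real.exp (2 * β * u) ≤ 1 := by
      rw [Real.exp_le_one_iff]
      exact mul_nonpos_of_nonneg_of_nonpos (by positivity) hu
    have e2 := mul_le_of_le_one_left (norm_nonneg (airyInt c φ (-u))) e1
    have e3 : 0 ≤ (K * (eLpNorm φ 2 volume).toReal) *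
      ‖(Ioi (0 : ℝ)).indicator (fun v : ℝ => ((Real.exp (-(1 * v)) : ℝ) : ℂ)) u‖ := by positivity
    linarith
  · rw [indicator_of_mem (show u ∈ Ioi (0 : ℝ) from hu), norm_real, Real.norm_eq_abs, Real.abs_exp]
    have e1 := h φ hφ ha u
    have e2 := norm_nonneg (airyInt c φ (-u))
    linarith

lemma memLp_reflDiff {c : ℝ} (hc : 0 ≤ c) {β : ℝ} (hβ : 0 ≤ β) {φ : ℝ → ℂ}
    (hφ : MemLp φ 2 (volume : Measure ℝ)) {a : ℝ} (ha : ∀ v ≤ a, φ v = 0) :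
    MemLp (reflDiff c β φ) 2 (volume : Measure ℝ) :=
  (memLp_airyInt hc hφ ha).sub (memLp_reflected hc hβ hφ ha)

lemma airyInt_zeroExt_add {a : ℝ} (c : ℝ) (f g : L2Ioi a) (u : ℝ) :
    airyInt c (zeroExt (f + g)) u = airyInt c (zeroExt f) u + airyInt c (zeroExt g) u := by
  have h : zeroExt (f + g) =ᵐ[volume] zeroExt f + zeroExt g := by
    have h1 := (incl a).map_add f g
    rw [incl_eq_toLp, incl_eq_toLp, incl_eq_toLp, ← MemLp.toLp_add, MemLp.toLp_eq_toLp_iff] at h1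
    exact h1
  rw [airyInt_congr_ae h, airyInt, airyInt, airyInt,
    ← integral_add (integrable_airyInt (memLp_zeroExt f) (zeroExt_eq_zero f) c u)
      (integrable_airyInt (memLp_zeroExt g) (zeroExt_eq_zero g) c u)]
  congr 1; ext v
  rw [Pi.add_apply, mul_add]

lemma airyInt_zeroExt_smul {a : ℝ} (c : ℝ) (r : ℂ) (f : L2Ioi a) (u : ℝ) :
    airyInt c (zeroExt (r • f)) u = r * airyInt c (zeroExt f) u := by
  have h : zeroExt (r • f) =ᵐ[volume] r • zeroExt f := by
    have h1 := (incl a).map_smul r f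
    rw [incl_eq_toLp, incl_eq_toLp, ← MemLp.toLp_const_smul, MemLp.toLp_eq_toLp_iff] at h1
    exact h1
  rw [airyInt_congr_ae h, airyInt, airyInt, ← integral_const_mul]
  congr 1; ext v
  rw [Pi.smul_apply, smul_eq_mul]
  ring

/-- The operator `χ_0 (I - M_{2β} R) exp (∂³/3 - c ∂)` is bounded from `L²(a, ∞)` to `L²(ℝ)`. -/
lemma exists_realizes_reflDiff {c : ℝ} (hc : 0 ≤ c) {β : ℝ} (hβ : 0 ≤ β) (a : ℝ) :
    ∃ V : L2Ioi a →L[ℂ] L2R, Realizes V fun φ => (Ioi 0).indicator (reflDiff c β φ) := by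
  obtain ⟨K, hK, h⟩ := exists_norm_reflected_le c a β hβ 1 one_pos
  have hm : ∀ f : L2Ioi a, MemLp ((Ioi 0).indicator (reflDiff c β (zeroExt f))) 2
      (volume : Measure ℝ) := fun f =>
    (memLp_reflDiff hc hβ (memLp_zeroExt f) (zeroExt_eq_zero f)).indicator measurableSet_Ioi
  set e : L2R := (memLp_indicator_exp 0 one_pos).toLp _ with he
  let L : L2Ioi a →ₗ[ℂ] L2R :=
    { toFun := fun f => (hm f).toLp _
      map_add' := fun f g => by
        rw [← MemLp.toLp_add, MemLp.toLp_eq_toLp_iff]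
        refine Eventually.of_forall fun u => ?_
        by_cases hu : u ∈ Ioi (0 : ℝ)
        · simp only [Pi.add_apply, indicator_of_mem hu, reflDiff, airyInt_zeroExt_add]
          ring
        · simp only [Pi.add_apply, indicator_of_notMem hu, add_zero]
      map_smul' := fun r f => by
        rw [RingHom.id_apply, ← MemLp.toLp_const_smul, MemLp.toLp_eq_toLp_iff]
        refine Eventually.of_forall fun u => ?_
        by_cases hu : u ∈ Ioi (0 : ℝ)
        · simp only [Pi.smul_apply, indicator_of_mem hu, reflDiff, airyInt_zeroExt_smul,
            smul_eq_mul]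
          ring
        · simp only [Pi.smul_apply, indicator_of_notMem hu, smul_zero] }
  have hbound : ∀ f, ‖L f‖ ≤ (1 + K * ‖e‖) * ‖f‖ := by
    intro f
    have hf2 := memLp_zeroExt f
    have hnf : ‖f‖ = (eLpNorm (zeroExt f) 2 volume).toReal := by
      rw [← (incl a).norm_map f, incl_eq_toLp, Lp.norm_toLp]
    set U : L2R := airyTransform c (incl a f) with hU
    have hUn : ‖U‖ = ‖f‖ := by rw [hU, LinearIsometryEquiv.norm_map, (incl a).norm_map]
    set N : L2R := ((K * ‖f‖ : ℝ) : ℂ) • e with hN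
    have hNn : ‖N‖ = K * ‖f‖ * ‖e‖ := by
      rw [hN, norm_smul, norm_real, Real.norm_of_nonneg (by positivity)]
    set U' : L2R := (Lp.memLp U).norm.ofReal.toLp (fun x => ((‖U x‖ : ℝ) : ℂ)) with hU'
    set N' : L2R := (Lp.memLp N).norm.ofReal.toLp (fun x => ((‖N x‖ : ℝ) : ℂ)) with hN'
    have hU'n : ‖U'‖ = ‖U‖ := by
      rw [hU', Lp.norm_toLp, Lp.norm_def]
      congr 1
      exact eLpNorm_congr_norm_ae (Eventually.of_forall fun x => by simp)
    have hN'n : ‖N'‖ = ‖N‖ := by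
      rw [hN', Lp.norm_toLp, Lp.norm_def]
      congr 1
      exact eLpNorm_congr_norm_ae (Eventually.of_forall fun x => by simp)
    have hle : ‖L f‖ ≤ ‖U' + N'‖ := by
      refine Lp.norm_le_norm_of_ae_le ?_
      filter_upwards [(hm f).coeFn_toLp, Lp.coeFn_add U' N',
        ((Lp.memLp U).norm.ofReal (K := ℂ)).coeFn_toLp, ((Lp.memLp N).norm.ofReal (K := ℂ)).coeFn_toLp,
        airyTransform_toLp_ae_eq hc hf2 (zeroExt_eq_zero f),
        Lp.coeFn_smul ((K * ‖f‖ : ℝ) : ℂ) e, (memLp_indicator_exp 0 one_pos).coeFn_toLp]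
        with u h1 h2 h3 h4 h5 h6 h7
      rw [show (L f) u = _ from h1, h2, Pi.add_apply]
      rw [show U' u = _ from h3, show N' u = _ from h4]
      have hsum : ‖((‖U u‖ : ℝ) : ℂ) + ((‖N u‖ : ℝ) : ℂ)‖ = ‖U u‖ + ‖N u‖ := by
        rw [← ofReal_add, norm_real, Real.norm_eq_abs, abs_of_nonneg (by positivity)]
      refine le_of_le_of_eq ?_ hsum.symm
      by_cases hu : u ∈ Ioi (0 : ℝ)
      · rw [indicator_of_mem hu, reflDiff]
        refine (norm_sub_le _ _).trans (add_le_add ?_ ?_)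
        · rw [show U u = _ from h5]; exact le_rfl
        · rw [show N u = _ from h6, Pi.smul_apply, norm_smul, norm_real,
            Real.norm_of_nonneg (by positivity), show e u = _ from h7, indicator_of_mem hu,
            norm_real, Real.norm_eq_abs, Real.abs_exp, hnf]
          exact h _ hf2 (zeroExt_eq_zero f) u
      · rw [indicator_of_notMem hu, norm_zero]
        positivity
    refine hle.trans ((norm_add_le _ _).trans (le_of_eq ?_))
    rw [hU'n, hN'n, hUn, hNn]
    ring
  exact ⟨L.mkContinuous _ hbound, fun f => (hm f).coeFn_toLp⟩

lemma toL2_eq_of_realizes {a : ℝ} {F : (ℝ → ℂ) → (ℝ → ℂ)} {T : L2Ioi a →L[ℂ] L2R}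
    (h : Realizes T F) : toL2 F a = T := by
  have hex : ∃ T : L2Ioi a →L[ℂ] L2R, Realizes T F := ⟨T, h⟩
  rw [toL2, dif_pos hex]
  ext1 f
  exact Lp.ext ((hex.choose_spec f).trans (h f).symm)

/-! ### The operators `A` and `E_β` -/

lemma sKernel_zero (u v : ℝ) : sKernel 0 u v = airyAi (v - u + 0) := by
  simp [sKernel]

lemma opS_zero (g : ℝ → ℂ) : opS 0 g = airyInt 0 g := by
  ext u
  simp only [opS, kernelOp, airyInt, sKernel_zero]

/-- Absolute convergence of the double integral for `M_β S^* R S M_{-β}`: for `z ≤ 0` the factor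
`Ai (u - z + c)` decays, and for `z > 0` the factor `Ai (v + z + c)` beats `e^{2βz}`. -/
lemma integrable_airyAi_mul_reflected {c : ℝ} {β : ℝ} (hβ : 0 ≤ β) {φ : ℝ → ℂ}
    (hφ : MemLp φ 2 (volume : Measure ℝ)) {a : ℝ} (ha : ∀ v ≤ a, φ v = 0) (u : ℝ) :
    Integrable (fun p : ℝ × ℝ => ((airyAi (u - p.1 + c) * Real.exp (2 * β * p.1) *
      airyAi (p.2 + p.1 + c) : ℝ) : ℂ) * φ p.2)
      ((volume : Measure ℝ).prod (volume : Measure ℝ)) := by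
  have hk : 0 < 2 * β + 2 := by positivity
  obtain ⟨C₁, hC₁, h₁⟩ := exists_abs_airyAi_le one_pos
  obtain ⟨C₂, hC₂, h₂⟩ := exists_abs_airyAi_le two_pos
  obtain ⟨C₃, hC₃, h₃⟩ := exists_abs_airyAi_le hk
  set A := C₁ * C₃ * Real.exp (-(u + c) - (2 * β + 2) * c) with hA
  set B := C₂ * C₁ * Real.exp (-(2 * (u + c)) - c) with hB
  have hA0 : 0 ≤ A := by positivity
  have hB0 : 0 ≤ B := by positivity
  have i₁ := (integrable_exp_mul_of_eq_zero hφ ha hk).norm.const_mul A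
  have i₂ := (integrable_exp_mul_of_eq_zero hφ ha one_pos).norm.const_mul B
  refine ((integrable_exp_neg_mul_abs one_pos).mul_prod (i₁.add i₂)).mono' ?_
    (Eventually.of_forall fun p => ?_)
  · refine (Continuous.aestronglyMeasurable ?_).mul hφ.1.comp_snd
    have c1 : Continuous fun p : ℝ × ℝ => airyAi (u - p.1 + c) :=
      continuous_airyAi.comp (by fun_prop)
    have c2 : Continuous fun p : ℝ × ℝ => airyAi (p.2 + p.1 + c) :=
      continuous_airyAi.comp (by fun_prop)
    fun_prop
  · obtain ⟨z, v⟩ := p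
    simp only [Pi.add_apply, norm_mul, norm_real, Real.norm_eq_abs, Real.abs_exp]
    rw [← mul_assoc A, ← mul_assoc B, ← add_mul, ← mul_assoc]
    refine mul_le_mul_of_nonneg_right ?_ (norm_nonneg _)
    rcases le_or_gt z 0 with hz | hz
    · calc |airyAi (u - z + c)| * Real.exp (2 * β * z) * |airyAi (v + z + c)|
          ≤ (C₂ * Real.exp (-(2 * (u - z + c)))) * Real.exp (2 * β * z) *
            (C₁ * Real.exp (-(1 * (v + z + c)))) := by
            gcongr
            · exact h₂ _
            · exact h₁ _
        _ = (C₂ * C₁) * (Real.exp (-(2 * (u - z + c))) * Real.exp (2 * β * z) *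
            Real.exp (-(1 * (v + z + c)))) := by ring
        _ = (C₂ * C₁) * (Real.exp ((1 + 2 * β) * z) * Real.exp (-(2 * (u + c)) - c) *
            Real.exp (-(1 * v))) := by
            congr 1
            rw [← Real.exp_add, ← Real.exp_add, ← Real.exp_add, ← Real.exp_add]
            ring_nf
        _ ≤ (C₂ * C₁) * (Real.exp (-(1 * |z|)) * Real.exp (-(2 * (u + c)) - c) *
            Real.exp (-(1 * v))) := by
            gcongr
            rw [abs_of_nonpos hz]
            have := mul_nonpos_of_nonneg_of_nonpos hβ hz
            linarith
        _ = Real.exp (-(1 * |z|)) * (B * Real.exp (-(1 * v))) := by rw [hB]; ring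
        _ ≤ _ := by
            gcongr
            have : 0 ≤ A * Real.exp (-((2 * β + 2) * v)) := by positivity
            linarith
    · calc |airyAi (u - z + c)| * Real.exp (2 * β * z) * |airyAi (v + z + c)|
          ≤ (C₁ * Real.exp (-(1 * (u - z + c)))) * Real.exp (2 * β * z) *
            (C₃ * Real.exp (-((2 * β + 2) * (v + z + c)))) := by
            gcongr
            · exact h₁ _
            · exact h₃ _
        _ = (C₁ * C₃) * (Real.exp (-(1 * (u - z + c))) * Real.exp (2 * β * z) *
            Real.exp (-((2 * β + 2) * (v + z + c)))) := by ring
        _ = (C₁ * C₃) * (Real.exp (-(1 * |z|)) * Real.exp (-(u + c) - (2 * β + 2) * c) *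
            Real.exp (-((2 * β + 2) * v))) := by
            congr 1
            rw [abs_of_pos hz, ← Real.exp_add, ← Real.exp_add, ← Real.exp_add, ← Real.exp_add]
            ring_nf
        _ = Real.exp (-(1 * |z|)) * (A * Real.exp (-((2 * β + 2) * v))) := by rw [hA]; ring
        _ ≤ _ := by
            gcongr
            have : 0 ≤ B * Real.exp (-(1 * v)) := by positivity
            linarith

/-- `M_β S^* R S M_{-β}` written as the adjoint Airy transform of `M_{2β} R` applied to the Airy
transform: the kernel is the GOE kernel, conjugated by `e^{β u}`. -/
lemma integral_airyAi_mul_reflected {β : ℝ} (hβ : 0 ≤ β) {φ : ℝ → ℂ}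
    (hφ : MemLp φ 2 (volume : Measure ℝ)) {a : ℝ} (ha : ∀ v ≤ a, φ v = 0) (u : ℝ) :
    Integrable (fun z : ℝ => (airyAi (u - z + β ^ 2) : ℂ) *
      ((Real.exp (2 * β * z) : ℂ) * airyInt (β ^ 2) φ (-z))) ∧
    Integrable (fun v : ℝ => ((Real.exp (β * (u - v)) * goeKernel u v : ℝ) : ℂ) * φ v) ∧
    ∫ z : ℝ, (airyAi (u - z + β ^ 2) : ℂ) *
      ((Real.exp (2 * β * z) : ℂ) * airyInt (β ^ 2) φ (-z))
      = ∫ v, ((Real.exp (β * (u - v)) * goeKernel u v : ℝ) : ℂ) * φ v := by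
  have hi := integrable_airyAi_mul_reflected (c := β ^ 2) hβ hφ ha u
  have e1 : ∀ z : ℝ, ∫ v, ((airyAi (u - z + β ^ 2) * Real.exp (2 * β * z) *
      airyAi (v + z + β ^ 2) : ℝ) : ℂ) * φ v = (airyAi (u - z + β ^ 2) : ℂ) *
      ((Real.exp (2 * β * z) : ℂ) * airyInt (β ^ 2) φ (-z)) := by
    intro z
    rw [airyInt, ← integral_const_mul, ← integral_const_mul]
    congr 1; ext v
    rw [sub_neg_eq_add]
    push_cast
    ring
  have e2 : ∀ v : ℝ, ∫ z : ℝ, ((airyAi (u - z + β ^ 2) * Real.exp (2 * β * z) *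
      airyAi (v + z + β ^ 2) : ℝ) : ℂ) * φ v
      = ((Real.exp (β * (u - v)) * goeKernel u v : ℝ) : ℂ) * φ v := by
    intro v
    rw [integral_mul_const, integral_complex_ofReal, integral_airyAi_mul_airyAi hβ]
  refine ⟨?_, ?_, ?_⟩
  · refine hi.integral_prod_left.congr (Eventually.of_forall fun z => ?_)
    exact e1 z
  · refine hi.integral_prod_right.congr (Eventually.of_forall fun v => ?_)
    exact e2 v
  · simp_rw [← e1, ← e2]
    exact integral_integral_swap hi

lemma opA_apply (g : ℝ → ℂ) (u : ℝ) :
    opA g u = ∫ z : ℝ, (airyAi (u - z + 0 ^ 2) : ℂ) *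
      ((Real.exp (2 * 0 * z) : ℂ) * airyInt (0 ^ 2) g (-z)) := by
  simp [opA, opSAdj, kernelOp, transposeKernel, sKernel_zero, opS_zero, opR]

/-- On `L²(a, ∞)`, the kernel of `A = S^* R S` is the GOE kernel. -/
lemma opA_eq_kernelOp {g : ℝ → ℂ} (hg : MemLp g 2 (volume : Measure ℝ)) {a : ℝ}
    (ha : ∀ v ≤ a, g v = 0) :
    KernelConverges goeKernel g ∧ opA g = kernelOp goeKernel g ∧
      KernelConverges (transposeKernel (sKernel 0)) (opR (opS 0 g)) := by
  have h := fun u => integral_airyAi_mul_reflected le_rfl hg ha u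
  refine ⟨fun u => ?_, ?_, fun u => ?_⟩
  · simpa using (h u).2.1
  · ext u
    rw [opA_apply, (h u).2.2]
    simp [kernelOp]
  · simpa [transposeKernel, sKernel_zero, opS_zero, opR] using (h u).1

lemma memLp_opM_neg {β : ℝ} (hβ : 0 ≤ β) {φ : ℝ → ℂ} (hφ : MemLp φ 2 (volume : Measure ℝ)) {a : ℝ}
    (ha : ∀ v ≤ a, φ v = 0) :
    MemLp (opM (-β) φ) 2 (volume : Measure ℝ) ∧ ∀ v ≤ a, opM (-β) φ v = 0 := by
  refine ⟨?_, fun v hv => by rw [opM, ha v hv, mul_zero]⟩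
  refine hφ.of_le_mul (c := Real.exp (-β * a))
    ((Continuous.aestronglyMeasurable (by fun_prop)).mul hφ.1) (Eventually.of_forall fun v => ?_)
  rw [opM, norm_mul, norm_real, Real.norm_eq_abs, Real.abs_exp]
  by_cases hv : v ≤ a
  · simp [ha v hv]
  · gcongr ?_ * _
    apply Real.exp_le_exp.2
    nlinarith [mul_le_mul_of_nonneg_left (le_of_not_ge hv) hβ]

lemma sKernel_mul_opM (β : ℝ) (φ : ℝ → ℂ) (u v : ℝ) :
    (sKernel β u v : ℂ) * opM (-β) φ v
      = (Real.exp (2 / 3 * β ^ 3 - β * u) : ℂ) * ((airyAi (v - u + β ^ 2) : ℂ) * φ v) := by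
  have h : Real.exp (2 / 3 * β ^ 3 + β * (v - u)) * Real.exp (-β * v)
      = Real.exp (2 / 3 * β ^ 3 - β * u) := by
    rw [← Real.exp_add]; ring_nf
  rw [opM, ← h, sKernel]
  push_cast
  ring

lemma opS_opM (β : ℝ) (φ : ℝ → ℂ) (u : ℝ) :
    opS β (opM (-β) φ) u = (Real.exp (2 / 3 * β ^ 3 - β * u) : ℂ) * airyInt (β ^ 2) φ u := by
  rw [opS, kernelOp, airyInt, ← integral_const_mul]
  simp_rw [sKernel_mul_opM]

/-- `(I - R) S_β M_{-β}` is `(I - M_{2β} R) exp (∂³/3 - β² ∂)` up to an exponential factor. -/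
lemma opS_sub_opR (β : ℝ) (φ : ℝ → ℂ) (u : ℝ) :
    (opS β (opM (-β) φ) - opR (opS β (opM (-β) φ))) u
      = (Real.exp (2 / 3 * β ^ 3 - β * u) : ℂ) * reflDiff (β ^ 2) β φ u := by
  rw [Pi.sub_apply, opR, opS_opM, opS_opM, reflDiff, mul_sub, ← mul_assoc]
  congr 2
  rw [← ofReal_mul, ← Real.exp_add]
  ring_nf

lemma transposeKernel_mul_chiBar (β : ℝ) (φ : ℝ → ℂ) (u v : ℝ) :
    (transposeKernel (sKernel (-β)) u v : ℂ) *
        chiBar 0 (opS β (opM (-β) φ) - opR (opS β (opM (-β) φ))) v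
      = (Real.exp (-(β * u)) : ℂ) *
        ((airyAi (u - v + β ^ 2) : ℂ) * (Iic 0).indicator (reflDiff (β ^ 2) β φ) v) := by
  by_cases hv : v ∈ Iic (0 : ℝ)
  · rw [chiBar, indicator_of_mem hv, indicator_of_mem hv, opS_sub_opR, transposeKernel, sKernel]
    have h : Real.exp (2 / 3 * (-β) ^ 3 + -β * (u - v)) * Real.exp (2 / 3 * β ^ 3 - β * v)
        = Real.exp (-(β * u)) := by
      rw [← Real.exp_add]; ring_nf
    rw [← h, neg_sq]
    push_cast
    ring
  · rw [chiBar, indicator_of_notMem hv, indicator_of_notMem hv]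
    simp

lemma opE_opM (β : ℝ) (φ : ℝ → ℂ) (u : ℝ) :
    opE β (opM (-β) φ) u = (Real.exp (-(β * u)) : ℂ) *
      ∫ v, (airyAi (u - v + β ^ 2) : ℂ) * (Iic 0).indicator (reflDiff (β ^ 2) β φ) v := by
  rw [opE, opSAdj, kernelOp, ← integral_const_mul]
  simp_rw [transposeKernel_mul_chiBar]

lemma opX_apply {β : ℝ} (hβ : 0 ≤ β) {φ : ℝ → ℂ} (hφ : MemLp φ 2 (volume : Measure ℝ)) {a : ℝ}
    (ha : ∀ v ≤ a, φ v = 0) (u : ℝ) :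
    opX β φ u = (∫ z : ℝ, (airyAi (u - z + β ^ 2) : ℂ) *
        ((Real.exp (2 * β * z) : ℂ) * airyInt (β ^ 2) φ (-z))) +
      ∫ v, (airyAi (u - v + β ^ 2) : ℂ) * (Iic 0).indicator (reflDiff (β ^ 2) β φ) v := by
  obtain ⟨hg, hga⟩ := memLp_opM_neg hβ hφ ha
  rw [opX]
  conv_lhs => rw [opM]
  rw [Pi.add_apply, opE_opM, (opA_eq_kernelOp hg hga).2.1, (integral_airyAi_mul_reflected hβ hφ ha u).2.2,
    kernelOp, mul_add, ← mul_assoc, ← ofReal_mul, ← Real.exp_add, add_neg_cancel, Real.exp_zero,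
    ofReal_one, one_mul, ← integral_const_mul]
  congr 2
  ext v
  rw [opM, show β * (u - v) = β * u + -β * v by ring, Real.exp_add]
  push_cast
  ring

lemma integrable_exp_mul_chiBar {g : ℝ → ℂ} (hg : MemLp g 2 (volume : Measure ℝ)) :
    Integrable fun v : ℝ => ((Real.exp (1 * v) : ℝ) : ℂ) * (Iic 0).indicator g v := by
  have h1 : MemLp (fun v => (Iic 0).indicator g (-v)) 2 (volume : Measure ℝ) :=
    (hg.indicator measurableSet_Iic).comp_measurePreserving (Measure.measurePreserving_neg volume)
  have h2 : ∀ v ≤ (-1 : ℝ), (Iic 0).indicator g (-v) = 0 := fun v hv =>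
    indicator_of_notMem (by simp; linarith) _
  have h3 := (integrable_exp_mul_of_eq_zero h1 h2 one_pos).comp_neg
  refine h3.congr (Eventually.of_forall fun v => ?_)
  simp

lemma integrable_exp_mul_reflected (c : ℝ) {β : ℝ} (hβ : 0 ≤ β) {φ : ℝ → ℂ}
    (hφ : MemLp φ 2 (volume : Measure ℝ)) {a : ℝ} (ha : ∀ v ≤ a, φ v = 0) :
    Integrable fun u : ℝ => ((Real.exp (1 * u) : ℝ) : ℂ) *
      ((Real.exp (2 * β * u) : ℂ) * airyInt c φ (-u)) := by
  obtain ⟨K₁, hK₁, h₁⟩ := exists_norm_reflected_le c a β hβ (1 / 2) (by norm_num)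
  obtain ⟨K₂, hK₂, h₂⟩ := exists_norm_reflected_le c a β hβ 2 (by norm_num)
  set N := (eLpNorm φ 2 volume).toReal with hN
  refine ((integrable_exp_neg_mul_abs (show (0 : ℝ) < 1 / 2 by norm_num)).const_mul
    ((K₁ + K₂) * N)).mono' ((Continuous.aestronglyMeasurable (by fun_prop)).mul
      (aestronglyMeasurable_reflected c β hφ.1)) (Eventually.of_forall fun u => ?_)
  rw [norm_mul, norm_real, Real.norm_eq_abs, Real.abs_exp]
  rcases le_or_gt u 0 with hu | hu
  · calc _ ≤ Real.exp (1 * u) * (K₁ * N * Real.exp (-(1 / 2 * u))) := by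
          gcongr; exact h₁ φ hφ ha u
      _ = K₁ * N * Real.exp (-(1 / 2 * |u|)) := by
          rw [abs_of_nonpos hu, mul_left_comm, ← Real.exp_add]; ring_nf
      _ ≤ _ := by gcongr; linarith
  · calc _ ≤ Real.exp (1 * u) * (K₂ * N * Real.exp (-(2 * u))) := by
          gcongr; exact h₂ φ hφ ha u
      _ = K₂ * N * Real.exp (-u) := by
          rw [mul_left_comm, ← Real.exp_add]; ring_nf
      _ ≤ _ := by
          rw [abs_of_pos hu]
          gcongr
          · linarith
          · linarith

/-- `I - M_β (A + E_β) M_{-β}` is the inverse Airy transform of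
`χ_0 (I - M_{2β} R) exp (∂³/3 - β² ∂)`. -/
lemma realizes_opX {β : ℝ} (hβ : 0 ≤ β) {a : ℝ} {V : L2Ioi a →L[ℂ] L2R}
    (hV : Realizes V fun φ => (Ioi 0).indicator (reflDiff (β ^ 2) β φ)) :
    Realizes ((incl a).toContinuousLinearMap -
      (airyTransform (β ^ 2)).symm.toContinuousLinearEquiv.toContinuousLinearMap ∘L V)
      (opX β) := by
  intro f
  have hc : 0 ≤ β ^ 2 := sq_nonneg β
  set φ := zeroExt f with hφd
  have hφ : MemLp φ 2 (volume : Measure ℝ) := memLp_zeroExt f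
  have ha : ∀ v ≤ a, φ v = 0 := zeroExt_eq_zero f
  have hq := memLp_reflected hc hβ hφ ha
  have hy := memLp_reflDiff hc hβ hφ ha
  have hyb := hy.indicator (measurableSet_Iic (a := (0 : ℝ)))
  set U := airyTransform (β ^ 2) with hU
  -- `χ_0 y = U f - M_{2β} R U f - χ̄_0 y`, where `y = (I - M_{2β} R) U f`
  have hVf : V f = U (incl a f) - hq.toLp _ - hyb.toLp _ := by
    apply Lp.ext
    filter_upwards [hV f, Lp.coeFn_sub (U (incl a f) - hq.toLp _) (hyb.toLp _),
      Lp.coeFn_sub (U (incl a f)) (hq.toLp _), hq.coeFn_toLp, hyb.coeFn_toLp,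
      airyTransform_toLp_ae_eq hc hφ ha] with u h1 h2 h3 h4 h5 h6
    rw [h1, h2, Pi.sub_apply, h3, Pi.sub_apply, h4, h5, show U (incl a f) u = _ from h6]
    change _ = reflDiff (β ^ 2) β φ u - _
    by_cases hu : u ∈ Ioi (0 : ℝ)
    · rw [indicator_of_mem hu, indicator_of_notMem (by simpa using hu), sub_zero]
    · rw [indicator_of_notMem hu, indicator_of_mem (by simpa using hu), sub_self]
  have hT : ((incl a).toContinuousLinearMap -
      U.symm.toContinuousLinearEquiv.toContinuousLinearMap ∘L V) f
      = U.symm (hq.toLp _) + U.symm (hyb.toLp _) := by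
    change incl a f - U.symm (V f) = _
    rw [hVf, map_sub, map_sub, LinearIsometryEquiv.symm_apply_apply]
    abel
  rw [hT]
  filter_upwards [Lp.coeFn_add (U.symm (hq.toLp _)) (U.symm (hyb.toLp _)),
    airyTransform_symm_toLp_ae_eq hc one_pos hq (integrable_exp_mul_reflected _ hβ hφ ha),
    airyTransform_symm_toLp_ae_eq hc one_pos hyb (integrable_exp_mul_chiBar hy)] with u h1 h2 h3
  rw [h1, Pi.add_apply, h2, h3, opX_apply hβ hφ ha]

/-! ### Stopping a path and the exponential martingale -/

/-- The event that a continuous path stays strictly above a continuous barrier on `[0, t]` is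
measurable with respect to the values of the path on `[0, t]`. As `[0, t]` is uncountable, its
preimage under an a.e.-measurable process is only null-measurable because the event can be expressed
through countably many coordinates. -/
lemma exists_measurableSet_forall_lt {Ω : Type*} [MeasurableSpace Ω] {P : Measure Ω} {t : ℝ≥0}
    {Y : Iic t → Ω → ℝ} (hY : ∀ y, AEMeasurable (Y y) P) {f : Iic t → ℝ} (hf : Continuous f) :
    ∃ A : Set (Iic t → ℝ), MeasurableSet A ∧ NullMeasurableSet {ω | (fun y => Y y ω) ∈ A} P ∧
      ∀ w : Iic t → ℝ, Continuous w → (w ∈ A ↔ ∀ y, f y < w y) := by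
  let d := TopologicalSpace.denseSeq (Iic t)
  refine ⟨⋃ m : ℕ, ⋂ n : ℕ, {w | f (d n) + 1 / (m + 1) ≤ w (d n)}, ?_, ?_, fun w hw => ?_⟩
  · refine MeasurableSet.iUnion fun m => MeasurableSet.iInter fun n => ?_
    exact measurableSet_le measurable_const (measurable_pi_apply _)
  · have : {ω | (fun y => Y y ω) ∈ ⋃ m : ℕ, ⋂ n : ℕ, {w : Iic t → ℝ |
        f (d n) + 1 / (m + 1) ≤ w (d n)}} =
        ⋃ m : ℕ, ⋂ n : ℕ, {ω | f (d n) + 1 / (m + 1) ≤ Y (d n) ω} := by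
      ext ω; simp
    rw [this]
    exact .iUnion fun m => .iInter fun n => nullMeasurableSet_le aemeasurable_const (hY _)
  · simp only [mem_iUnion, mem_iInter, mem_ofPred_eq]
    constructor
    · rintro ⟨m, hm⟩ y
      have key : ∀ y, f y + 1 / ((m : ℝ) + 1) ≤ w y := fun y =>
        isClosed_property (TopologicalSpace.denseRange_denseSeq (Iic t))
          (isClosed_le (hf.add continuous_const) hw) hm y
      have : (0 : ℝ) < 1 / ((m : ℝ) + 1) := by positivity
      linarith [key y]
    · intro h
      have hc : CompactSpace (Iic t) := by
        rw [← isCompact_iff_compactSpace, ← Icc_bot]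
        exact isCompact_Icc
      obtain ⟨y₀, -, hy₀⟩ := isCompact_univ.exists_isMinOn (univ_nonempty (α := Iic t))
        (hw.sub hf).continuousOn
      obtain ⟨m, hm⟩ := exists_nat_one_div_lt (sub_pos.2 (h y₀))
      refine ⟨m, fun n => ?_⟩
      have := hy₀ (mem_univ (d n))
      simp only [mem_ofPred_eq, Pi.sub_apply] at this
      linarith

section Path

variable {x : ℝ≥0 → ℝ}

lemma sInf_mem_nonpos (hx : Continuous x) (h : {y | x y ≤ 0}.Nonempty) :
    x (sInf {y | x y ≤ 0}) ≤ 0 :=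
  (isClosed_le hx continuous_const).csInf_mem h (OrderBot.bddBelow _)

/-- A continuous path stays positive on `[0, t]` iff it enters `(-∞, 0]` after time `t` or never. -/
lemma forall_le_pos_iff (hx : Continuous x) (t : ℝ≥0) :
    (∀ y ≤ t, 0 < x y) ↔ ({y | x y ≤ 0}.Nonempty → t < sInf {y | x y ≤ 0}) := by
  constructor
  · intro h hne
    by_contra! hlt
    exact absurd (sInf_mem_nonpos hx hne) (not_le.2 (h _ hlt))
  · intro h y hy
    by_contra! hle
    have := h ⟨y, hle⟩
    exact absurd (csInf_le (OrderBot.bddBelow _) (show y ∈ {y | x y ≤ 0} from hle))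
      (not_le.2 (hy.trans_lt this))

lemma nonneg_of_le_sInf (hx : Continuous x) (h0 : 0 < x 0) {y : ℝ≥0}
    (hy : {y | x y ≤ 0}.Nonempty → y ≤ sInf {y | x y ≤ 0}) : 0 ≤ x y := by
  by_cases hlt : {y | x y ≤ 0}.Nonempty → y < sInf {y | x y ≤ 0}
  · exact ((forall_le_pos_iff hx y).2 hlt y le_rfl).le
  · push Not at hlt
    obtain ⟨hne, hle⟩ := hlt
    have heq := le_antisymm (hy hne) hle
    have hpos : (Iio y).Nonempty := by
      refine ⟨0, ?_⟩
      rw [mem_Iio, pos_iff_ne_zero]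
      rintro rfl
      rw [heq] at h0
      exact absurd (sInf_mem_nonpos hx hne) (not_le.2 h0)
    have hcl : closure (Iio y) ⊆ {y | 0 ≤ x y} :=
      closure_minimal (fun z hz => ((forall_le_pos_iff hx z).2
        (fun _ => heq ▸ hz) z le_rfl).le) (isClosed_le continuous_const hx)
    rw [closure_Iio' hpos] at hcl
    exact hcl self_mem_Iic

/-- A continuous path that starts above `0` is at `0` when it first enters `(-∞, 0]`. -/
lemma eq_zero_sInf (hx : Continuous x) (h0 : 0 < x 0) (h : {y | x y ≤ 0}.Nonempty) :
    x (sInf {y | x y ≤ 0}) = 0 :=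
  le_antisymm (sInf_mem_nonpos hx h) (nonneg_of_le_sInf hx h0 fun _ => le_rfl)

end Path

open Classical in
/-- The infimum `inf H ∧ T` of a set of times, capped at `T`, where `inf ∅ = ∞`. -/
def cappedInf (H : Set ℝ≥0) (T : ℝ≥0) : ℝ≥0 := if H.Nonempty then min T (sInf H) else T

lemma cappedInf_le (H : Set ℝ≥0) (T : ℝ≥0) : cappedInf H T ≤ T := by
  unfold cappedInf; split_ifs <;> simp

lemma cappedInf_le_sInf {H : Set ℝ≥0} (T : ℝ≥0) (h : H.Nonempty) : cappedInf H T ≤ sInf H := by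
  simp [cappedInf, h]

lemma lt_cappedInf_iff {H : Set ℝ≥0} {s T : ℝ≥0} (hs : s < T) :
    s < cappedInf H T ↔ (H.Nonempty → s < sInf H) := by
  by_cases h : H.Nonempty <;> simp [cappedInf, h, hs]

/-- The first point of the grid `{k T / N}` at or after `s`. -/
def gridCeil (T : ℝ≥0) (N : ℕ) (s : ℝ≥0) : ℝ≥0 := ⌈s / T * N⌉₊ * (T / N)

lemma tendsto_gridCeil {T : ℝ≥0} (hT : 0 < T) (s : ℝ≥0) :
    Tendsto (fun N : ℕ => gridCeil T (N + 1) s) atTop (𝓝 s) := by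
  have h1 := (tendsto_nat_ceil_mul_div_atTop (R := ℝ) (a := s / T) (by positivity)).comp
    (tendsto_natCast_atTop_atTop.comp (tendsto_add_atTop_nat 1))
  have h2 := h1.mul_const (T : ℝ)
  rw [← NNReal.tendsto_coe]
  have hT' : (T : ℝ) ≠ 0 := by positivity
  convert! h2 using 2 with N
  · simp only [gridCeil, Function.comp_apply]
    push_cast
    rw [show ⌈s / T * ((N : ℝ≥0) + 1)⌉₊ = ⌈(s : ℝ) / T * ((N : ℝ) + 1)⌉₊ by
      refine eq_of_forall_ge_iff fun c => ?_
      rw [Nat.ceil_le, Nat.ceil_le, ← NNReal.coe_le_coe]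
      push_cast; rfl]
    ring
  · field_simp

/-- Summing the increments of `m` over the grid intervals that start before `s` gives the value of
`m` at the first grid point at or after `s`. -/
lemma sum_range_telescope_gridCeil {T s : ℝ≥0} (hT : 0 < T) (hs : s ≤ T) {N : ℕ} (hN : 0 < N)
    (m : ℝ≥0 → ℂ) (a : ℕ → ℂ)
    (ha : ∀ k < N, a k = if (k : ℝ≥0) * (T / N) < s then 1 else 0) :
    m 0 + ∑ k ∈ Finset.range N, a k * (m ((k + 1 : ℕ) * (T / N)) - m (k * (T / N))) =
      m (gridCeil T N s) := by
  have hN' : (0 : ℝ≥0) < N := by exact_mod_cast hN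
  set K := ⌈s / T * N⌉₊ with hK
  have hKN : K ≤ N := by
    rw [hK, Nat.ceil_le]
    exact mul_le_of_le_one_left hN'.le (div_le_one_of_le₀ hs hT.le)
  have hiff : ∀ k : ℕ, (k : ℝ≥0) * (T / N) < s ↔ k < K := fun k => by
    rw [hK, Nat.lt_ceil, ← lt_div_iff₀ (by positivity)]
    congr! 1
    field_simp
  rw [← Finset.sum_subset (Finset.range_subset_range.2 hKN)]
  · rw [Finset.sum_congr rfl (g := fun k : ℕ => m ((k + 1 : ℕ) * (T / N)) - m (k * (T / N)))]
    · rw [Finset.sum_range_sub (fun k : ℕ => m (k * (T / N)))]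
      simp [gridCeil, hK]
    · intro k hk
      rw [Finset.mem_range] at hk
      rw [ha k (hk.trans_le hKN), if_pos ((hiff k).2 hk), one_mul]
  · intro k hk hk'
    rw [Finset.mem_range] at hk hk'
    rw [ha k hk, if_neg (fun h => hk' ((hiff k).1 h)), zero_mul]

/-- Expectations pass to an almost sure limit if second moments are bounded (so that the sequence is
uniformly integrable). -/
lemma integral_eq_of_tendsto_of_sq_le {Ω : Type*} [MeasurableSpace Ω] {P : Measure Ω}
    [IsProbabilityMeasure P] {f : ℕ → Ω → ℂ} {g : Ω → ℂ} {c : ℂ} {C : ℝ}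
    (hf : ∀ n, Integrable (f n) P) (hfc : ∀ n, ∫ ω, f n ω ∂P = c)
    (hsq : ∀ n, Integrable (fun ω => ‖f n ω‖ ^ 2) P) (hC : ∀ n, ∫ ω, ‖f n ω‖ ^ 2 ∂P ≤ C)
    (hg : ∀ᵐ ω ∂P, ‖g ω‖ ≤ 1) (hlim : ∀ᵐ ω ∂P, Tendsto (fun n => f n ω) atTop (𝓝 (g ω))) :
    AEStronglyMeasurable g P ∧ ∫ ω, g ω ∂P = c := by
  have hgm : AEStronglyMeasurable g P :=
    aestronglyMeasurable_of_tendsto_ae atTop (fun n => (hf n).1) hlim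
  have hgi : Integrable g P :=
    (integrable_const (1 : ℝ)).mono' hgm hg
  refine ⟨hgm, ?_⟩
  -- the bounded regularization `z / (1 + ε ‖z‖)` is within `ε ‖z‖²` of `z`
  let ψ : ℝ → ℂ → ℂ := fun ε z => z / ((1 + ε * ‖z‖ : ℝ) : ℂ)
  have hψc : ∀ ε > 0, Continuous (ψ ε) := fun ε hε => by
    refine Continuous.div₀ continuous_id (by fun_prop) fun z => ?_
    rw [Complex.ofReal_ne_zero]
    positivity
  have hψn : ∀ ε > 0, ∀ z, ‖ψ ε z‖ = ‖z‖ / (1 + ε * ‖z‖) := fun ε hε z => by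
    rw [norm_div, Complex.norm_real, Real.norm_of_nonneg (by positivity)]
  have hψ1 : ∀ ε > 0, ∀ z, ‖ψ ε z‖ ≤ 1 / ε := fun ε hε z => by
    rw [hψn ε hε, div_le_div_iff₀ (by positivity) hε]
    nlinarith [norm_nonneg z]
  have hψd : ∀ ε > 0, ∀ z, ‖z - ψ ε z‖ ≤ ε * ‖z‖ ^ 2 := fun ε hε z => by
    have hpos : 0 < 1 + ε * ‖z‖ := by positivity
    have : z - ψ ε z = z * ((ε * ‖z‖ / (1 + ε * ‖z‖) : ℝ) : ℂ) := by
      have h0 : ((1 + ε * ‖z‖ : ℝ) : ℂ) ≠ 0 := Complex.ofReal_ne_zero.2 hpos.ne'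
      simp only [ψ, Complex.ofReal_div]
      field_simp
      push_cast
      ring
    rw [this, norm_mul, Complex.norm_real, Real.norm_of_nonneg (by positivity),
      mul_div_assoc', div_le_iff₀ hpos]
    have : 0 ≤ ε * ‖z‖ ^ 2 * (ε * ‖z‖) := by positivity
    nlinarith
  have hψi : ∀ ε > 0, ∀ k : Ω → ℂ, Integrable k P → Integrable (fun ω => ψ ε (k ω)) P :=
    fun ε hε k hk => (integrable_const (1 / ε)).mono'
      ((hψc ε hε).comp_aestronglyMeasurable hk.1) (ae_of_all _ fun ω => hψ1 ε hε _)
  have hcmp : ∀ ε > 0, ∀ k : Ω → ℂ, ∀ D : ℝ, Integrable k P → Integrable (fun ω => ‖k ω‖ ^ 2) P →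
      ∫ ω, ‖k ω‖ ^ 2 ∂P ≤ D → ‖∫ ω, k ω ∂P - ∫ ω, ψ ε (k ω) ∂P‖ ≤ ε * D := by
    intro ε hε k D hk hk2 hD
    rw [← integral_sub hk (hψi ε hε k hk)]
    calc _ ≤ ∫ ω, ε * ‖k ω‖ ^ 2 ∂P :=
          norm_integral_le_of_norm_le (hk2.const_mul ε) (ae_of_all _ fun ω => hψd ε hε _)
      _ ≤ ε * D := by rw [integral_const_mul]; gcongr
  have hg2 : Integrable (fun ω => ‖g ω‖ ^ 2) P := by
    refine (integrable_const (1 : ℝ)).mono' (hgm.norm.pow 2) ?_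
    filter_upwards [hg] with ω hω
    rw [Real.norm_of_nonneg (by positivity)]
    exact pow_le_one₀ (norm_nonneg _) hω
  have hg1 : ∫ ω, ‖g ω‖ ^ 2 ∂P ≤ 1 := by
    calc _ ≤ ∫ _ω, (1 : ℝ) ∂P := integral_mono_ae hg2 (integrable_const _) (by
          filter_upwards [hg] with ω hω using pow_le_one₀ (norm_nonneg _) hω)
      _ = 1 := by simp
  have hbound : ∀ ε > 0, ‖∫ ω, g ω ∂P - c‖ ≤ ε * (1 + C) := by
    intro ε hε
    have hl : Tendsto (fun n => ∫ ω, ψ ε (f n ω) ∂P) atTop (𝓝 (∫ ω, ψ ε (g ω) ∂P)) := by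
      refine tendsto_integral_of_dominated_convergence (fun _ => 1 / ε)
        (fun n => (hψi ε hε _ (hf n)).1) (integrable_const _)
        (fun n => ae_of_all _ fun ω => hψ1 ε hε _) ?_
      filter_upwards [hlim] with ω hω using ((hψc ε hε).tendsto _).comp hω
    have h1 : ‖c - ∫ ω, ψ ε (g ω) ∂P‖ ≤ ε * C :=
      le_of_tendsto (tendsto_const_nhds.sub hl).norm (Eventually.of_forall fun n => by
        rw [← hfc n]; exact hcmp ε hε _ C (hf n) (hsq n) (hC n))
    have h2 := hcmp ε hε g 1 hgi hg2 hg1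
    calc _ = ‖(∫ ω, g ω ∂P - ∫ ω, ψ ε (g ω) ∂P) - (c - ∫ ω, ψ ε (g ω) ∂P)‖ := by congr 1; ring
      _ ≤ _ := (norm_sub_le _ _).trans (by linarith)
  rw [← sub_eq_zero, ← norm_le_zero_iff]
  have ht : Tendsto (fun ε : ℝ => ε * (1 + C)) (𝓝[>] 0) (𝓝 0) := by
    have : Tendsto (fun ε : ℝ => ε * (1 + C)) (𝓝 0) (𝓝 (0 * (1 + C))) :=
      (continuous_id.mul continuous_const).tendsto 0
    rw [zero_mul] at this
    exact this.mono_left nhdsWithin_le_nhds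
  exact ge_of_tendsto ht (by filter_upwards [self_mem_nhdsWithin] with ε hε using hbound ε hε)

/-- The exponential martingale `exp (-r B(t) - r² t)` of `B(t) = u + √2 W(t)`. -/
def expMartingale {Ω : Type*} (W : ℝ≥0 → Ω → ℝ) (u : ℝ) (r : ℂ) (t : ℝ≥0) (ω : Ω) : ℂ :=
  cexp (-r * ((u + √2 * W t ω : ℝ) : ℂ) - r ^ 2 * t)

section Martingale

variable {Ω : Type*} [MeasurableSpace Ω] {P : Measure Ω} {W : ℝ≥0 → Ω → ℝ}

lemma integrable_expMartingale (hW : IsPreBrownianReal W P) (u : ℝ) (r : ℂ) (t : ℝ≥0) :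
    Integrable (expMartingale W u r t) P := by
  have hm : AEStronglyMeasurable (expMartingale W u r t) P := by
    have hc : Continuous fun x : ℝ => cexp (-r * ((u + √2 * x : ℝ) : ℂ) - r ^ 2 * t) := by fun_prop
    exact hc.comp_aestronglyMeasurable (hW.aemeasurable t).aestronglyMeasurable
  have h1 : Integrable (fun ω => Real.exp ((-r.re * √2) * W t ω)) P := by
    have h := integrable_exp_mul_gaussianReal (μ := 0) (v := t) (-r.re * √2)
    rw [← (hW.hasLaw_eval t).map_eq] at h
    exact h.comp_aemeasurable (hW.aemeasurable t)
  refine (h1.const_mul (Real.exp (-r.re * u - (r ^ 2).re * t))).mono' hm (ae_of_all _ fun ω => ?_)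
  rw [expMartingale, Complex.norm_exp, ← Real.exp_add]
  apply le_of_eq
  congr 1
  simp only [sub_re, mul_re, neg_re, neg_im, ofReal_re, ofReal_im]
  simp
  ring

/-- The growth factor of the martingale over `[s, s + d]` has mean one. -/
lemma integral_expMartingale_increment (hW : IsPreBrownianReal W P) (r : ℂ) (s d : ℝ≥0) :
    ∫ ω, cexp (-r * √2 * ((W (s + d) ω - W s ω : ℝ) : ℂ) - r ^ 2 * d) ∂P = 1 := by
  have hl := (hW.shift s).hasLaw_eval d
  have h := complexMGF_gaussianReal (p := P) hl.map_eq (-r * √2)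
  rw [complexMGF] at h
  simp_rw [sub_eq_add_neg (_ * _) (r ^ 2 * d), Complex.exp_add]
  rw [integral_mul_const, h, ← Complex.exp_add, ← Complex.exp_zero]
  congr 1
  have h2 : ((√2 : ℝ) : ℂ) ^ 2 = 2 := by
    rw [← Complex.ofReal_pow, Real.sq_sqrt (by norm_num)]; norm_num
  simp only [ofReal_zero, mul_zero, zero_add, mul_pow, neg_sq, h2]
  ring

/-- The martingale property, tested against an event of the past. -/
lemma integral_indicator_expMartingale (hW : IsPreBrownianReal W P) (u : ℝ) (r : ℂ) {s t : ℝ≥0}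
    (hst : s ≤ t) {A : Set (Iic s → ℝ)} (hA : MeasurableSet A)
    (hA' : NullMeasurableSet {ω | (fun y : Iic s => W y ω) ∈ A} P) :
    ∫ ω in {ω | (fun y : Iic s => W y ω) ∈ A}, expMartingale W u r t ω ∂P =
      ∫ ω in {ω | (fun y : Iic s => W y ω) ∈ A}, expMartingale W u r s ω ∂P := by
  obtain ⟨d, rfl⟩ := exists_add_of_le hst
  let ψ : (Iic s → ℝ) → ℂ := A.indicator fun p =>
    cexp (-r * ((u + √2 * p ⟨s, self_mem_Iic⟩ : ℝ) : ℂ) - r ^ 2 * s)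
  let φ : (ℝ≥0 → ℝ) → ℂ := fun p => cexp (-r * √2 * (p d : ℂ) - r ^ 2 * d)
  have hc : Continuous fun x : ℝ => cexp (-r * √2 * (x : ℂ) - r ^ 2 * d) := by fun_prop
  have hψ : Measurable ψ := Measurable.indicator (by fun_prop) hA
  have hφ : Measurable φ := hc.measurable.comp (measurable_pi_apply d)
  have hψW : (ψ ∘ fun ω (y : Iic s) => W y ω) =
      {ω | (fun y : Iic s => W y ω) ∈ A}.indicator (expMartingale W u r s) := rfl
  have hψm : AEStronglyMeasurable (ψ ∘ fun ω (y : Iic s) => W y ω) P := by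
    rw [hψW]
    exact (integrable_expMartingale hW u r s).1.indicator₀ hA'
  have hφm : AEStronglyMeasurable (φ ∘ fun ω t => W (s + t) ω - W s ω) P :=
    hc.comp_aestronglyMeasurable ((hW.shift s).aemeasurable d).aestronglyMeasurable
  have h := ((hW.indepFun_shift s).comp hφ hψ).integral_fun_mul_eq_mul_integral hφm hψm
  have h1 : P[φ ∘ fun ω t => W (s + t) ω - W s ω] = 1 :=
    integral_expMartingale_increment hW r s d
  rw [h1, one_mul, hψW, integral_indicator₀ hA'] at h
  rw [← h, ← integral_indicator₀ hA']
  congr 1 with ω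
  simp only [indicator, Function.comp_apply]
  split_ifs
  · simp only [φ, expMartingale]
    rw [← Complex.exp_add]
    congr 1
    push_cast
    ring
  · simp

end Martingale

/-! ### The Laplace transform of the hitting time of a line -/

lemma gridCeil_le {T s : ℝ≥0} (hs : s ≤ T) {N : ℕ} (hN : 0 < N) : gridCeil T N s ≤ T := by
  have hN' : (0 : ℝ≥0) < N := by exact_mod_cast hN
  have hKN : ⌈s / T * N⌉₊ ≤ N := by
    rw [Nat.ceil_le]
    exact mul_le_of_le_one_left hN'.le (div_le_one_of_le₀ hs (zero_le))
  calc gridCeil T N s ≤ N * (T / N) := by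
        unfold gridCeil; gcongr
    _ = T := by field_simp

section Martingale

variable {Ω : Type*} {W : ℝ≥0 → Ω → ℝ}

lemma hitTimes_line (β u : ℝ) (ω : Ω) :
    hitTimes W (fun y => 2 * β * y) u ω = {y : ℝ≥0 | u + √2 * W y ω - 2 * β * y ≤ 0} := by
  ext y; simp [hitTimes]

/-- The square of the martingale of parameter `r` is dominated by the martingale of parameter
`2 Re r`; the second moments of the one are controlled by the mean of the other. -/
lemma norm_expMartingale_sq (u : ℝ) (r : ℂ) (t : ℝ≥0) (ω : Ω) :
    ‖expMartingale W u r t ω‖ ^ 2 =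
      Real.exp ((4 * r.re ^ 2 - 2 * (r ^ 2).re) * t) *
        ‖expMartingale W u ((2 * r.re : ℝ) : ℂ) t ω‖ := by
  rw [expMartingale, expMartingale, Complex.norm_exp, Complex.norm_exp, ← Real.exp_nat_mul,
    ← Real.exp_add]
  congr 1
  simp [pow_two]
  ring

lemma expMartingale_ofReal (u ρ : ℝ) (t : ℝ≥0) (ω : Ω) :
    expMartingale W u (ρ : ℂ) t ω = (‖expMartingale W u (ρ : ℂ) t ω‖ : ℂ) := by
  have : expMartingale W u (ρ : ℂ) t ω =
      ((Real.exp (-ρ * (u + √2 * W t ω) - ρ ^ 2 * t) : ℝ) : ℂ) := by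
    simp [expMartingale]
  rw [this, Complex.norm_real, Real.norm_of_nonneg (Real.exp_pos _).le]

/-- In terms of the distance `u + √2 W(t) - 2 β t` to the line. -/
lemma norm_expMartingale (β u : ℝ) (r : ℂ) (t : ℝ≥0) (ω : Ω) :
    ‖expMartingale W u r t ω‖ =
      Real.exp (-r.re * (u + √2 * W t ω - 2 * β * t) - (r ^ 2 + 2 * β * r).re * t) := by
  rw [expMartingale, Complex.norm_exp]
  congr 1
  simp [pow_two]
  ring

lemma norm_expMartingale_cappedInf_le {β u : ℝ} (hu : 0 < u) {r : ℂ} (hr : 0 ≤ r.re) (T : ℝ≥0)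
    {ω : Ω} (hω : Continuous (W · ω)) (h0 : W 0 ω = 0) :
    ‖expMartingale W u r (cappedInf (hitTimes W (fun y => 2 * β * y) u ω) T) ω‖ ≤
      Real.exp (-(r ^ 2 + 2 * β * r).re *
        cappedInf (hitTimes W (fun y => 2 * β * y) u ω) T) := by
  have hx : Continuous fun y : ℝ≥0 => u + √2 * W y ω - 2 * β * y := by fun_prop
  rw [norm_expMartingale β, Real.exp_le_exp, hitTimes_line]
  have h := nonneg_of_le_sInf hx (by simpa [h0] using hu)
    (y := cappedInf {y : ℝ≥0 | u + √2 * W y ω - 2 * β * y ≤ 0} T) (cappedInf_le_sInf T)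
  have := mul_nonneg hr h
  linarith

variable [MeasurableSpace Ω] {P : Measure Ω}

/-- Optional stopping along a grid, for the first grid time (capped at `T`) after Brownian motion
hits the line. -/
lemma integral_expMartingale_gridCeil (hW : IsBrownianReal W P) (β u : ℝ) (r : ℂ)
    {T : ℝ≥0} (hT : 0 < T) {N : ℕ} (hN : 0 < N) :
    Integrable (fun ω => expMartingale W u r
      (gridCeil T N (cappedInf (hitTimes W (fun y => 2 * β * y) u ω) T)) ω) P ∧
    ∫ ω, expMartingale W u r
      (gridCeil T N (cappedInf (hitTimes W (fun y => 2 * β * y) u ω) T)) ω ∂P = cexp (-r * u) := by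
  have := hW.isGaussianProcess.isProbabilityMeasure
  let t : ℕ → ℝ≥0 := fun k => k * (T / N)
  have ht : ∀ k, t k ≤ t (k + 1) := fun k => by
    simp only [t]; gcongr; simp
  choose A hA hA' hAw using fun k => exists_measurableSet_forall_lt (P := P)
    (Y := fun (y : Iic (t k)) ω => W y ω) (fun y => hW.aemeasurable y)
    (f := fun y => (2 * β * y - u) / √2) (by fun_prop)
  -- `E k` is the event that the path has not hit the line by the `k`-th grid time
  let E : ℕ → Set Ω := fun k => {ω | (fun y : Iic (t k) => W y ω) ∈ A k}
  have hM := integrable_expMartingale hW.toIsPreBrownianReal u r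
  let S : Ω → ℂ := fun ω => expMartingale W u r 0 ω + ∑ k ∈ Finset.range N, (E k).indicator
    (fun ω => expMartingale W u r (t (k + 1)) ω - expMartingale W u r (t k) ω) ω
  have hSi : ∀ k, Integrable ((E k).indicator
    (fun ω => expMartingale W u r (t (k + 1)) ω - expMartingale W u r (t k) ω)) P := fun k =>
    ((hM _).sub (hM _)).indicator₀ (hA' k)
  have hSint : Integrable S P := (hM 0).add (integrable_finsetSum _ fun k _ => hSi k)
  have hS : (fun ω => expMartingale W u r
      (gridCeil T N (cappedInf (hitTimes W (fun y => 2 * β * y) u ω) T)) ω) =ᵐ[P] S := by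
    filter_upwards [hW.cont] with ω hω
    have hx : Continuous fun y : ℝ≥0 => u + √2 * W y ω - 2 * β * y := by fun_prop
    rw [hitTimes_line]
    rw [← sum_range_telescope_gridCeil hT (cappedInf_le _ T) hN
      (fun s => expMartingale W u r s ω) (fun k => (E k).indicator 1 ω)]
    · simp only [S]
      congr 1
      refine Finset.sum_congr rfl fun k _ => ?_
      by_cases h : ω ∈ E k <;> simp [h, t]
    · intro k hk
      have hkT : t k < T := by
        have hN' : (0 : ℝ≥0) < N := by exact_mod_cast hN
        calc t k < N * (T / N) := by
              simp only [t]
              have : (k : ℝ≥0) < N := by exact_mod_cast hk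
              have h2 : 0 < T / N := by positivity
              gcongr
          _ = T := by field_simp
      have hiff : ω ∈ E k ↔ t k < cappedInf {y : ℝ≥0 | u + √2 * W y ω - 2 * β * y ≤ 0} T := by
        rw [lt_cappedInf_iff hkT, ← forall_le_pos_iff hx]
        change (fun y : Iic (t k) => W y ω) ∈ A k ↔ _
        rw [hAw k _ (by fun_prop)]
        have h2 : (0 : ℝ) < √2 := by positivity
        simp only [Subtype.forall, mem_Iic, div_lt_iff₀ h2]
        refine forall₂_congr fun y _ => ?_
        constructor <;> intro h <;> linarith
      simp only [indicator, hiff, Pi.one_apply, t]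
  refine ⟨hSint.congr hS.symm, ?_⟩
  rw [integral_congr_ae hS]
  simp only [S]
  rw [integral_add (hM 0) (integrable_finsetSum _ fun k _ => hSi k),
    integral_finsetSum _ fun k _ => hSi k, Finset.sum_eq_zero, add_zero]
  · have h0 : ∀ᵐ ω ∂P, expMartingale W u r 0 ω = cexp (-r * u) := by
      filter_upwards [hW.eval_zero_ae_eq_zero] with ω hω
      simp [expMartingale, hω]
    rw [integral_congr_ae h0]
    simp
  · intro k _
    rw [integral_indicator₀ (hA' k), integral_sub (hM _).integrableOn (hM _).integrableOn,
      integral_indicator_expMartingale hW.toIsPreBrownianReal u r (ht k) (hA k) (hA' k), sub_self]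

/-- The second moments of the martingale stopped on the grid are bounded uniformly in the mesh. -/
lemma integral_norm_sq_expMartingale_gridCeil_le (hW : IsBrownianReal W P) (β u : ℝ) (r : ℂ)
    {T : ℝ≥0} (hT : 0 < T) {N : ℕ} (hN : 0 < N) :
    Integrable (fun ω => ‖expMartingale W u r
      (gridCeil T N (cappedInf (hitTimes W (fun y => 2 * β * y) u ω) T)) ω‖ ^ 2) P ∧
    ∫ ω, ‖expMartingale W u r
      (gridCeil T N (cappedInf (hitTimes W (fun y => 2 * β * y) u ω) T)) ω‖ ^ 2 ∂P ≤
      Real.exp (|4 * r.re ^ 2 - 2 * (r ^ 2).re| * T) * Real.exp (-(2 * r.re) * u) := by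
  obtain ⟨h1, -⟩ := integral_expMartingale_gridCeil hW β u r hT hN
  obtain ⟨h2, h3⟩ := integral_expMartingale_gridCeil hW β u ((2 * r.re : ℝ) : ℂ) hT hN
  have hle : ∀ ω, ‖expMartingale W u r
      (gridCeil T N (cappedInf (hitTimes W (fun y => 2 * β * y) u ω) T)) ω‖ ^ 2 ≤
      Real.exp (|4 * r.re ^ 2 - 2 * (r ^ 2).re| * T) * ‖expMartingale W u ((2 * r.re : ℝ) : ℂ)
      (gridCeil T N (cappedInf (hitTimes W (fun y => 2 * β * y) u ω) T)) ω‖ := fun ω => by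
    rw [norm_expMartingale_sq]
    gcongr
    · exact le_abs_self _
    · exact gridCeil_le (cappedInf_le _ T) hN
  have hint : Integrable (fun ω => ‖expMartingale W u r
      (gridCeil T N (cappedInf (hitTimes W (fun y => 2 * β * y) u ω) T)) ω‖ ^ 2) P := by
    refine (h2.norm.const_mul (Real.exp (|4 * r.re ^ 2 - 2 * (r ^ 2).re| * T))).mono'
      (h1.1.norm.pow 2) (ae_of_all _ fun ω => ?_)
    rw [Real.norm_of_nonneg (by positivity)]
    exact hle ω
  refine ⟨hint, (integral_mono hint (h2.norm.const_mul _) hle).trans (le_of_eq ?_)⟩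
  rw [integral_const_mul]
  congr 1
  rw [integral_congr_ae (ae_of_all _ fun ω => expMartingale_ofReal u (2 * r.re) _ ω),
    integral_complex_ofReal] at h3
  rw [← Complex.ofReal_inj, h3]
  push_cast
  rfl

/-- Optional stopping at the hitting time of the line, capped at `T`. -/
lemma integral_expMartingale_cappedInf (hW : IsBrownianReal W P) {β u : ℝ} (hu : 0 < u)
    {r : ℂ} (hr : 0 ≤ r.re) (hl : 0 ≤ (r ^ 2 + 2 * β * r).re) {T : ℝ≥0} (hT : 0 < T) :
    AEStronglyMeasurable (fun ω => expMartingale W u r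
      (cappedInf (hitTimes W (fun y => 2 * β * y) u ω) T) ω) P ∧
    ∫ ω, expMartingale W u r
      (cappedInf (hitTimes W (fun y => 2 * β * y) u ω) T) ω ∂P = cexp (-r * u) := by
  have := hW.isGaussianProcess.isProbabilityMeasure
  refine integral_eq_of_tendsto_of_sq_le
    (fun N => (integral_expMartingale_gridCeil hW β u r hT N.succ_pos).1)
    (fun N => (integral_expMartingale_gridCeil hW β u r hT N.succ_pos).2)
    (fun N => (integral_norm_sq_expMartingale_gridCeil_le hW β u r hT N.succ_pos).1)
    (fun N => (integral_norm_sq_expMartingale_gridCeil_le hW β u r hT N.succ_pos).2) ?_ ?_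
  · filter_upwards [hW.cont, hW.eval_zero_ae_eq_zero] with ω hω h0
    refine (norm_expMartingale_cappedInf_le hu hr T hω h0).trans (Real.exp_le_one_iff.2 ?_)
    have := mul_nonneg hl
      (cappedInf (hitTimes W (fun y => 2 * β * y) u ω) T).coe_nonneg
    linarith
  · filter_upwards [hW.cont] with ω hω
    have hc : Continuous fun t => expMartingale W u r t ω := by
      unfold expMartingale; fun_prop
    exact (hc.tendsto _).comp (tendsto_gridCeil hT _)

/-- **Laplace transform of the hitting time** of the line `2 β y` by `u + √2 W y`, in the
variable `r² + 2 β r`. -/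
lemma integral_cexp_sInf_hitTimes (hW : IsBrownianReal W P) {β u : ℝ} (hu : 0 < u)
    {r : ℂ} (hr : 0 ≤ r.re) (hl : 0 < (r ^ 2 + 2 * β * r).re) :
    AEStronglyMeasurable ({ω | (hitTimes W (fun y => 2 * β * y) u ω).Nonempty}.indicator
      fun ω => cexp (-(r ^ 2 + 2 * β * r) * sInf (hitTimes W (fun y => 2 * β * y) u ω))) P ∧
    ∫ ω, {ω | (hitTimes W (fun y => 2 * β * y) u ω).Nonempty}.indicator
      (fun ω => cexp (-(r ^ 2 + 2 * β * r) * sInf (hitTimes W (fun y => 2 * β * y) u ω))) ω ∂P =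
      cexp (-r * u) := by
  have := hW.isGaussianProcess.isProbabilityMeasure
  set F : Ω → ℂ := {ω | (hitTimes W (fun y => 2 * β * y) u ω).Nonempty}.indicator
      fun ω => cexp (-(r ^ 2 + 2 * β * r) * sInf (hitTimes W (fun y => 2 * β * y) u ω)) with hF
  have hT : ∀ n : ℕ, (0 : ℝ≥0) < n + 1 := fun n => by positivity
  have hG := fun n : ℕ => integral_expMartingale_cappedInf hW hu hr hl.le (hT n)
  have hlim : ∀ᵐ ω ∂P, Tendsto (fun n : ℕ => expMartingale W u r
      (cappedInf (hitTimes W (fun y => 2 * β * y) u ω) (n + 1)) ω) atTop (𝓝 (F ω)) := by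
    filter_upwards [hW.cont, hW.eval_zero_ae_eq_zero] with ω hω h0
    have hx : Continuous fun y : ℝ≥0 => u + √2 * W y ω - 2 * β * y := by fun_prop
    by_cases hne : (hitTimes W (fun y => 2 * β * y) u ω).Nonempty
    -- on a path that hits the line, the stopped martingale is eventually constant in the cap
    · have hne' : ω ∈ {ω | (hitTimes W (fun y => 2 * β * y) u ω).Nonempty} := hne
      apply tendsto_const_nhds.congr'
      obtain ⟨n₀, hn₀⟩ := exists_nat_ge (sInf (hitTimes W (fun y => 2 * β * y) u ω))
      filter_upwards [eventually_ge_atTop n₀] with n hn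
      have hle : sInf (hitTimes W (fun y => 2 * β * y) u ω) ≤ (n : ℝ≥0) + 1 :=
        (hn₀.trans (Nat.cast_le.2 hn)).trans le_self_add
      rw [hF, indicator_of_mem hne', cappedInf, if_pos hne,
        min_eq_right hle]
      have hz := eq_zero_sInf hx (by simpa [h0] using hu) (by rwa [← hitTimes_line])
      rw [← hitTimes_line] at hz
      have hz' : u + √2 * W (sInf (hitTimes W (fun y => 2 * β * y) u ω)) ω =
        2 * β * sInf (hitTimes W (fun y => 2 * β * y) u ω) := by linarith
      rw [expMartingale, hz']
      congr 1
      push_cast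
      ring
    -- on a path that never hits it, the factor `exp (-λ T)` makes the martingale vanish
    · have hne' : ω ∉ {ω | (hitTimes W (fun y => 2 * β * y) u ω).Nonempty} := hne
      rw [hF, indicator_of_notMem hne']
      have hcap : ∀ T, cappedInf (hitTimes W (fun y => 2 * β * y) u ω) T = T := fun T => by
        rw [cappedInf, if_neg hne]
      refine squeeze_zero_norm (fun n => norm_expMartingale_cappedInf_le (β := β) hu hr _ hω h0) ?_
      simp_rw [hcap]
      refine Real.tendsto_exp_atBot.comp ?_
      refine Tendsto.const_mul_atTop_of_neg (neg_neg_of_pos hl) ?_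
      push_cast
      exact tendsto_atTop_add_const_right _ _ tendsto_natCast_atTop_atTop
  refine ⟨aestronglyMeasurable_of_tendsto_ae atTop (fun n => (hG n).1) hlim, ?_⟩
  have h := tendsto_integral_of_dominated_convergence (fun _ => (1 : ℝ)) (fun n => (hG n).1)
    (integrable_const _) (fun n => ?_) hlim
  · simp_rw [(hG _).2] at h
    exact tendsto_nhds_unique h tendsto_const_nhds
  · filter_upwards [hW.cont, hW.eval_zero_ae_eq_zero] with ω hω h0
    refine (norm_expMartingale_cappedInf_le hu hr _ hω h0).trans (Real.exp_le_one_iff.2 ?_)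
    have := mul_nonneg hl.le
      (cappedInf (hitTimes W (fun y => 2 * β * y) u ω) (n + 1)).coe_nonneg
    linarith

end Martingale

/-! ### The hitting kernel of a line -/

/-- The slope `6/5 + i` of the contour `w = 2 β + (6/5 + i) s`. As `6/5 > 1`, the real part of
`(w - 2 β) w` is positive on the contour. -/
def slantSlope : ℂ := ((6 / 5 : ℝ) : ℂ) + I

/-- The exponent `λ = r² + 2 β r` of the Laplace transform, at `r = (6/5 + i) s`. -/
def slantExponent (β s : ℝ) : ℂ := (slantSlope * s) ^ 2 + 2 * β * (slantSlope * s)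

lemma slantSlope_mul_re (s : ℝ) : (slantSlope * s).re = 6 / 5 * s := by
  simp [slantSlope]

lemma slantExponent_re (β s : ℝ) : (slantExponent β s).re = 11 / 25 * s ^ 2 + 12 / 5 * β * s := by
  simp [slantExponent, slantSlope, pow_two]
  ring

lemma slantExponent_re_pos {β : ℝ} (hβ : 0 ≤ β) {s : ℝ} (hs : 0 < s) :
    0 < (slantExponent β s).re := by
  rw [slantExponent_re]; positivity

/-- The kernel of `S_{-t}` started from the line at time `t`, as an integral over the slanted
contour in which `t` enters only through `exp (-λ t)`. -/
lemma sKernel_neg_line (β t v : ℝ) :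
    sKernel (-t) (2 * β * t) v = 1 / Real.pi * (∫ s : ℝ in Ioi 0,
      airyPhase v (2 * β + slantSlope * s) * slantSlope * cexp (-slantExponent β s * t)).im := by
  rw [sKernel, (airyAi_eq_slanted _ (2 * β - t)).2, mul_left_comm]
  congr 1
  rw [rayIntegral, ← Complex.im_ofReal_mul, ← integral_const_mul]
  congr 1
  refine integral_congr_ae (ae_of_all _ fun s => ?_)
  simp only [airyPhase, slantSlope, slantExponent]
  rw [mul_right_comm (cexp _), ← Complex.exp_add, ofReal_exp, ← mul_assoc, ← Complex.exp_add]
  congr 2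
  push_cast
  ring

section HittingKernel

variable {Ω : Type*} [MeasurableSpace Ω] {P : Measure Ω} {W : ℝ≥0 → Ω → ℝ}

lemma hypoIntegrand_line_of_nonpos (hW : IsBrownianReal W P) {β u : ℝ} (hu : u ≤ 0) (v : ℝ) :
    hypoIntegrand W (fun y => 2 * β * y) 0 u v =ᵐ[P] fun _ => sKernel 0 u v := by
  filter_upwards [hW.eval_zero_ae_eq_zero] with ω h0
  have hmem : (0 : ℝ≥0) ∈ hitTimes W (fun y => 2 * β * y) u ω := by
    simpa [hitTimes, h0] using hu
  have hinf : sInf (hitTimes W (fun y => 2 * β * y) u ω) = 0 :=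
    le_antisymm (csInf_le (OrderBot.bddBelow _) hmem) zero_le
  rw [hypoIntegrand, if_pos ⟨0, hmem⟩]
  simp [hinf, h0]

lemma hypoIntegrand_line_of_pos (hW : IsBrownianReal W P) {β u : ℝ} (hu : 0 < u) (v : ℝ) :
    hypoIntegrand W (fun y => 2 * β * y) 0 u v =ᵐ[P]
      {ω | (hitTimes W (fun y => 2 * β * y) u ω).Nonempty}.indicator fun ω =>
        sKernel (-(sInf (hitTimes W (fun y => 2 * β * y) u ω) : ℝ≥0))
          (2 * β * sInf (hitTimes W (fun y => 2 * β * y) u ω)) v := by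
  filter_upwards [hW.cont, hW.eval_zero_ae_eq_zero] with ω hω h0
  have hx : Continuous fun y : ℝ≥0 => u + √2 * W y ω - 2 * β * y := by fun_prop
  by_cases hne : (hitTimes W (fun y => 2 * β * y) u ω).Nonempty
  · have hne' : ω ∈ {ω | (hitTimes W (fun y => 2 * β * y) u ω).Nonempty} := hne
    have hz := eq_zero_sInf hx (by simpa [h0] using hu) (by rwa [← hitTimes_line])
    rw [← hitTimes_line] at hz
    rw [indicator_of_mem hne', hypoIntegrand, if_pos hne, ← sub_eq_zero.1 hz, ← zero_sub]
  · have hne' : ω ∉ {ω | (hitTimes W (fun y => 2 * β * y) u ω).Nonempty} := hne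
    rw [indicator_of_notMem hne', hypoIntegrand, if_neg hne]

/-- The Laplace transform of the hitting time, integrated against a function on the contour. The
integrand is jointly measurable as it is a function of `s` and of `1{τ < ∞} exp (-τ)`. -/
lemma integrable_mul_cexp_sInf_hitTimes (hW : IsBrownianReal W P) {β u : ℝ} (hβ : 0 ≤ β)
    (hu : 0 < u) {Φ : ℝ → ℂ} (hΦ : IntegrableOn Φ (Ioi 0)) :
    Integrable (fun p : Ω × ℝ =>
      {ω | (hitTimes W (fun y => 2 * β * y) u ω).Nonempty}.indicator (fun ω =>
        Φ p.2 * cexp (-slantExponent β p.2 * sInf (hitTimes W (fun y => 2 * β * y) u ω))) p.1)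
      (P.prod (volume.restrict (Ioi 0))) := by
  have := hW.isGaussianProcess.isProbabilityMeasure
  let H : Ω → Set ℝ≥0 := fun ω => hitTimes W (fun y => 2 * β * y) u ω
  -- `r = √(β² + 1) - β` solves `r² + 2 β r = 1`
  let r : ℝ := √(β ^ 2 + 1) - β
  have hr : 0 ≤ r := sub_nonneg.2 (Real.le_sqrt_of_sq_le (by linarith))
  have hr1 : ((r : ℂ) ^ 2 + 2 * β * r) = 1 := by
    have h : r ^ 2 + 2 * β * r = 1 := by
      have := Real.sq_sqrt (show 0 ≤ β ^ 2 + 1 by positivity)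
      simp only [r]; linear_combination this
    exact_mod_cast congrArg (fun x : ℝ => (x : ℂ)) h
  have hq := (integral_cexp_sInf_hitTimes hW (β := β) hu (r := r) (by simpa using hr)
    (by rw [hr1]; simp)).1
  let q : Ω → ℝ := {ω | (H ω).Nonempty}.indicator fun ω => Real.exp (-sInf (H ω))
  have hqm : AEMeasurable q P := by
    refine hq.norm.aemeasurable.congr (ae_of_all _ fun ω => ?_)
    by_cases h : (H ω).Nonempty
    · have h' : ω ∈ {ω | (H ω).Nonempty} := h
      simp only [q]
      rw [indicator_of_mem h', indicator_of_mem h', hr1, Complex.norm_exp]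
      simp [H]
    · have h' : ω ∉ {ω | (H ω).Nonempty} := h
      simp only [q]
      rw [indicator_of_notMem h', indicator_of_notMem h', norm_zero]
  let g : ℝ × ℝ → ℂ := {p | 0 < p.1}.indicator fun p =>
    cexp (slantExponent β p.2 * (Real.log p.1 : ℂ))
  have hg : Measurable g := by
    refine Measurable.indicator ?_ (measurableSet_lt measurable_const measurable_fst)
    unfold slantExponent
    fun_prop
  have heq : (fun p : Ω × ℝ => {ω | (H ω).Nonempty}.indicator (fun ω =>
      Φ p.2 * cexp (-slantExponent β p.2 * sInf (H ω))) p.1) =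
      fun p : Ω × ℝ => Φ p.2 * g (q p.1, p.2) := by
    ext ⟨ω, s⟩
    by_cases h : (H ω).Nonempty
    · have h' : ω ∈ {ω | (H ω).Nonempty} := h
      have hqv : q ω = Real.exp (-sInf (H ω)) := indicator_of_mem h' _
      have hgm : (q ω, s) ∈ {p : ℝ × ℝ | 0 < p.1} := by
        rw [mem_ofPred_eq, hqv]; positivity
      simp only [g]
      rw [indicator_of_mem h', indicator_of_mem hgm]
      simp only [hqv, Real.log_exp]
      push_cast
      ring_nf
    · have h' : ω ∉ {ω | (H ω).Nonempty} := h
      have hqv : q ω = 0 := indicator_of_notMem h' _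
      have hgm : (q ω, s) ∉ {p : ℝ × ℝ | 0 < p.1} := by simp [hqv]
      simp only [g]
      rw [indicator_of_notMem h', indicator_of_notMem hgm, mul_zero]
  have hΦp : Integrable (fun p : Ω × ℝ => Φ p.2) (P.prod (volume.restrict (Ioi 0))) :=
    hΦ.comp_snd P
  refine hΦp.mono (heq ▸ ?_) ?_
  · refine hΦp.1.mul (AEMeasurable.aestronglyMeasurable ?_)
    exact hg.comp_aemeasurable ((hqm.comp_fst).prodMk measurable_snd.aemeasurable)
  · have hae : ∀ᵐ p ∂(P.prod (volume.restrict (Ioi (0 : ℝ)))), p.2 ∈ Ioi (0 : ℝ) :=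
      Measure.quasiMeasurePreserving_snd.ae (ae_restrict_mem measurableSet_Ioi)
    filter_upwards [hae] with p hp
    refine norm_indicator_le_norm_self _ _ |>.trans ?_
    rw [norm_mul, Complex.norm_exp]
    refine mul_le_of_le_one_right (norm_nonneg _) (Real.exp_le_one_iff.2 ?_)
    have := mul_nonneg (slantExponent_re_pos hβ hp).le (sInf (H p.1)).coe_nonneg
    simp only [mul_re, neg_re, ofReal_re, ofReal_im, mul_zero, sub_zero]
    linarith

lemma integral_integral_mul_cexp_sInf_hitTimes (hW : IsBrownianReal W P) {β u : ℝ} (hβ : 0 ≤ β)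
    (hu : 0 < u) {Φ : ℝ → ℂ} (hΦ : IntegrableOn Φ (Ioi 0)) :
    ∫ ω, (∫ s in Ioi 0, {ω | (hitTimes W (fun y => 2 * β * y) u ω).Nonempty}.indicator (fun ω =>
        Φ s * cexp (-slantExponent β s * sInf (hitTimes W (fun y => 2 * β * y) u ω))) ω) ∂P =
      ∫ s in Ioi 0, Φ s * cexp (-(slantSlope * s) * u) := by
  have := hW.isGaussianProcess.isProbabilityMeasure
  rw [integral_integral_swap (integrable_mul_cexp_sInf_hitTimes hW hβ hu hΦ)]
  refine setIntegral_congr_fun measurableSet_Ioi fun s hs => ?_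
  have hl := slantExponent_re_pos hβ hs
  have hr : 0 ≤ (slantSlope * s).re := by
    rw [slantSlope_mul_re]; exact mul_nonneg (by norm_num) (mem_Ioi.1 hs).le
  rw [← (integral_cexp_sInf_hitTimes hW hu hr hl).2, ← integral_const_mul]
  congr 1 with ω
  simp only [indicator, slantExponent]
  split_ifs <;> simp

/-- The hitting kernel of the line, started above it: the reflected Airy kernel. -/
lemma hypoKernel_line_of_pos (hW : IsBrownianReal W P) {β u : ℝ} (hβ : 0 ≤ β) (hu : 0 < u)
    (v : ℝ) : Integrable (hypoIntegrand W (fun y => 2 * β * y) 0 u v) P ∧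
      hypoKernel P W (fun y => 2 * β * y) 0 u v = Real.exp (2 * β * u) * airyAi (u + v) := by
  have := hW.isGaussianProcess.isProbabilityMeasure
  let Φ : ℝ → ℂ := fun s => airyPhase v (2 * β + slantSlope * s) * slantSlope
  have hΦ : IntegrableOn Φ (Ioi 0) := by
    have h := (airyAi_eq_slanted v (2 * β)).1
    rw [Complex.ofReal_mul, Complex.ofReal_ofNat] at h
    exact h
  have hint := (integrable_mul_cexp_sInf_hitTimes hW hβ hu hΦ).integral_prod_left
  have hval := integral_integral_mul_cexp_sInf_hitTimes hW hβ hu hΦ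
  set J : Ω → ℂ := fun ω => ∫ s in Ioi 0,
    {ω | (hitTimes W (fun y => 2 * β * y) u ω).Nonempty}.indicator (fun ω =>
      Φ s * cexp (-slantExponent β s * sInf (hitTimes W (fun y => 2 * β * y) u ω))) ω with hJ
  have heq : hypoIntegrand W (fun y => 2 * β * y) 0 u v =ᵐ[P] fun ω => 1 / Real.pi * (J ω).im := by
    refine (hypoIntegrand_line_of_pos hW hu v).trans (ae_of_all _ fun ω => ?_)
    by_cases h : (hitTimes W (fun y => 2 * β * y) u ω).Nonempty
    · have h' : ω ∈ {ω | (hitTimes W (fun y => 2 * β * y) u ω).Nonempty} := h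
      rw [indicator_of_mem h', sKernel_neg_line]
      simp only [hJ, indicator_of_mem h', Φ]
    · have h' : ω ∉ {ω | (hitTimes W (fun y => 2 * β * y) u ω).Nonempty} := h
      rw [indicator_of_notMem h']
      simp only [hJ, indicator_of_notMem h']
      simp
  have hJi : Integrable J P := hint
  refine ⟨(hJi.im.const_mul _).congr heq.symm, ?_⟩
  rw [hypoKernel, integral_congr_ae heq, integral_const_mul]
  have him : ∫ ω, (J ω).im ∂P = (∫ ω, J ω ∂P).im := Complex.imCLM.integral_comp_comm hJi
  rw [him, hval, (airyAi_eq_slanted (u + v) (2 * β)).2, mul_left_comm]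
  congr 1
  rw [rayIntegral, ← Complex.im_ofReal_mul, ← integral_const_mul]
  congr 1
  refine integral_congr_ae (ae_of_all _ fun s => ?_)
  simp only [Φ, airyPhase, slantSlope]
  rw [mul_right_comm, ← Complex.exp_add, ofReal_exp, ← mul_assoc, ← Complex.exp_add]
  congr 2
  push_cast
  ring

lemma hypoKernel_line_of_nonpos (hW : IsBrownianReal W P) {β u : ℝ} (hu : u ≤ 0)
    (v : ℝ) : Integrable (hypoIntegrand W (fun y => 2 * β * y) 0 u v) P ∧
      hypoKernel P W (fun y => 2 * β * y) 0 u v = sKernel 0 u v := by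
  have := hW.isGaussianProcess.isProbabilityMeasure
  have h := hypoIntegrand_line_of_nonpos hW (β := β) hu v
  refine ⟨(integrable_const _).congr h.symm, ?_⟩
  rw [hypoKernel, integral_congr_ae h]
  simp

lemma integrable_hypoIntegrand_line (hW : IsBrownianReal W P) {β : ℝ} (hβ : 0 ≤ β) (u v : ℝ) :
    Integrable (hypoIntegrand W (fun y => 2 * β * y) 0 u v) P := by
  rcases le_or_gt u 0 with hu | hu
  · exact (hypoKernel_line_of_nonpos hW hu v).1
  · exact (hypoKernel_line_of_pos hW hβ hu v).1

lemma kernelConverges_sKernel_zero {φ : ℝ → ℂ} (hφ : MemLp φ 2 (volume : Measure ℝ)) {a : ℝ}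
    (ha : ∀ v ≤ a, φ v = 0) : KernelConverges (sKernel 0) φ := fun u => by
  simp_rw [sKernel_zero]
  exact integrable_airyInt hφ ha 0 u

lemma hypoKernel_mul_of_pos (hW : IsBrownianReal W P) {β u : ℝ} (hβ : 0 ≤ β) (hu : 0 < u)
    (φ : ℝ → ℂ) (v : ℝ) :
    (hypoKernel P W (fun y => 2 * β * y) 0 u v : ℂ) * φ v =
      (Real.exp (2 * β * u) : ℂ) * ((airyAi (v - -u + 0) : ℂ) * φ v) := by
  rw [(hypoKernel_line_of_pos hW hβ hu v).2, show v - -u + 0 = u + v by ring]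
  push_cast
  ring

lemma kernelConverges_hypoKernel_line (hW : IsBrownianReal W P) {β : ℝ} (hβ : 0 ≤ β) {φ : ℝ → ℂ}
    (hφ : MemLp φ 2 (volume : Measure ℝ)) {a : ℝ} (ha : ∀ v ≤ a, φ v = 0) :
    KernelConverges (hypoKernel P W (fun y => 2 * β * y) 0) φ := fun u => by
  rcases le_or_gt u 0 with hu | hu
  · simp_rw [fun v => (hypoKernel_line_of_nonpos hW (β := β) hu v).2]
    exact kernelConverges_sKernel_zero hφ ha u
  · simp_rw [hypoKernel_mul_of_pos hW hβ hu]
    exact (integrable_airyInt hφ ha 0 (-u)).const_mul _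

/-- `S - S^{hypo(h)}` for the line `h(y) = 2 β y` is `χ_0 (I - M_{2β} R) S`. -/
lemma opHit_line (hW : IsBrownianReal W P) {β : ℝ} (hβ : 0 ≤ β) (φ : ℝ → ℂ) :
    opHit P W (fun y => 2 * β * y) φ = (Ioi 0).indicator (reflDiff 0 β φ) := by
  ext u
  rw [opHit, Pi.sub_apply]
  rcases le_or_gt u 0 with hu | hu
  · rw [indicator_of_notMem (by simpa using hu), kernelOp, opS, kernelOp]
    simp_rw [fun v => (hypoKernel_line_of_nonpos hW (β := β) hu v).2]
    exact sub_self _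
  · rw [indicator_of_mem (mem_Ioi.2 hu), opS_zero, reflDiff, kernelOp]
    simp_rw [hypoKernel_mul_of_pos hW hβ hu]
    rw [integral_const_mul]
    rfl

end HittingKernel

/-! ### Projections, translations and the wedge `2 β |y|` -/

lemma leftHalf_hShock (β : ℝ) : leftHalf (hShock β) = fun y : ℝ≥0 => 2 * β * (y : ℝ) := by
  ext y; simp [leftHalf, hShock]

lemma rightHalf_hShock (β : ℝ) : rightHalf (hShock β) = fun y : ℝ≥0 => 2 * β * (y : ℝ) := by
  ext y; simp [rightHalf, hShock]

lemma proj_ae_eq (a : ℝ) (g : L2R) : proj a g =ᵐ[volume] (Ioi a).indicator g := by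
  refine (MemLp.coeFn_toLp (memLp_zeroExt _)).trans ?_
  have h := (ae_restrict_iff' measurableSet_Ioi).1
    (LpToLpRestrictCLM_coeFn (𝕜 := ℂ) (Ioi a) g)
  filter_upwards [h] with u hu
  by_cases hm : u ∈ Ioi a
  · rw [zeroExt, indicator_of_mem hm, indicator_of_mem hm]
    exact hu hm
  · rw [zeroExt, indicator_of_notMem hm, indicator_of_notMem hm]

lemma proj_comp_of_realizes {a b : ℝ} {V : L2Ioi a →L[ℂ] L2R} {F : (ℝ → ℂ) → ℝ → ℂ}
    (hV : Realizes V fun φ => (Ioi b).indicator (F φ)) : proj b ∘L V = V := by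
  ext1 f
  refine Lp.ext ((proj_ae_eq b (V f)).trans ?_)
  filter_upwards [hV f] with u hu
  by_cases hm : u ∈ Ioi b
  · rw [indicator_of_mem hm]
  · rw [indicator_of_notMem hm, hu, indicator_of_notMem hm]

lemma shift_ae_eq {l a b : ℝ} (h : b = a + l) (f : L2Ioi b) :
    shift l h f =ᵐ[volume.restrict (Ioi a)] fun u => f (u + l) :=
  Lp.coeFn_compMeasurePreserving f (measurePreserving_shift h)

lemma zeroExt_shift_ae_eq {l a b : ℝ} (h : b = a + l) (f : L2Ioi b) :
    zeroExt (shift l h f) =ᵐ[volume] fun u => zeroExt f (u + l) := by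
  have h1 := (ae_restrict_iff' measurableSet_Ioi).1 (shift_ae_eq h f)
  filter_upwards [h1] with u hu
  have hiff : u ∈ Ioi a ↔ u + l ∈ Ioi b := by simp [h]
  by_cases hm : u ∈ Ioi a
  · rw [zeroExt, zeroExt, indicator_of_mem hm, indicator_of_mem (hiff.1 hm), hu hm]
  · rw [zeroExt, zeroExt, indicator_of_notMem hm, indicator_of_notMem (mt hiff.2 hm)]

lemma adjoint_shift_comp_self {l a b : ℝ} (h : b = a + l) :
    (shift l h).adjoint ∘L shift l h = 1 :=
  (ContinuousLinearMap.norm_map_iff_adjoint_comp_self _).1 fun f =>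
    (Lp.compMeasurePreservingₗᵢ ℂ (fun u : ℝ => u + l) (measurePreserving_shift h)).norm_map f

/-- The equations `h`, `h'` make the two translations opposite. -/
lemma shift_comp_shift_neg {l l' a b : ℝ} (h : b = a + l) (h' : a = b + l') :
    shift l h ∘L shift l' h' = 1 := by
  ext1 f
  refine Lp.ext ((shift_ae_eq h _).trans ?_)
  have h1 := (measurePreserving_shift h).quasiMeasurePreserving.ae_eq_comp (shift_ae_eq h' f)
  filter_upwards [h1] with u hu
  have hu' : shift l' h' f (u + l) = f (u + l + l') := hu
  rw [show u + l + l' = u by linarith] at hu'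
  exact hu'

lemma adjoint_shift {l l' a b : ℝ} (h : b = a + l) (h' : a = b + l') :
    (shift l h).adjoint = shift l' h' := by
  calc _ = (shift l h).adjoint ∘L (shift l h ∘L shift l' h') := by
        rw [shift_comp_shift_neg]; rfl
    _ = shift l' h' := by
        rw [← ContinuousLinearMap.comp_assoc, adjoint_shift_comp_self]; rfl

/-- Precomposition with a translation changes the parameter of `exp (∂³/3 - c ∂)` and leaves the
projection and the reflection, which act on the output, in place. -/
lemma realizes_comp_shift {a b β c : ℝ} (h : a = b + -c) {V : L2Ioi b →L[ℂ] L2R}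
    (hV : Realizes V fun φ => (Ioi 0).indicator (reflDiff 0 β φ)) :
    Realizes (V ∘L shift (-c) h) fun φ => (Ioi 0).indicator (reflDiff c β φ) := by
  intro f
  refine (hV (shift (-c) h f)).trans (Eventually.of_forall fun u => ?_)
  have h1 : reflDiff 0 β (zeroExt (shift (-c) h f)) = reflDiff c β (zeroExt f) := by
    rw [reflDiff_congr_ae (zeroExt_shift_ae_eq h f)]
    ext u
    rw [reflDiff, reflDiff, airyInt_comp_shift, airyInt_comp_shift, zero_add]
  simp only [h1]

end SoftShock

end

theorem lemma4p3 {Ω : Type*} [MeasurableSpace Ω] (P : Measure Ω) [IsProbabilityMeasure P]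
    (W : ℝ≥0 → Ω → ℝ) (hW : IsBrownianReal W P) (β : ℝ) (hβ : 0 ≤ β) (a : ℝ) :
    -- the expectations and the integrals in the definitions of the operators converge absolutely
    (∀ u v : ℝ, Integrable (hypoIntegrand W (leftHalf (hShock β)) 0 u v) P ∧
      Integrable (hypoIntegrand W (rightHalf (hShock β)) 0 u v) P) ∧
    (∀ f : L2Ioi (a + β ^ 2),
      KernelConverges (sKernel 0) (zeroExt f) ∧
      KernelConverges (hypoKernel P W (leftHalf (hShock β)) 0) (zeroExt f) ∧
      KernelConverges (hypoKernel P W (rightHalf (hShock β)) 0) (zeroExt f)) ∧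
    (∀ f : L2Ioi a, ∀ g : ℝ → ℂ, g = opM (-β) (zeroExt f) →
      KernelConverges (sKernel 0) g ∧
      KernelConverges (transposeKernel (sKernel 0)) (opR (opS 0 g)) ∧
      KernelConverges (sKernel β) g ∧
      KernelConverges (transposeKernel (sKernel (-β)))
        (chiBar 0 (opS β g - opR (opS β g)))) ∧
    -- `A = S^* R S` has the GOE kernel
    (∀ f : L2Ioi a,
      KernelConverges goeKernel (zeroExt f) ∧
      opA (zeroExt f) = kernelOp goeKernel (zeroExt f)) ∧
    -- `S - S^{hypo(h)}` and `M_β (A + E_β) M_{-β}` are bounded operators into `L²(ℝ)`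
    Realizes (toL2 (opHit P W (leftHalf (hShock β))) (a + β ^ 2))
      (opHit P W (leftHalf (hShock β))) ∧
    Realizes (toL2 (opHit P W (rightHalf (hShock β))) (a + β ^ 2))
      (opHit P W (rightHalf (hShock β))) ∧
    Realizes (toL2 (opX β) a) (opX β) ∧
    -- the factorization, on `L²(a, ∞)`
    1 - shift (β ^ 2) (a := a) (b := a + β ^ 2) rfl ∘L
          opK P W β (a + β ^ 2) ∘L
          shift (-β ^ 2) (a := a + β ^ 2) (b := a) (by ring) =
      ((incl a).toContinuousLinearMap - toL2 (opX β) a).adjoint ∘L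
        ((incl a).toContinuousLinearMap - toL2 (opX β) a) := by
  obtain ⟨V, hV⟩ := exists_realizes_reflDiff (c := 0) le_rfl hβ (a + β ^ 2)
  have hVS := realizes_comp_shift (c := β ^ 2) (a := a) (by ring) hV
  have hHit : Realizes V (opHit P W (fun y => 2 * β * y)) := fun f => by
    rw [opHit_line hW hβ]; exact hV f
  have hX := realizes_opX hβ hVS
  simp only [leftHalf_hShock, rightHalf_hShock]
  refine ⟨fun u v => ⟨integrable_hypoIntegrand_line hW hβ u v,
    integrable_hypoIntegrand_line hW hβ u v⟩, fun f => ?_, ?_, fun f => ?_, ?_, ?_, ?_, ?_⟩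
  · have hc := kernelConverges_hypoKernel_line hW hβ (memLp_zeroExt f) (zeroExt_eq_zero f)
    exact ⟨kernelConverges_sKernel_zero (memLp_zeroExt f) (zeroExt_eq_zero f), hc, hc⟩
  · rintro f g rfl
    obtain ⟨hg, hga⟩ := memLp_opM_neg hβ (memLp_zeroExt f) (zeroExt_eq_zero f)
    refine ⟨kernelConverges_sKernel_zero hg hga, (opA_eq_kernelOp hg hga).2.2, fun u => ?_,
      fun u => ?_⟩
    · simp_rw [sKernel_mul_opM]
      exact (integrable_airyInt (memLp_zeroExt f) (zeroExt_eq_zero f) _ u).const_mul _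
    · simp_rw [transposeKernel_mul_chiBar]
      have hm := memLp_reflDiff (sq_nonneg β) hβ (memLp_zeroExt f) (zeroExt_eq_zero f)
      exact (integrable_airyAi_sub_mul _ u one_pos (integrable_exp_mul_chiBar hm)
        (hm.1.indicator measurableSet_Iic)).const_mul _
  · obtain ⟨h1, h2, -⟩ := opA_eq_kernelOp (memLp_zeroExt f) (zeroExt_eq_zero f)
    exact ⟨h1, h2⟩
  · rwa [toL2_eq_of_realizes hHit]
  · rwa [toL2_eq_of_realizes hHit]
  · rwa [toL2_eq_of_realizes hX]
  · have hadj : shift (β ^ 2) (a := a) (b := a + β ^ 2) rfl =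
        (shift (-β ^ 2) (a := a + β ^ 2) (b := a) (by ring)).adjoint :=
      (adjoint_shift _ _).symm
    have hSS := adjoint_shift_comp_self (l := -β ^ 2) (a := a + β ^ 2) (b := a) (by ring)
    have hpV : proj 0 ∘L V = V := proj_comp_of_realizes hV
    rw [toL2_eq_of_realizes hX, sub_sub_cancel, opK, hittingOperator, leftHalf_hShock,
      rightHalf_hShock, toL2_eq_of_realizes hHit, show hShock β 0 = 0 by simp [hShock], hpV, hadj]
    set S : L2Ioi a →L[ℂ] L2Ioi (a + β ^ 2) := shift (-β ^ 2) (by ring)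
    set U : L2R →L[ℂ] L2R :=
      (airyTransform (β ^ 2)).symm.toContinuousLinearEquiv.toContinuousLinearMap
    have hUU : U.adjoint ∘L U = 1 := (ContinuousLinearMap.norm_map_iff_adjoint_comp_self U).1
      (airyTransform (β ^ 2)).symm.norm_map
    have hleft : 1 - S.adjoint ∘L (1 - V.adjoint ∘L V) ∘L S =
        S.adjoint ∘L V.adjoint ∘L V ∘L S := by
      have hone : (1 : L2Ioi (a + β ^ 2) →L[ℂ] L2Ioi (a + β ^ 2)) ∘L S = S := rfl
      rw [ContinuousLinearMap.sub_comp, ContinuousLinearMap.comp_sub, hone, hSS]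
      exact sub_sub_cancel _ _
    have hUVS : (U ∘L V ∘L S).adjoint ∘L (U ∘L V ∘L S) =
        S.adjoint ∘L V.adjoint ∘L (U.adjoint ∘L U) ∘L V ∘L S := by
      simp only [ContinuousLinearMap.adjoint_comp, ContinuousLinearMap.comp_assoc]
    exact hleft.trans (by rw [hUVS, hUU]; rfl)
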